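/- **Model.** $P$ asynchronous processes share ordinary CAS objects, i.e. objects with the atomic operations Read and CAS only. Each object holds either one value from an arbitrary nonempty set $V$ (which the program can copy, and compare only through CAS) or one record of three natural numbers. Each process has a private memory with integer and value cells and executes one fixed program text, whose instructions are: assignments and conditional jumps over integer expressions built from constants, (indirect) loads, addition and truncated subtraction; copying of value cells; Read and CAS on a shared object; and return. Each instruction, local or shared, is one step. Any process that is not in the middle of an operation may invoke a new one at any time, and the steps of different processes are interleaved arbitrarily; there are no crashes. An *array of $M$ writable CAS objects* stores $\sigma\in V^M$ and supports, for $1\le j\le M$: Read$(j)$, which returns $\sigma_j$; CAS$(j,a,b)$, which replaces $\sigma_j$ by $b$ and returns true if $\sigma_j=a$, and otherwise returns false without changing anything; and Write$(j,b)$, which sets $\sigma_j:=b$. **Theorem.** There are a program text, implementing the three operations Read, CAS and Write, and constants $C,k$ such that for all $P,M\ge 0$ there are $N_1,N_2$ with $N_1+N_2\le C\,(M+P^2)$, initial contents for $N_2$ CAS objects holding records and initial integer private memories for the $P$ processes (zero at all addresses $\ge C(P+1)$) for which the following holds. For every nonempty set $V$ and every $\sigma_0\in V^M$, one can choose the initial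 contents of $N_1$ further CAS objects holding values, and of the private value cells, such that with these $N_1+N_2$ CAS objects: 1. (Linearizability) The history of every finite execution is linearizable with respect to the array of $M$ writable CAS objects with initial contents $\sigma_0$. 2. (Constant worst-case step complexity) In every execution, every operation returns at the latest with the $k$-th instruction, local or shared, that its process executes for it. 3. (Constant computation delay) Let $A'$ be any concurrent program for $P$ processes that communicate through $M$ shared locations with initial contents $\sigma_0$ and atomic Read, Write and CAS. Let $A$ be obtained from $A'$ by keeping local instructions and replacing each shared access by a call of the corresponding implemented operation, so that $A$ uses no shared writes. Then in every execution of $A$ each replaced access takes at most $k$ instructions; and for every finite execution $E$ of $A$ there is an execution $E'$ of $A'$ that performs exactly the accesses completed in $E$, with the same responses, and possibly some of those pending at the end of $E$, in an order in which an access that was completed in $E$ before another one was invoked precedes it. At the end of $E'$ each process that is not in the middle of an access in $E$ has the same local state as in $E$, and each other process is in its local state before or after its pending access. -/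

import Mathlib

/-! ## Arrays of writable CAS objects: sequential specification -/

universe u v

namespace WritableCAS

/-- The operations of an array of `M` writable CAS objects with values in `V`. -/
inductive Op (M : ℕ) (V : Type u) where
  | read (j : Fin M)
  | cas (j : Fin M) (old new : V)
  | write (j : Fin M) (v : V)

/-- Responses: a value (to a `read`), a success flag (to a `cas`), an acknowledgement
(to a `write`). -/
inductive Ret (V : Type u) where
  | value (v : V)
  | flag (b : Bool)
  | ack

open Classical in
/-- The atomic effect of an operation on the contents of the array, and its response. -/
noncomputable def Op.apply {M : ℕ} {V : Type u} : Op M V → (Fin M → V) → (Fin M → V) × Ret V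
  | .read j, σ => (σ, .value (σ j))
  | .cas j old new, σ =>
      if σ j = old then (Function.update σ j new, .flag true) else (σ, .flag false)
  | .write j v, σ => (Function.update σ j v, .ack)

/-! ## Histories and linearizations -/

/-- Invocation and response events of `P` processes. -/
inductive Event (P M : ℕ) (V : Type u) where
  | inv (i : Fin P) (op : Op M V)
  | res (i : Fin P) (r : Ret V)

/-- The process that an event belongs to. -/
def Event.proc {P M : ℕ} {V : Type u} : Event P M V → Fin P
  | .inv i _ => i
  | .res i _ => i

/-- The event at position `b` of the history `H` is the response, with result `r`, to the
invocation at position `a`. -/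
def IsResponse {P M : ℕ} {V : Type u} (H : List (Event P M V)) (a b : ℕ) (r : Ret V) : Prop :=
  a < b ∧ ∃ (i : Fin P) (op : Op M V),
    H[a]? = some (.inv i op) ∧ H[b]? = some (.res i r) ∧
    ∀ (c : ℕ) (e : Event P M V), a < c → c < b → H[c]? = some e → e.proc ≠ i

/-- An operation instance: the position of its invocation in a history, the process, the
operation, and a response. -/
structure Instance (P M : ℕ) (V : Type u) where
  pos : ℕ
  proc : Fin P
  op : Op M V
  ret : Ret V

/-- `L` is an arrangement, in a total order, of all completed operation instances of `H` with
their responses, and of some of the pending ones with responses of our choice; an operation that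
responded before another one was invoked comes before it. -/
structure IsLinearization {P M : ℕ} {V : Type u} (H : List (Event P M V))
    (L : List (Instance P M V)) : Prop where
  mem : ∀ x ∈ L, H[x.pos]? = some (.inv x.proc x.op)
  nodup : (L.map Instance.pos).Nodup
  complete : ∀ a b r, IsResponse H a b r → ∃ x ∈ L, x.pos = a
  response : ∀ x ∈ L, ∀ b r, IsResponse H x.pos b r → x.ret = r
  order : L.Pairwise fun x y => ∀ b r, IsResponse H y.pos b r → ¬ b < x.pos

/-- Executed one after the other from contents `σ`, the operations return the listed responses. -/
def Legal {P M : ℕ} {V : Type u} : (Fin M → V) → List (Instance P M V) → Prop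
  | _, [] => True
  | σ, x :: L => (x.op.apply σ).2 = x.ret ∧ Legal (x.op.apply σ).1 L

/-! ## Asynchronous random access machines that share ordinary CAS objects

The shared memory consists of ordinary CAS objects, with the operations Read and CAS only.
An object holds either one value from `V`, which is opaque to the machine, or one record of three
natural numbers. Each process has a private memory with integer and value cells. -/

/-- Integer expressions over the private memory; `load e` is the integer cell at address `e`. -/
inductive Expr where
  | const (n : ℕ)
  | load (e : Expr)
  | add (e f : Expr)
  | sub (e f : Expr)

def Expr.eval (m : ℕ → ℕ) : Expr → ℕ
  | .const n => n
  | .load e => m (e.eval m)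
  | .add e f => e.eval m + f.eval m
  | .sub e f => e.eval m - f.eval m

/-- Contents of a record object. -/
abbrev Rec := ℕ × ℕ × ℕ

/-- Instructions. Each of them is one step; a program text fixes the sizes of its expressions.
* `set d e`: integer cell `d` := `e`;
* `move d s`: value cell `d` := value cell `s`;
* `jumpEq e f t`, `jumpLt e f t`: go to `t` if `e = f`, if `e < f`;
* `readRec a d`: read record object `a` into the integer cells `d`, `d + 1`, `d + 2`;
* `casRec a o₁ o₂ o₃ n₁ n₂ n₃ d`: CAS on record object `a`, expected `(o₁, o₂, o₃)`,
  new `(n₁, n₂, n₃)`; integer cell `d` := 1 or 0 for success or failure;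
* `readVal a d`: read value object `a` into value cell `d`;
* `casVal a o n d`: CAS on value object `a`, expected and new value in the value cells `o`, `n`;
  integer cell `d` := 1 or 0 for success or failure;
* `retVal s`, `retFlag e`, `retAck`: return value cell `s`, the flag `e ≠ 0`, nothing. -/
inductive Instr where
  | set (d e : Expr)
  | move (d s : Expr)
  | jumpEq (e f : Expr) (t : ℕ)
  | jumpLt (e f : Expr) (t : ℕ)
  | readRec (a d : Expr)
  | casRec (a o₁ o₂ o₃ n₁ n₂ n₃ d : Expr)
  | readVal (a d : Expr)
  | casVal (a o n d : Expr)
  | retVal (s : Expr)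
  | retFlag (e : Expr)
  | retAck

/-- A program text with the entry points of the three operations. -/
structure Code where
  text : List Instr
  entryRead : ℕ
  entryCas : ℕ
  entryWrite : ℕ

/-- The shared memory: `N₁` CAS objects that hold values and `N₂` that hold records. -/
structure Shared (N₁ N₂ : ℕ) (V : Type u) where
  objs : Fin N₁ → V
  recs : Fin N₂ → Rec

/-- The private memory of a process. -/
structure Private (V : Type u) where
  ints : ℕ → ℕ
  vals : ℕ → V

/-- What a process does after an instruction: go on at a position of the text, or return. -/
inductive Next (V : Type u) where
  | goto (pc : ℕ)
  | done (r : Ret V)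

open Classical in
/-- Execution of one instruction at position `pc`. An access to an object that does not exist, and
an instruction beyond the end of the text, are faults: the process stays there for ever. -/
noncomputable def exec {N₁ N₂ : ℕ} {V : Type u} (code : Code) (s : Shared N₁ N₂ V)
    (p : Private V) (pc : ℕ) : Shared N₁ N₂ V × Private V × Next V :=
  match code.text[pc]? with
  | none => (s, p, .goto pc)
  | some (.set d e) =>
      (s, { p with ints := Function.update p.ints (d.eval p.ints) (e.eval p.ints) },
        .goto (pc + 1))
  | some (.move d c) =>
      (s, { p with vals := Function.update p.vals (d.eval p.ints) (p.vals (c.eval p.ints)) },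
        .goto (pc + 1))
  | some (.jumpEq e f t) =>
      (s, p, .goto (if e.eval p.ints = f.eval p.ints then t else pc + 1))
  | some (.jumpLt e f t) =>
      (s, p, .goto (if e.eval p.ints < f.eval p.ints then t else pc + 1))
  | some (.readRec a d) =>
      if h : a.eval p.ints < N₂ then
        let x := s.recs ⟨a.eval p.ints, h⟩
        let d' := d.eval p.ints
        let m := Function.update p.ints d' x.1
        let m := Function.update m (d' + 1) x.2.1
        let m := Function.update m (d' + 2) x.2.2
        (s, { p with ints := m }, .goto (pc + 1))
      else (s, p, .goto pc)
  | some (.casRec a o₁ o₂ o₃ n₁ n₂ n₃ d) =>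
      if h : a.eval p.ints < N₂ then
        if s.recs ⟨a.eval p.ints, h⟩ = (o₁.eval p.ints, o₂.eval p.ints, o₃.eval p.ints) then
          let y : Rec := (n₁.eval p.ints, n₂.eval p.ints, n₃.eval p.ints)
          ({ s with recs := Function.update s.recs ⟨a.eval p.ints, h⟩ y },
            { p with ints := Function.update p.ints (d.eval p.ints) 1 }, .goto (pc + 1))
        else
          (s, { p with ints := Function.update p.ints (d.eval p.ints) 0 }, .goto (pc + 1))
      else (s, p, .goto pc)
  | some (.readVal a d) =>
      if h : a.eval p.ints < N₁ then
        let x := s.objs ⟨a.eval p.ints, h⟩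
        (s, { p with vals := Function.update p.vals (d.eval p.ints) x }, .goto (pc + 1))
      else (s, p, .goto pc)
  | some (.casVal a o n d) =>
      if h : a.eval p.ints < N₁ then
        if s.objs ⟨a.eval p.ints, h⟩ = p.vals (o.eval p.ints) then
          let y : V := p.vals (n.eval p.ints)
          ({ s with objs := Function.update s.objs ⟨a.eval p.ints, h⟩ y },
            { p with ints := Function.update p.ints (d.eval p.ints) 1 }, .goto (pc + 1))
        else
          (s, { p with ints := Function.update p.ints (d.eval p.ints) 0 }, .goto (pc + 1))
      else (s, p, .goto pc)
  | some (.retVal c) => (s, p, .done (.value (p.vals (c.eval p.ints))))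
  | some (.retFlag e) => (s, p, .done (.flag (decide (e.eval p.ints ≠ 0))))
  | some .retAck => (s, p, .done .ack)

/-- Entry point of the code for an operation. -/
def Op.entry {M : ℕ} {V : Type u} (code : Code) : Op M V → ℕ
  | .read _ => code.entryRead
  | .cas _ _ _ => code.entryCas
  | .write _ _ => code.entryWrite

/-- Parameter passing: the index of the object goes to integer cell 0, the value arguments go to
the value cells 0 and 1. -/
def Op.pass {M : ℕ} {V : Type u} : Op M V → Private V → Private V
  | .read j, p => { p with ints := Function.update p.ints 0 (j : ℕ) }
  | .cas j old new, p =>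
      { ints := Function.update p.ints 0 (j : ℕ)
        vals := Function.update (Function.update p.vals 0 old) 1 new }
  | .write j v, p =>
      { ints := Function.update p.ints 0 (j : ℕ)
        vals := Function.update p.vals 0 v }

/-- A process is idle, or it is in the middle of a call: at position `pc` of the text, after
`n` instructions of this call. -/
inductive Control where
  | idle
  | running (pc n : ℕ)

/-- Configurations of `P` processes that share `N₁ + N₂` CAS objects. -/
structure Config (P N₁ N₂ : ℕ) (V : Type u) where
  shared : Shared N₁ N₂ V
  priv : Fin P → Private V
  ctrl : Fin P → Control

/-- One transition of the asynchronous machine, with the event (if any) that it emits: a process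
that is idle invokes an operation, or a process that is in a call executes one instruction. -/
inductive Step {P M N₁ N₂ : ℕ} {V : Type u} (code : Code) :
    Config P N₁ N₂ V → Option (Event P M V) → Config P N₁ N₂ V → Prop where
  | invoke (c : Config P N₁ N₂ V) (i : Fin P) (op : Op M V) (hi : c.ctrl i = .idle) :
      Step code c (some (.inv i op))
        { shared := c.shared
          priv := Function.update c.priv i (op.pass (c.priv i))
          ctrl := Function.update c.ctrl i (.running (op.entry code) 0) }
  | advance (c : Config P N₁ N₂ V) (i : Fin P) (pc n pc' : ℕ) (s : Shared N₁ N₂ V)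
      (p : Private V) (hi : c.ctrl i = .running pc n)
      (he : exec code c.shared (c.priv i) pc = (s, p, .goto pc')) :
      Step code c none
        { shared := s
          priv := Function.update c.priv i p
          ctrl := Function.update c.ctrl i (.running pc' (n + 1)) }
  | finish (c : Config P N₁ N₂ V) (i : Fin P) (pc n : ℕ) (r : Ret V) (s : Shared N₁ N₂ V)
      (p : Private V) (hi : c.ctrl i = .running pc n)
      (he : exec code c.shared (c.priv i) pc = (s, p, .done r)) :
      Step code c (some (.res i r))
        { shared := s
          priv := Function.update c.priv i p
          ctrl := Function.update c.ctrl i .idle }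

/-- `Exec code c₀ H c`: some finite execution from `c₀` ends in `c` and has the history `H`. -/
inductive Exec {P M N₁ N₂ : ℕ} {V : Type u} (code : Code) (c₀ : Config P N₁ N₂ V) :
    List (Event P M V) → Config P N₁ N₂ V → Prop where
  | start : Exec code c₀ [] c₀
  | step {H : List (Event P M V)} {c c' : Config P N₁ N₂ V} {e : Option (Event P M V)} :
      Exec code c₀ H c → Step code c e c' → Exec code c₀ (H ++ e.toList) c'

/-- Every history is linearizable with respect to the array with initial contents `σ₀`. -/
def Linearizable {P M N₁ N₂ : ℕ} {V : Type u} (code : Code) (c₀ : Config P N₁ N₂ V)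
    (σ₀ : Fin M → V) : Prop :=
  ∀ (H : List (Event P M V)) (c : Config P N₁ N₂ V), Exec code c₀ H c →
    ∃ L : List (Instance P M V), IsLinearization H L ∧ Legal σ₀ L

/-- In every execution, every operation returns at the latest with the `k`-th instruction that its
process executes for it, whatever the other processes do. (A process in a call can always execute
an instruction.) -/
def StepComplexityLE (M : ℕ) {P N₁ N₂ : ℕ} {V : Type u} (code : Code) (c₀ : Config P N₁ N₂ V)
    (k : ℕ) : Prop :=
  ∀ (H : List (Event P M V)) (c : Config P N₁ N₂ V), Exec code c₀ H c →
    ∀ (i : Fin P) (pc n : ℕ), c.ctrl i = .running pc n → n < k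

/-! ## Simulation of concurrent programs that use Read, Write and CAS -/

/-- The next instruction of a process: none, a local one, or an atomic access to the shared array
followed by a state that depends on the response. -/
inductive Action (M : ℕ) (V : Type u) (S : Type v) where
  | halt
  | tau (s : S)
  | access (op : Op M V) (cont : Ret V → S)

/-- A concurrent program for `P` processes that share `M` locations with atomic Read, Write and
CAS: initial local states, and the next instruction of each process in each local state. -/
structure Program (P M : ℕ) (V : Type u) (S : Type v) where
  start : Fin P → S
  act : Fin P → S → Action M V S

/-- Finite executions of the program itself: the sequence of accesses (process, operation,
response), the local states and the contents of the shared locations that are reached. -/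
inductive Program.AtomicExec {P M : ℕ} {V : Type u} {S : Type v} (A : Program P M V S)
    (σ₀ : Fin M → V) :
    List (Fin P × Op M V × Ret V) → (Fin P → S) → (Fin M → V) → Prop where
  | start : AtomicExec A σ₀ [] A.start σ₀
  | tau {T : List (Fin P × Op M V × Ret V)} {loc : Fin P → S} {σ : Fin M → V}
      (i : Fin P) (s : S) :
      AtomicExec A σ₀ T loc σ → A.act i (loc i) = .tau s →
      AtomicExec A σ₀ T (Function.update loc i s) σ
  | access {T : List (Fin P × Op M V × Ret V)} {loc : Fin P → S} {σ : Fin M → V}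
      (i : Fin P) (op : Op M V) (cont : Ret V → S) :
      AtomicExec A σ₀ T loc σ → A.act i (loc i) = .access op cont →
      AtomicExec A σ₀ (T ++ [(i, op, (op.apply σ).2)])
        (Function.update loc i (cont (op.apply σ).2)) (op.apply σ).1

/-- Finite executions of the simulation: local instructions are kept, and each access is replaced
by a call of the code, executed instruction by instruction. The local state of the original
program is updated when the call returns. -/
inductive Program.SimExec {P M N₁ N₂ : ℕ} {V : Type u} {S : Type v} (A : Program P M V S)
    (code : Code) (c₀ : Config P N₁ N₂ V) :
    List (Event P M V) → (Fin P → S) → Config P N₁ N₂ V → Prop where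
  | start : SimExec A code c₀ [] A.start c₀
  | tau {H : List (Event P M V)} {loc : Fin P → S} {c : Config P N₁ N₂ V}
      (i : Fin P) (s : S) :
      SimExec A code c₀ H loc c → c.ctrl i = .idle → A.act i (loc i) = .tau s →
      SimExec A code c₀ H (Function.update loc i s) c
  | call {H : List (Event P M V)} {loc : Fin P → S} {c c' : Config P N₁ N₂ V}
      (i : Fin P) (op : Op M V) (cont : Ret V → S) :
      SimExec A code c₀ H loc c → A.act i (loc i) = .access op cont →
      Step code c (some (.inv i op)) c' →
      SimExec A code c₀ (H ++ [.inv i op]) loc c'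
  | advance {H : List (Event P M V)} {loc : Fin P → S} {c c' : Config P N₁ N₂ V} :
      SimExec A code c₀ H loc c → Step (M := M) code c none c' →
      SimExec A code c₀ H loc c'
  | finish {H : List (Event P M V)} {loc : Fin P → S} {c c' : Config P N₁ N₂ V}
      (i : Fin P) (op : Op M V) (cont : Ret V → S) (r : Ret V) :
      SimExec A code c₀ H loc c → A.act i (loc i) = .access op cont →
      Step (M := M) code c (some (.res i r)) c' →
      SimExec A code c₀ (H ++ [.res i r]) (Function.update loc i (cont r)) c'

/-- Replacing the accesses of `A` by calls of the code is a `k`-computation-delay simulation of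
`A`: each access takes at most `k` instructions, and each execution of the simulation corresponds
to an execution of `A` with the same accesses and responses, in an order that respects the order
of the accesses in the simulation, and with the same local states (a process in the middle of an
access is in its local state before or after this access). -/
def Program.IsDelaySimulation {P M N₁ N₂ : ℕ} {V : Type u} {S : Type v} (A : Program P M V S)
    (code : Code) (c₀ : Config P N₁ N₂ V) (σ₀ : Fin M → V) (k : ℕ) : Prop :=
  ∀ (H : List (Event P M V)) (loc : Fin P → S) (c : Config P N₁ N₂ V),
    A.SimExec code c₀ H loc c →
    (∀ (i : Fin P) (pc n : ℕ), c.ctrl i = .running pc n → n < k) ∧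
    ∃ (L : List (Instance P M V)) (loc' : Fin P → S) (σ : Fin M → V),
      IsLinearization H L ∧
      A.AtomicExec σ₀ (L.map fun x => (x.proc, x.op, x.ret)) loc' σ ∧
      ∀ i : Fin P,
        (c.ctrl i = .idle → loc' i = loc i) ∧
        (c.ctrl i ≠ .idle → loc' i = loc i ∨
          ∃ (op : Op M V) (cont : Ret V → S) (r : Ret V),
            A.act i (loc i) = .access op cont ∧ loc' i = cont r)

end WritableCAS

/-! Each location holds a pointer to a value object and a count of the successful writes to it; the
count divides the life of the location into epochs. A read or CAS is executed on the value object of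
one epoch and is linearized in that epoch, even if the pointer has moved on by then. A write puts
its value into a private object and tries once to swing the pointer. Success ends the epoch. Failure
means that some other write ended the epoch after this one had read the pointer; the failed write is
placed directly before that other write, where nobody can observe it.

The difficulty is to recycle old value objects in constant time while slow readers may still access
them. A reader announces the location, not the object, with a fresh sequence number and an open
pointer field. It reads the pointer, tries to fill the field by CAS, and uses whatever object the
field then shows. A writer that meets an open announcement fills it by the same protocol. After
that, a delayed attempt to fill fails, because both the number and the open field are compared. So
after a scan of one announcement its owner threatens at most one object of the scanning writer,
namely the announced one. No threat to an owned object can arise anew, since threats arise only by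
reading a pointer and no pointer shows an owned object.

Each process owns `3 * P` objects in three parts of length `P`. In a phase of `P` successful writes
it uses up one of the first two parts, putting the replaced objects in their places, and scans one
announcement per write. The announced objects are moved to the third part, one place per announcing
process. At the end of the phase the other part has been checked against every process and is safe
to use next. An inverse table makes each move a constant amount of work, and all pools together take
`3 * P ^ 2` objects.

The proof has four layers. `Pool.Inv` and `State.Safe` express that the next object of a pool is
unreachable for everybody else; `State.Safe.step` shows that this persists. `State.Lin` adds a
linearization list in which late operations are inserted backwards. This works because the entries
behind the insertion point start, at that location, with a write (`LinInv.exists_insert`), and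
because the operation was invoked before those entries took effect (`Cut`). `Represents.step` shows
that the program text refines the transition system; as all jumps go forward, the length of the text
bounds the number of steps. Finally, `Program.isDelaySimulation_of_linearizable` derives the
simulation statement from linearizability alone, by merging the sequential runs of the processes in
the order of a linearization. -/

namespace WritableCAS

/-! ### Operations on a single location -/

/-- The location that an operation accesses. -/
def Op.loc {M : ℕ} {V : Type u} : Op M V → Fin M
  | .read j => j
  | .cas j _ _ => j
  | .write j _ => j

open Classical in
/-- The effect of an operation on the contents of its location, and its response. -/
noncomputable def Op.act {M : ℕ} {V : Type u} : Op M V → V → V × Ret V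
  | .read _, x => (x, .value x)
  | .cas _ a b, x => if x = a then (b, .flag true) else (x, .flag false)
  | .write _ v, _ => (v, .ack)

theorem Op.apply_eq {M : ℕ} {V : Type u} (op : Op M V) (σ : Fin M → V) :
    op.apply σ = (Function.update σ op.loc (op.act (σ op.loc)).1, (op.act (σ op.loc)).2) := by
  cases op with
  | read j => simp [Op.apply, Op.loc, Op.act]
  | cas j a b =>
    by_cases h : σ j = a
    · simp [Op.apply, Op.loc, Op.act, h]
    · simp [Op.apply, Op.loc, Op.act, h]
  | write j v => simp [Op.apply, Op.loc, Op.act]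

/-! ### Histories -/

section Histories

variable {P M : ℕ} {V : Type u}

/-- The invocation at position `a` is the last event of process `i`. -/
def Pending (H : List (Event P M V)) (i : Fin P) (a : ℕ) (op : Op M V) : Prop :=
  H[a]? = some (.inv i op) ∧ ∀ (c : ℕ) (e : Event P M V), a < c → H[c]? = some e → e.proc ≠ i

theorem Pending.lt {H : List (Event P M V)} {i : Fin P} {a : ℕ} {op : Op M V}
    (h : Pending H i a op) : a < H.length :=
  (List.getElem?_eq_some_iff.1 h.1).1

theorem Pending.unique {H : List (Event P M V)} {i : Fin P} {a a' : ℕ} {op op' : Op M V}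
    (h : Pending H i a op) (h' : Pending H i a' op') : a = a' ∧ op = op' := by
  have : a = a' := by
    rcases lt_trichotomy a a' with hl | hl | hl
    · exact absurd rfl (h.2 _ _ hl h'.1)
    · exact hl
    · exact absurd rfl (h'.2 _ _ hl h.1)
  subst this
  refine ⟨rfl, ?_⟩
  have := h.1.symm.trans h'.1
  simpa using this

theorem getElem?_append_singleton {α : Type*} (H : List α) (e : α) (a : ℕ) (x : α) :
    (H ++ [e])[a]? = some x ↔ H[a]? = some x ∨ (a = H.length ∧ x = e) := by
  rcases lt_trichotomy a H.length with h | h | h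
  · rw [List.getElem?_append_left h]
    constructor
    · exact Or.inl
    · rintro (h' | ⟨h', -⟩)
      · exact h'
      · omega
  · subst h
    simp [eq_comm]
  · have h1 : (H ++ [e])[a]? = none := List.getElem?_eq_none (by simp; omega)
    have h2 : H[a]? = none := List.getElem?_eq_none (by omega)
    rw [h1, h2]
    simp
    omega

theorem pending_append {H : List (Event P M V)} {e : Event P M V} {i : Fin P} {a : ℕ}
    {op : Op M V} : Pending (H ++ [e]) i a op ↔
      (e.proc ≠ i ∧ Pending H i a op) ∨ (a = H.length ∧ e = .inv i op) := by
  simp only [Pending, getElem?_append_singleton]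
  constructor
  · rintro ⟨h1 | ⟨h1, h1'⟩, h2⟩
    · have hl := (List.getElem?_eq_some_iff.1 h1).1
      exact .inl ⟨h2 _ _ hl (.inr ⟨rfl, rfl⟩), h1, fun c e' hc he => h2 c e' hc (.inl he)⟩
    · exact .inr ⟨h1, h1'.symm⟩
  · rintro (⟨h0, h1, h2⟩ | ⟨h1, h2⟩)
    · refine ⟨.inl h1, ?_⟩
      rintro c e' hc (he | ⟨-, rfl⟩)
      · exact h2 c e' hc he
      · exact h0
    · refine ⟨.inr ⟨h1, h2.symm⟩, ?_⟩
      rintro c e' hc (he | ⟨he, -⟩)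
      · have hl := (List.getElem?_eq_some_iff.1 he).1
        omega
      · omega

theorem isResponse_append {H : List (Event P M V)} {e : Event P M V} {a b : ℕ} {r : Ret V} :
    IsResponse (H ++ [e]) a b r ↔ IsResponse H a b r ∨
      (b = H.length ∧ ∃ i op, e = .res i r ∧ Pending H i a op) := by
  simp only [IsResponse, Pending, getElem?_append_singleton]
  constructor
  · rintro ⟨hab, i, op, h1, h2, h3⟩
    rcases h1 with h1 | ⟨h1, h1'⟩
    · rcases h2 with h2 | ⟨h2, h2'⟩
      · exact .inl ⟨hab, i, op, h1, h2, fun c e' hc hb he => h3 c e' hc hb (.inl he)⟩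
      · refine .inr ⟨h2, i, op, h2'.symm, h1, fun c e' hc he => h3 c e' hc ?_ (.inl he)⟩
        have hl := (List.getElem?_eq_some_iff.1 he).1
        omega
    · rcases h2 with h2 | ⟨h2, -⟩
      · have hl := (List.getElem?_eq_some_iff.1 h2).1
        omega
      · omega
  · rintro (⟨hab, i, op, h1, h2, h3⟩ | ⟨hb, i, op, h1, h2, h3⟩)
    · refine ⟨hab, i, op, .inl h1, .inl h2, ?_⟩
      rintro c e' hc hcb (he | ⟨he, -⟩)
      · exact h3 c e' hc hcb he
      · have hl := (List.getElem?_eq_some_iff.1 h2).1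
        omega
    · have hl := (List.getElem?_eq_some_iff.1 h2).1
      refine ⟨by omega, i, op, .inl h2, .inr ⟨hb, h1.symm⟩, ?_⟩
      rintro c e' hc hcb (he | ⟨he, -⟩)
      · exact h3 c e' hc he
      · omega

theorem IsResponse.lt {H : List (Event P M V)} {a b : ℕ} {r : Ret V}
    (h : IsResponse H a b r) : b < H.length := by
  obtain ⟨-, i, op, -, h2, -⟩ := h
  exact (List.getElem?_eq_some_iff.1 h2).1

theorem Pending.not_isResponse {H : List (Event P M V)} {i : Fin P} {a b : ℕ} {op : Op M V}
    {r : Ret V} (h : Pending H i a op) : ¬ IsResponse H a b r := by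
  rintro ⟨hab, i', op', h1, h2, -⟩
  have := h.1.symm.trans h1
  simp only [Option.some.injEq, Event.inv.injEq] at this
  exact h.2 b _ hab h2 this.1.symm

end Histories

/-! ### Linearization lists -/

/-- An entry of a linearization list: an operation instance, with a key that orders the entries
of its location, and the length of the history when it took effect. -/
structure Ent (P M : ℕ) (V : Type u) extends Instance P M V where
  key : ℕ
  stamp : ℕ

section Lists

variable {P M : ℕ} {V : Type u}

/-- The contents of a location after the given operations on it. -/
noncomputable def evalAt (x : V) (L : List (Ent P M V)) : V :=
  L.foldl (fun y z => (z.op.act y).1) x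

/-- Legality of a list of operations on one location. -/
def LegalAt : V → List (Ent P M V) → Prop
  | _, [] => True
  | x, z :: L => (z.op.act x).2 = z.ret ∧ LegalAt (z.op.act x).1 L

theorem evalAt_append (x : V) (L L' : List (Ent P M V)) :
    evalAt x (L ++ L') = evalAt (evalAt x L) L' := List.foldl_append

theorem legalAt_append (x : V) (L L' : List (Ent P M V)) :
    LegalAt x (L ++ L') ↔ LegalAt x L ∧ LegalAt (evalAt x L) L' := by
  induction L generalizing x with
  | nil => simp [LegalAt, evalAt]
  | cons z L ih =>
    simp only [List.cons_append, LegalAt, ih, evalAt, List.foldl_cons, and_assoc]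

/-- Operations on different locations do not interact, so legality can be checked for each location
separately. This is why the keys need to be sorted only among entries of the same location. -/
theorem legal_of_legalAt (L : List (Ent P M V)) (σ : Fin M → V)
    (h : ∀ j, LegalAt (σ j) (L.filter fun z => z.op.loc = j)) :
    Legal σ (L.map Ent.toInstance) := by
  induction L generalizing σ with
  | nil => trivial
  | cons z L ih =>
    have hz := h z.op.loc
    simp only [decide_true, List.filter_cons_of_pos, LegalAt] at hz
    rw [List.map_cons, Legal, Op.apply_eq]
    refine ⟨hz.1, ih _ fun j => ?_⟩
    by_cases hj : j = z.op.loc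
    · subst hj
      simpa using hz.2
    · have := h j
      rw [List.filter_cons_of_neg (by simpa using Ne.symm hj)] at this
      simpa [Function.update_of_ne hj] using this

/-- The contents of location `j` after its entries with keys up to `k`. -/
noncomputable def valAt (σ₀ : Fin M → V) (L : List (Ent P M V)) (j : Fin M) (k : ℕ) : V :=
  evalAt (σ₀ j) (L.filter fun z => z.op.loc = j ∧ z.key ≤ k)

/-- `L` linearizes the history `H`; location `j` is in epoch `w j`. The keys of the entries of
epoch `e` are `3 * e` for reads and CAS, `3 * e + 1` for overwritten writes, and `3 * e + 2` for
the write that ends the epoch. -/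
structure LinInv (σ₀ : Fin M → V) (H : List (Event P M V)) (L : List (Ent P M V))
    (w : Fin M → ℕ) : Prop where
  keys : L.Pairwise fun x y => x.op.loc = y.op.loc → x.key ≤ y.key
  stamps : L.Pairwise fun x y => x.stamp ≤ y.stamp
  key_le : ∀ z ∈ L, z.key ≤ 3 * w z.op.loc
  -- Every past epoch is closed by a write, which shields later epochs from entries inserted before
  -- it.
  swing : ∀ j e, e < w j → ∃ z ∈ L, z.op.loc = j ∧ z.key = 3 * e + 2
  writes : ∀ z ∈ L, z.key % 3 ≠ 0 → ∃ j v, z.op = .write j v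
  legal : ∀ j, LegalAt (σ₀ j) (L.filter fun z => z.op.loc = j)
  mem : ∀ z ∈ L, H[z.pos]? = some (.inv z.proc z.op)
  nodup : (L.map fun z => z.pos).Nodup
  complete : ∀ a b r, IsResponse H a b r → ∃ z ∈ L, z.pos = a
  response : ∀ z ∈ L, ∀ b r, IsResponse H z.pos b r → z.ret = r ∧ z.stamp ≤ b
  pos_lt : ∀ z ∈ L, z.pos < z.stamp
  stamp_le : ∀ z ∈ L, z.stamp ≤ H.length

theorem LinInv.nil (σ₀ : Fin M → V) : LinInv (P := P) σ₀ [] [] fun _ => 0 := by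
  constructor <;> simp [LegalAt, IsResponse]

/-- Stamps increase weakly along the list, and each lies after the invocation and not after the
response. Hence an operation that responded before the invocation of another one has the smaller
stamp and cannot stand behind it. -/
theorem LinInv.isLinearization {σ₀ : Fin M → V} {H : List (Event P M V)}
    {L : List (Ent P M V)} {w : Fin M → ℕ} (h : LinInv σ₀ H L w) :
    IsLinearization H (L.map Ent.toInstance) where
  mem := by
    simp only [List.mem_map, forall_exists_index, and_imp, forall_apply_eq_imp_iff₂]
    exact h.mem
  nodup := by simpa [List.map_map, Function.comp_def] using h.nodup
  complete := by
    intro a b r hr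
    obtain ⟨z, hz, hp⟩ := h.complete a b r hr
    exact ⟨_, List.mem_map_of_mem hz, hp⟩
  response := by
    simp only [List.mem_map, forall_exists_index, and_imp, forall_apply_eq_imp_iff₂]
    exact fun z hz b r hr => (h.response z hz b r hr).1
  order := by
    rw [List.pairwise_map]
    refine h.stamps.imp_of_mem fun {x y} hx hy hxy b r hr hb => ?_
    have := (h.response y hy b r hr).2
    have := h.pos_lt x hx
    omega

theorem LinInv.isLegal {σ₀ : Fin M → V} {H : List (Event P M V)}
    {L : List (Ent P M V)} {w : Fin M → ℕ} (h : LinInv σ₀ H L w) :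
    Legal σ₀ (L.map Ent.toInstance) := legal_of_legalAt _ _ h.legal

theorem LinInv.invoke {σ₀ : Fin M → V} {H : List (Event P M V)}
    {L : List (Ent P M V)} {w : Fin M → ℕ} (h : LinInv σ₀ H L w) (i : Fin P) (op : Op M V) :
    LinInv σ₀ (H ++ [.inv i op]) L w :=
  { h with
    mem := fun z hz => (getElem?_append_singleton ..).2 (.inl (h.mem z hz))
    complete := fun a b r hr => by
      rcases isResponse_append.1 hr with hr | ⟨-, i', op', h1, -⟩
      · exact h.complete a b r hr
      · cases h1
    response := fun z hz b r hr => by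
      rcases isResponse_append.1 hr with hr | ⟨-, i', op', h1, -⟩
      · exact h.response z hz b r hr
      · cases h1
    stamp_le := fun z hz => by have := h.stamp_le z hz; simp; omega }

theorem LinInv.respond {σ₀ : Fin M → V} {H : List (Event P M V)}
    {L : List (Ent P M V)} {w : Fin M → ℕ} (h : LinInv σ₀ H L w) {i : Fin P} {a : ℕ}
    {op : Op M V} {r : Ret V} (hp : Pending H i a op)
    (hL : ∃ z ∈ L, z.pos = a ∧ z.ret = r) :
    LinInv σ₀ (H ++ [.res i r]) L w :=
  { h with
    mem := fun z hz => (getElem?_append_singleton ..).2 (.inl (h.mem z hz))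
    complete := fun a' b r' hr => by
      rcases isResponse_append.1 hr with hr | ⟨-, i', op', h1, h2⟩
      · exact h.complete a' b r' hr
      · cases h1
        obtain ⟨z, hz, hz', -⟩ := hL
        exact ⟨z, hz, hz'.trans (hp.unique h2).1⟩
    response := fun z hz b r' hr => by
      rcases isResponse_append.1 hr with hr | ⟨hb, i', op', h1, h2⟩
      · exact h.response z hz b r' hr
      · cases h1
        obtain ⟨z', hz', hpos, hret⟩ := hL
        have hzz : z' = z := List.inj_on_of_nodup_map h.nodup hz' hz
          (hpos.trans (hp.unique h2).1)
        subst hzz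
        exact ⟨hret, hb ▸ h.stamp_le _ hz⟩
    stamp_le := fun z hz => by have := h.stamp_le z hz; simp; omega }

/-- A write forgets the earlier contents. This and the next lemma make insertions in front of a
write invisible from there on. -/
theorem evalAt_write_cons (x y : V) (z : Ent P M V) (L : List (Ent P M V))
    (hz : ∃ j v, z.op = .write j v) : evalAt x (z :: L) = evalAt y (z :: L) := by
  obtain ⟨j, v, hz⟩ := hz
  simp [evalAt, hz, Op.act]

theorem legalAt_write_cons (x y : V) (z : Ent P M V) (L : List (Ent P M V))
    (hz : ∃ j v, z.op = .write j v) : LegalAt x (z :: L) ↔ LegalAt y (z :: L) := by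
  obtain ⟨j, v, hz⟩ := hz
  simp [LegalAt, hz, Op.act]

/-- A list whose entries of each location are sorted by keys splits before the first entry of
location `j` whose key exceeds `k`. -/
theorem exists_split (L : List (Ent P M V)) (j : Fin M) (k : ℕ)
    (h : L.Pairwise fun x y => x.op.loc = y.op.loc → x.key ≤ y.key) :
    ∃ A B, L = A ++ B ∧ (∀ z ∈ A, z.op.loc = j → z.key ≤ k) ∧
      (∀ z ∈ B, z.op.loc = j → k < z.key) ∧
      (B = [] ∨ ∃ z B', B = z :: B' ∧ z.op.loc = j) := by
  induction L with
  | nil => exact ⟨[], [], by simp⟩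
  | cons z L ih =>
    rw [List.pairwise_cons] at h
    by_cases hz : z.op.loc = j ∧ k < z.key
    · refine ⟨[], z :: L, rfl, by simp, ?_, .inr ⟨z, L, rfl, hz.1⟩⟩
      rintro y hy hyj
      rcases List.mem_cons.1 hy with rfl | hy
      · exact hz.2
      · exact hz.2.trans_le (h.1 y hy (hz.1.trans hyj.symm))
    · obtain ⟨A, B, rfl, hA, hB, hB'⟩ := ih h.2
      refine ⟨z :: A, B, rfl, ?_, hB, hB'⟩
      rintro y hy hyj
      rcases List.mem_cons.1 hy with rfl | hy
      · by_contra hlt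
        exact hz ⟨hyj, by omega⟩
      · exact hA y hy hyj

end Lists

/-! ### Adding an operation to a linearization -/

section Insertion

variable {P M : ℕ} {V : Type u}

/-- A successful write takes effect at the present moment, so it goes to the end of the list. Its
key `3 * w j + 2` exceeds all keys of the location, and the epoch that it opens starts with its
value. -/
theorem LinInv.exists_swing {σ₀ : Fin M → V} {H : List (Event P M V)}
    {L : List (Ent P M V)} {w : Fin M → ℕ} (h : LinInv σ₀ H L w) {i : Fin P} {a : ℕ}
    {j : Fin M} {v : V} (hp : Pending H i a (.write j v)) (hnew : ∀ z ∈ L, z.pos ≠ a) :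
    ∃ (L' : List (Ent P M V)) (y : Ent P M V),
      LinInv σ₀ H L' (Function.update w j (w j + 1)) ∧ y.pos = a ∧ y.ret = .ack ∧
      y.stamp = H.length ∧ (∀ z, z ∈ L' ↔ z = y ∨ z ∈ L) ∧
      (∀ j' e, e ≤ w j' → valAt σ₀ L' j' (3 * e) = valAt σ₀ L j' (3 * e)) ∧
      valAt σ₀ L' j (3 * (w j + 1)) = v := by
  let y : Ent P M V := ⟨⟨a, i, .write j v, .ack⟩, 3 * w j + 2, H.length⟩
  have hyl : y.op.loc = j := rfl
  have hw : ∀ j', w j' ≤ Function.update w j (w j + 1) j' := by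
    intro j'
    by_cases hj : j' = j
    · subst hj; simp
    · simp [hj]
  refine ⟨L ++ [y], y, ?_, rfl, rfl, rfl, by simp [or_comm], ?_, ?_⟩
  · constructor
    · rw [List.pairwise_append]
      refine ⟨h.keys, by simp, fun x hx y' hy' hxy => ?_⟩
      obtain rfl : y' = y := by simpa using hy'
      have := h.key_le x hx
      rw [hxy, hyl] at this
      show x.key ≤ 3 * w j + 2
      omega
    · rw [List.pairwise_append]
      refine ⟨h.stamps, by simp, fun x hx y' hy' => ?_⟩
      obtain rfl : y' = y := by simpa using hy'
      exact h.stamp_le x hx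
    · intro z hz
      rcases List.mem_append.1 hz with hz | hz
      · have := h.key_le z hz
        have := hw z.op.loc
        omega
      · obtain rfl : z = y := by simpa using hz
        rw [hyl, Function.update_self]
        show 3 * w j + 2 ≤ _
        omega
    · intro j' e he
      by_cases hlt : e < w j'
      · obtain ⟨z, hz, h1⟩ := h.swing j' e hlt
        exact ⟨z, by simp [hz], h1⟩
      · by_cases hj : j' = j
        · subst hj
          rw [Function.update_self] at he
          obtain rfl : e = w j' := by omega
          exact ⟨y, by simp, rfl, rfl⟩
        · rw [Function.update_of_ne hj] at he
          exact absurd he hlt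
    · intro z hz
      rcases List.mem_append.1 hz with hz | hz
      · exact h.writes z hz
      · obtain rfl : z = y := by simpa using hz
        exact fun _ => ⟨j, v, rfl⟩
    · intro j'
      rw [List.filter_append, legalAt_append]
      refine ⟨h.legal j', ?_⟩
      by_cases hj : y.op.loc = j'
      · simp only [List.filter_cons, hj, decide_true, List.filter_nil, if_true, LegalAt, and_true]
        rfl
      · simp [hj, LegalAt]
    · intro z hz
      rcases List.mem_append.1 hz with hz | hz
      · exact h.mem z hz
      · obtain rfl : z = y := by simpa using hz
        exact hp.1
    · rw [List.map_append, List.nodup_append]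
      refine ⟨h.nodup, by simp, ?_⟩
      intro x hx x' hx'
      obtain ⟨z, hz, rfl⟩ := List.mem_map.1 hx
      obtain rfl : x' = a := by simpa using hx'
      exact hnew z hz
    · intro a' b r hr
      obtain ⟨z, hz, h1⟩ := h.complete a' b r hr
      exact ⟨z, by simp [hz], h1⟩
    · intro z hz b r hr
      rcases List.mem_append.1 hz with hz | hz
      · exact h.response z hz b r hr
      · obtain rfl : z = y := by simpa using hz
        exact absurd hr hp.not_isResponse
    · intro z hz
      rcases List.mem_append.1 hz with hz | hz
      · exact h.pos_lt z hz
      · obtain rfl : z = y := by simpa using hz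
        exact hp.lt
    · intro z hz
      rcases List.mem_append.1 hz with hz | hz
      · exact h.stamp_le z hz
      · obtain rfl : z = y := by simpa using hz
        exact le_rfl
  · intro j' e he
    rw [valAt, valAt, List.filter_append, List.filter_cons_of_neg, List.filter_nil,
      List.append_nil]
    simp only [decide_eq_true_eq, not_and]
    intro hj
    have : j = j' := hj
    subst this
    show ¬ 3 * w j + 2 ≤ 3 * e
    omega
  · rw [valAt, List.filter_append, evalAt_append, List.filter_cons_of_pos]
    · rfl
    · simp only [decide_eq_true_eq]
      refine ⟨rfl, ?_⟩
      show 3 * w j + 2 ≤ _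
      omega

/-- An operation that takes effect in epoch `e` of its location: a read or CAS on the contents at
the end of the entries with key `3 * e`, or a write that is overwritten at the end of the epoch. -/
theorem LinInv.exists_insert {σ₀ : Fin M → V} {H : List (Event P M V)}
    {L : List (Ent P M V)} {w : Fin M → ℕ} (h : LinInv σ₀ H L w) {i : Fin P} {a : ℕ}
    {op : Op M V} (hp : Pending H i a op) (hnew : ∀ z ∈ L, z.pos ≠ a) {r : Ret V} {e k : ℕ}
    (hk : (k = 3 * e ∧ e ≤ w op.loc ∧ (op.act (valAt σ₀ L op.loc (3 * e))).2 = r) ∨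
      (k = 3 * e + 1 ∧ e < w op.loc ∧ r = .ack ∧ ∃ j v, op = .write j v))
    (hcut : ∀ z ∈ L, z.op.loc = op.loc → k < z.key → a < z.stamp) :
    ∃ (L' : List (Ent P M V)) (y : Ent P M V),
      LinInv σ₀ H L' w ∧ y.pos = a ∧ y.ret = r ∧ y.op = op ∧ y.key = k ∧
      (y.stamp = H.length ∨ ∃ f ∈ L, f.op.loc = op.loc ∧ k < f.key ∧ y.stamp = f.stamp) ∧
      (∀ z, z ∈ L' ↔ z = y ∨ z ∈ L) ∧
      (∀ j' e', e' ≤ w j' → (j' ≠ op.loc ∨ e' ≠ e ∨ k ≠ 3 * e) →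
        valAt σ₀ L' j' (3 * e') = valAt σ₀ L j' (3 * e')) ∧
      (k = 3 * e → valAt σ₀ L' op.loc (3 * e) =
        (op.act (valAt σ₀ L op.loc (3 * e))).1) := by
  -- The new entry goes between `A` and `B`, directly before the first entry of its location with a
  -- larger key.
  obtain ⟨A, B, rfl, hA, hB, hB'⟩ := exists_split L op.loc k h.keys
  -- The new entry borrows the stamp of the first entry of `B`, or the current time if `B` is empty.
  -- The hypothesis `hcut` puts this stamp after the invocation.
  obtain ⟨t, ht, htA, htB, hat, htH⟩ : ∃ t : ℕ,
      (t = H.length ∨ ∃ f ∈ A ++ B, f.op.loc = op.loc ∧ k < f.key ∧ t = f.stamp) ∧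
      (∀ z ∈ A, z.stamp ≤ t) ∧ (∀ z ∈ B, t ≤ z.stamp) ∧ a < t ∧ t ≤ H.length := by
    rcases hB' with rfl | ⟨f, B', rfl, hf⟩
    · exact ⟨H.length, .inl rfl, fun z hz => h.stamp_le z (by simp [hz]), by simp, hp.lt, le_rfl⟩
    · have hfm : f ∈ A ++ f :: B' := by simp
      have hfk : k < f.key := hB f (by simp) hf
      have hs := List.pairwise_append.1 h.stamps
      refine ⟨f.stamp, .inr ⟨f, hfm, hf, hfk, rfl⟩, fun z hz => hs.2.2 z hz f (by simp), ?_,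
        hcut f hfm hf hfk, h.stamp_le f hfm⟩
      intro z hz
      rcases List.mem_cons.1 hz with rfl | hz
      · exact le_rfl
      · exact (List.pairwise_cons.1 hs.2.1).1 z hz
  let y : Ent P M V := ⟨⟨a, i, op, r⟩, k, t⟩
  have hmem : ∀ z, z ∈ A ++ y :: B ↔ z = y ∨ z ∈ A ++ B := by
    intro z
    simp only [List.mem_append, List.mem_cons]
    tauto
  have hkw : k ≤ 3 * w op.loc := by rcases hk with ⟨h1, h2, -⟩ | ⟨h1, h2, -⟩ <;> omega
  have hke : 3 * e ≤ k ∧ k ≤ 3 * e + 1 := by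
    rcases hk with ⟨h1, h2, -⟩ | ⟨h1, h2, -⟩ <;> omega
  -- The entries of the location behind the new one start with a write.
  have hBw : B.filter (fun z => z.op.loc = op.loc) = [] ∨ e < w op.loc ∧
      ∃ f B', B.filter (fun z => z.op.loc = op.loc) = f :: B' ∧
      (∃ j v, f.op = .write j v) ∧ f.key ≤ 3 * e + 2 := by
    rcases hfil : B.filter (fun z => z.op.loc = op.loc) with _ | ⟨f, B''⟩
    · exact .inl hfil
    · have hf : f ∈ B.filter (fun z => z.op.loc = op.loc) := by rw [hfil]; simp
      rw [List.mem_filter, decide_eq_true_eq] at hf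
      have hfk := hB f hf.1 hf.2
      have hfw := h.key_le f (by simp [hf.1])
      rw [hf.2] at hfw
      have hew : e < w op.loc := by omega
      obtain ⟨s, hs, hsl, hsk⟩ := h.swing op.loc e hew
      have hsB : s ∈ f :: B'' := by
        rw [← hfil, List.mem_filter, decide_eq_true_eq]
        refine ⟨?_, hsl⟩
        rcases List.mem_append.1 hs with hs | hs
        · have := hA s hs hsl
          omega
        · exact hs
      have hfs : f.key ≤ s.key := by
        rcases List.mem_cons.1 hsB with rfl | hsB
        · exact le_rfl
        · have hpw := (List.pairwise_append.1 h.keys).2.1.filter (fun z => z.op.loc = op.loc)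
          rw [hfil, List.pairwise_cons] at hpw
          exact hpw.1 s hsB (hf.2.trans hsl.symm)
      -- The key of `f` is above `3 * e` and, because of the write `s` that ends the epoch, at most
      -- `3 * e + 2`. So it is not divisible by 3, and `f` is a write.
      exact .inr ⟨hew, f, B'', hfil, h.writes f (by simp [hf.1]) (by omega), by omega⟩
  have hAe : A.filter (fun z => z.op.loc = op.loc ∧ z.key ≤ k) =
      A.filter (fun z => z.op.loc = op.loc) := by
    refine List.filter_congr fun z hz => ?_
    simp only [decide_eq_decide, and_iff_left_iff_imp]
    exact hA z hz
  have hBe : B.filter (fun z => z.op.loc = op.loc ∧ z.key ≤ k) = [] := by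
    rw [List.filter_eq_nil_iff]
    intro z hz
    simp only [decide_eq_true_eq, not_and, not_le]
    exact hB z hz
  refine ⟨A ++ y :: B, y, ?_, rfl, rfl, rfl, rfl, ht, hmem, ?_, ?_⟩
  · constructor
    · rw [List.pairwise_append]
      have hpw := List.pairwise_append.1 h.keys
      refine ⟨hpw.1, List.pairwise_cons.2 ⟨?_, hpw.2.1⟩, ?_⟩
      · intro z hz hyz
        exact (hB z hz hyz.symm).le
      · intro z hz z' hz' hzz
        rcases List.mem_cons.1 hz' with rfl | hz'
        · exact hA z hz hzz
        · exact hpw.2.2 z hz z' hz' hzz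
    · rw [List.pairwise_append]
      have hpw := List.pairwise_append.1 h.stamps
      refine ⟨hpw.1, List.pairwise_cons.2 ⟨htB, hpw.2.1⟩, ?_⟩
      intro z hz z' hz'
      rcases List.mem_cons.1 hz' with rfl | hz'
      · exact htA z hz
      · exact hpw.2.2 z hz z' hz'
    · intro z hz
      rcases (hmem z).1 hz with rfl | hz
      · exact hkw
      · exact h.key_le z hz
    · intro j e he
      obtain ⟨z, hz, h1⟩ := h.swing j e he
      exact ⟨z, (hmem z).2 (.inr hz), h1⟩
    · intro z hz
      rcases (hmem z).1 hz with rfl | hz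
      · intro hmod
        have hmod : k % 3 ≠ 0 := hmod
        rcases hk with ⟨hk, -⟩ | hk
        · omega
        · exact hk.2.2.2
      · exact h.writes z hz
    · intro j
      have hl := h.legal j
      rw [List.filter_append, legalAt_append] at hl ⊢
      by_cases hj : op.loc = j
      · subst hj
        refine ⟨hl.1, ?_⟩
        rw [List.filter_cons_of_pos (by simp [y])]
        refine ⟨?_, ?_⟩
        · rcases hk with ⟨rfl, -, hr⟩ | ⟨-, -, rfl, j, v, rfl⟩
          · show _ = r
            rw [← hr, valAt, List.filter_append, hAe, hBe, List.append_nil]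
          · rfl
        · rcases hBw with hnil | ⟨-, f, B', hcons, hf, -⟩
          · rw [hnil]; trivial
          · rw [hcons] at hl ⊢
            exact (legalAt_write_cons _ _ _ _ hf).1 hl.2
      · rw [List.filter_cons_of_neg (by simpa [y] using hj)]
        exact hl
    · intro z hz
      rcases (hmem z).1 hz with rfl | hz
      · exact hp.1
      · exact h.mem z hz
    · have hn := h.nodup
      rw [List.map_append] at hn ⊢
      rw [List.map_cons, List.nodup_middle, List.nodup_cons]
      refine ⟨?_, hn⟩
      rw [← List.map_append]
      intro hy
      obtain ⟨z, hz, hza⟩ := List.mem_map.1 hy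
      exact hnew z hz hza
    · intro a' b r hr
      obtain ⟨z, hz, h1⟩ := h.complete a' b r hr
      exact ⟨z, (hmem z).2 (.inr hz), h1⟩
    · intro z hz b r hr
      rcases (hmem z).1 hz with rfl | hz
      · exact absurd hr hp.not_isResponse
      · exact h.response z hz b r hr
    · intro z hz
      rcases (hmem z).1 hz with rfl | hz
      · exact hat
      · exact h.pos_lt z hz
    · intro z hz
      rcases (hmem z).1 hz with rfl | hz
      · exact htH
      · exact h.stamp_le z hz
  · intro j' e' he' hne
    rw [valAt, valAt, List.filter_append, List.filter_append]
    by_cases hj : op.loc = j' ∧ k ≤ 3 * e'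
    · obtain ⟨rfl, hke'⟩ := hj
      rw [List.filter_cons_of_pos (by simpa [y] using hke'), evalAt_append, evalAt_append]
      -- Only values at later epochs are computed through the new entry, and for them the write `f`
      -- intervenes.
      have hee : e < e' := by
        simp only [ne_eq, not_true_eq_false, false_or] at hne
        omega
      rcases hBw with hnil | ⟨-, f, B', hcons, hf, hfk⟩
      · obtain ⟨s, hs, hsl, hsk⟩ := h.swing op.loc e (by omega)
        rcases List.mem_append.1 hs with hs | hs
        · have := hA s hs hsl
          omega
        · rw [List.filter_eq_nil_iff] at hnil
          exact absurd hsl (by simpa using hnil s hs)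
      · have hBf : B.filter (fun z => z.op.loc = op.loc ∧ z.key ≤ 3 * e') =
            f :: B'.filter fun z => z.key ≤ 3 * e' := by
          have : B.filter (fun z => z.op.loc = op.loc ∧ z.key ≤ 3 * e') =
              (B.filter fun z => z.op.loc = op.loc).filter fun z => z.key ≤ 3 * e' := by
            rw [List.filter_filter]
            refine List.filter_congr fun z _ => ?_
            rw [Bool.decide_and, Bool.and_comm]
          rw [this, hcons, List.filter_cons_of_pos]
          simp only [decide_eq_true_eq]
          omega
        rw [hBf]
        exact evalAt_write_cons _ _ _ _ hf
    · rw [List.filter_cons_of_neg (by simpa [y] using hj)]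
  · rintro rfl
    rw [valAt, valAt, List.filter_append, List.filter_append, hAe,
      List.filter_cons_of_pos (by simp [y]), hBe, evalAt_append, List.append_nil]
    rfl

end Insertion

/-! ### Pools of value objects -/

/-- The private bookkeeping of a process: a table of the value objects that it owns, a table for
finding the position of an object in the former, the number `a` of objects that it has used in
the current phase, and the start `hb` of the part of the table that it uses in this phase.

For `P` processes the table consists of three parts of length `P`. In each phase one of the first
two parts is used up, and the announcements of all processes are scanned; the announced objects
of the other part move to the third part. -/
structure Pool where
  arr : ℕ → ℕ
  inv : ℕ → ℕ
  a : ℕ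
  hb : ℕ

namespace Pool

/-- The object that is used next. -/
def fresh (q : Pool) : ℕ := q.arr (q.hb + q.a)

/-- Replace the object that is used next. -/
def exchange (q : Pool) (x : ℕ) : Pool :=
  { q with
    arr := Function.update q.arr (q.hb + q.a) x
    inv := Function.update q.inv x (q.hb + q.a) }

/-- Exchange the objects at two positions. -/
def swap (q : Pool) (k l : ℕ) : Pool :=
  { q with
    arr := Function.update (Function.update q.arr k (q.arr l)) l (q.arr k)
    inv := Function.update (Function.update q.inv (q.arr l) k) (q.arr k) l }

/-- Go on to the next object. -/
def advance (P : ℕ) (q : Pool) : Pool :=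
  if q.a + 1 < P then { q with a := q.a + 1 } else { q with a := 0, hb := P - q.hb }

/-- Object `x` is found outside of the part that is used in the current phase. -/
def Movable (P : ℕ) (q : Pool) (x : ℕ) : Prop :=
  q.arr (q.inv x) = x ∧ (q.inv x < q.hb ∨ q.hb + P ≤ q.inv x)

instance (P : ℕ) (q : Pool) (x : ℕ) : Decidable (q.Movable P x) := by
  unfold Movable; infer_instance

/-- Process the announcement `y` of process `a`, and go on to the next object. -/
def scanned (P : ℕ) (q : Pool) (y : ℕ) : Pool :=
  advance P (if q.Movable P (y - 1) then q.swap (q.inv (y - 1)) (2 * P + q.a) else q)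

/-- `D r x` means that process `r` may still access object `x`; `b` means that the object used
next has been exchanged already; the announcements of the first `c` processes have been scanned in
this phase. -/
structure Inv (P : ℕ) (q : Pool) (D : Fin P → ℕ → Prop) (b : Prop) (c : ℕ) : Prop where
  a_lt : q.a < P
  hb : q.hb = 0 ∨ q.hb = P
  inv_lt : ∀ x, q.inv x < 3 * P
  inj : ∀ k l, k < 3 * P → l < 3 * P → q.arr k = q.arr l → k = l
  ready : ∀ k, q.hb + q.a ≤ k → k < q.hb + P → (b → k ≠ q.hb + q.a) → ∀ r, ¬ D r (q.arr k)
  -- The exempt positions `2 * P + r` with `r < c` are the places reserved for objects announced by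
  -- processes already scanned. At the end of the phase (`c = P`) nothing is claimed about the third
  -- part.
  checked : ∀ k, k < 3 * P → (k < q.hb ∨ q.hb + P ≤ k) → (k < 2 * P ∨ 2 * P + c ≤ k) →
    ∀ r : Fin P, r < c → ¬ D r (q.arr k)
  -- The inverse table may be wrong for objects that nobody threatens. This permits a start with the
  -- zero table: only threatened objects must be found.
  found : ∀ k, k < 3 * P → q.inv (q.arr k) = k ∨ ∀ r, ¬ D r (q.arr k)

variable {P : ℕ} {q : Pool} {D : Fin P → ℕ → Prop} {b : Prop} {c : ℕ}

/-- Threats enter only negatively, and only for objects in the pool. Thus steps of other processes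
preserve the invariant as long as they create no threat to owned objects. -/
theorem Inv.mono {D' : Fin P → ℕ → Prop} (h : q.Inv P D b c)
    (hD : ∀ r k, k < 3 * P → D' r (q.arr k) → D r (q.arr k)) : q.Inv P D' b c :=
  { h with
    ready := fun k h1 h2 h3 r hr => h.ready k h1 h2 h3 r
      (hD r k (by have := h.hb; omega) hr)
    checked := fun k h1 h2 h3 r h4 hr => h.checked k h1 h2 h3 r h4 (hD r k h1 hr)
    found := fun k hk => (h.found k hk).imp_right fun h' r hr => h' r (hD r k hk hr) }

theorem Inv.slot_lt (h : q.Inv P D b c) : q.hb + q.a < 3 * P := by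
  have := h.a_lt; have := h.hb; omega

theorem Inv.fresh_safe (h : q.Inv P D False c) (r : Fin P) : ¬ D r q.fresh :=
  h.ready _ le_rfl (by have := h.a_lt; omega) (by simp) r

/-- The object `x` that comes in may be threatened by anybody. Its slot has been used up in this
phase, so nothing is claimed about it except that the inverse table finds it. -/
theorem Inv.exchange (h : q.Inv P D False c) {x : ℕ} (hx : ∀ k, k < 3 * P → q.arr k ≠ x) :
    (q.exchange x).Inv P D True c := by
  have hs := h.slot_lt
  have ha := h.a_lt
  have hhb := h.hb
  constructor
  · exact ha
  · exact hhb
  · intro y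
    simp only [Pool.exchange, Function.update_apply]
    split
    · exact hs
    · exact h.inv_lt y
  · intro k l hk hl
    simp only [Pool.exchange, Function.update_apply]
    have := hx k hk
    have := hx l hl
    have := h.inj k l hk hl
    grind
  · intro k h1 h2 h3 r
    simp only [Pool.exchange] at h1 h2 h3 ⊢
    rw [Function.update_of_ne (h3 trivial)]
    exact h.ready k h1 h2 (by simp) r
  · intro k h1 h2 h3 r h4
    simp only [Pool.exchange] at h2 h3 h4 ⊢
    rw [Function.update_of_ne (by omega)]
    exact h.checked k h1 h2 h3 r h4
  · intro k hk
    simp only [Pool.exchange]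
    by_cases hks : k = q.hb + q.a
    · subst hks
      simp
    · rw [Function.update_of_ne hks, Function.update_of_ne (hx k hk)]
      exact h.found k hk

theorem Inv.advance (h : q.Inv P D True (q.a + 1)) :
    (q.advance P).Inv P D False (q.advance P).a := by
  have hs := h.slot_lt
  have ha := h.a_lt
  have hhb := h.hb
  unfold Pool.advance
  split
  · constructor
    · assumption
    · exact hhb
    · exact h.inv_lt
    · exact h.inj
    · intro k h1 h2 h3 r
      simp only at h1 h2 h3
      exact h.ready k (by omega) h2 (fun _ => by omega) r
    · exact h.checked
    · exact h.found
  -- End of a phase: the announcements of all `P` processes have been scanned. For the part that is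
  -- used next, `checked` therefore gives `ready`, while `checked` starts again with no process.
  · constructor
    · simp only; omega
    · simp only; omega
    · exact h.inv_lt
    · exact h.inj
    · intro k h1 h2 h3 r
      simp only at h1 h2 h3
      exact h.checked k (by omega) (by omega) (by omega) r (by have := r.2; omega)
    · intro k h1 h2 h3 r h4
      simp only [not_lt_zero] at h4
    · exact h.found

/-- By `hD`, process `q.a` threatens at most `x`, which goes to the exempt place `2 * P + q.a`. The
object displaced from there has been checked against the earlier processes, and it is either not `x`
or does not move at all. The second conclusion says that no foreign object enters the pool. -/
theorem Inv.swap (h : q.Inv P D True q.a) {x : ℕ} (hx : q.Movable P x)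
    (hD : ∀ k, k < 3 * P → ∀ r : Fin P, r = q.a → D r (q.arr k) → q.arr k = x) :
    (q.swap (q.inv x) (2 * P + q.a)).Inv P D True (q.a + 1) ∧
    ∀ k, k < 3 * P → ∃ l, l < 3 * P ∧ (q.swap (q.inv x) (2 * P + q.a)).arr k = q.arr l := by
  obtain ⟨hx1, hx2⟩ := hx
  have hp := h.inv_lt x
  have ha := h.a_lt
  have hhb := h.hb
  set p := q.inv x with hpdef
  have hg : 2 * P + q.a < 3 * P := by omega
  have harr : ∀ k, (q.swap p (2 * P + q.a)).arr k =
      if k = 2 * P + q.a then x else if k = p then q.arr (2 * P + q.a) else q.arr k := by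
    intro k
    simp only [Pool.swap, Function.update_apply, hx1]
  have hinv : ∀ y, (q.swap p (2 * P + q.a)).inv y =
      if y = x then 2 * P + q.a else if y = q.arr (2 * P + q.a) then p else q.inv y := by
    intro y
    simp only [Pool.swap, Function.update_apply, hx1]
  have hself : ∀ k, k < 3 * P → q.arr k = x → k = p := fun k hk hkx =>
    h.inj k p hk hp (hkx.trans hx1.symm)
  constructor
  · constructor
    · exact ha
    · exact hhb
    · intro y
      rw [hinv]
      split
      · exact hg
      · split
        · exact hp
        · exact h.inv_lt y
    · intro k l hk hl
      rw [harr, harr]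
      have h1 := h.inj k l hk hl
      have h2 := hself k hk
      have h3 := hself l hl
      have h4 := h.inj k _ hk hg
      have h5 := h.inj l _ hl hg
      have h6 := hself _ hg
      grind
    · intro k h1 h2 h3 r
      simp only [Pool.swap] at h1 h2 h3
      rw [harr, if_neg (by omega), if_neg (by omega)]
      exact h.ready k h1 h2 h3 r
    · intro k h1 h2 h3 r h4
      simp only [Pool.swap] at h2
      rw [harr, if_neg (by omega)]
      rcases Nat.lt_succ_iff_lt_or_eq.1 h4 with h4 | h4
      · split
        · exact h.checked _ hg (by omega) (by omega) r h4
        · exact h.checked k h1 h2 (by omega) r h4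
      · intro hDr
        split at hDr
        · have := hself _ hg (hD _ hg r h4 hDr)
          omega
        · have := hself _ h1 (hD _ h1 r h4 hDr)
          contradiction
    · intro k hk
      rw [harr]
      split
      · left; rw [hinv]; simp [*]
      · split
        · rw [hinv]
          split
          · rename_i h1 h2 h3
            have := hself _ hg h3
            omega
          · simp [*]
        · rename_i h1 h2
          rw [hinv, if_neg (fun hh => h2 (hself k hk hh)),
            if_neg (fun hh => h1 (h.inj k _ hk hg hh))]
          exact h.found k hk
  · intro k hk
    rw [harr]
    split
    · exact ⟨p, hp, hx1.symm⟩
    · split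
      · exact ⟨_, hg, rfl⟩
      · exact ⟨k, hk, rfl⟩

/-- A scan of an announcement that shows every object of the pool that process `a` may still
access. -/
theorem Inv.scanned (h : q.Inv P D True q.a) {y : ℕ}
    (hD : ∀ k, k < 3 * P → ∀ r : Fin P, r = q.a → D r (q.arr k) → y = q.arr k + 1) :
    (q.scanned P y).Inv P D False (q.scanned P y).a ∧
    ∀ k, k < 3 * P → ∃ l, l < 3 * P ∧ (q.scanned P y).arr k = q.arr l := by
  have hadv : ∀ q' : Pool, (q'.advance P).arr = q'.arr := by
    intro q'; unfold Pool.advance; split <;> rfl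
  -- For `y = 0` (open again) the truncated `y - 1` names object 0. In this case `hD` excludes
  -- threats from the process, and moving object 0 is harmless.
  have hD' : ∀ k, k < 3 * P → ∀ r : Fin P, r = q.a → D r (q.arr k) → q.arr k = y - 1 :=
    fun k hk r hr hDr => by have := hD k hk r hr hDr; omega
  unfold Pool.scanned
  rw [hadv]
  split
  · rename_i hm
    obtain ⟨h1, h2⟩ := h.swap hm hD'
    exact ⟨Inv.advance h1, h2⟩
  · rename_i hm
    refine ⟨Inv.advance { h with checked := ?_ }, fun k hk => ⟨k, hk, rfl⟩⟩
    intro k h1 h2 h3 r h4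
    rcases Nat.lt_succ_iff_lt_or_eq.1 h4 with h4 | h4
    · exact h.checked k h1 h2 (by omega) r h4
    · intro hDr
      -- A threatened object outside the current part is the announced one and is found by the
      -- inverse table; it would have been movable.
      have hk := hD' k h1 r h4 hDr
      rcases h.found k h1 with h5 | h5
      · rw [hk] at h5
        exact hm ⟨by rw [h5, hk], by rw [h5]; exact h2⟩
      · exact h5 r hDr

end Pool

/-! ### The algorithm as a transition system

Object `j` of the array is a record that points to a value object and counts the writes to `j`.
A read or CAS on `j` announces `j`, waits until its announcement has been filled (by itself or by
another process) with a pointer read from `j`, and is performed on the value object. A write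
stores its value in a value object that nobody else can access, and tries once to swing the pointer
to it. If that succeeds, it reuses the old value object after it has scanned all announcements. -/

/-- Positions of a process in the code, with the contents of its registers. -/
inductive Local (V : Type u) where
  | readAnn
  | post (x : Rec)
  | readObj (s : ℕ)
  | fill (s x : ℕ)
  | readPtr
  | access (x : ℕ)
  | loadFresh
  | initFresh (y : V)
  | readCur
  | swing (x e : ℕ)
  | scan
  | help (j s : ℕ)
  | helpFill (j s x : ℕ)
  | rescan
  | fin (r : Ret V)

/-- A process is idle or in the middle of an operation. -/
inductive Proc (M : ℕ) (V : Type u) where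
  | idle
  | busy (op : Op M V) (l : Local V)

/-- States of the transition system: the pointers and write counts of the array, the announcements
`(j, s, y)` (open if `y = 0`, filled with `x` if `y = x + 1`), the value objects, and the
processes. -/
structure State (P M : ℕ) (V : Type u) where
  obj : ℕ → ℕ × ℕ
  ann : ℕ → Rec
  buf : ℕ → V
  proc : Fin P → Proc M V
  pool : Fin P → Pool

/-- The operation is a write. -/
def Op.IsWrite {M : ℕ} {V : Type u} (op : Op M V) : Prop := ∃ j v, op = .write j v

open Classical in
/-- Where an operation starts. -/
noncomputable def Op.first {M : ℕ} {V : Type u} (op : Op M V) : Local V :=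
  if op.IsWrite then .loadFresh else .readAnn

section System

variable {P M : ℕ} {V : Type u}

/-- Process `i` goes to `p`. -/
def State.goto (A : State P M V) (i : Fin P) (p : Proc M V) : State P M V :=
  { A with proc := Function.update A.proc i p }

inductive State.Step (A : State P M V) : Option (Event P M V) → State P M V → Prop where
  | invoke (i : Fin P) (op : Op M V) (h : A.proc i = .idle) :
      Step A (some (.inv i op)) (A.goto i (.busy op op.first))
  | respond (i : Fin P) (op : Op M V) (r : Ret V) (h : A.proc i = .busy op (.fin r)) :
      Step A (some (.res i r)) (A.goto i .idle)
  | readAnn (i : Fin P) (op : Op M V) (h : A.proc i = .busy op .readAnn) :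
      Step A none (A.goto i (.busy op (.post (A.ann i))))
  | post (i : Fin P) (op : Op M V) (x : Rec) (h : A.proc i = .busy op (.post x)) :
      Step A none ({ A with ann := Function.update A.ann i (op.loc, x.2.1 + 1, 0) }.goto i
        (.busy op (.readObj (x.2.1 + 1))))
  | readObj (i : Fin P) (op : Op M V) (s : ℕ) (h : A.proc i = .busy op (.readObj s)) :
      Step A none (A.goto i (.busy op (.fill s (A.obj op.loc).1)))
  | fill (i : Fin P) (op : Op M V) (s x : ℕ) (h : A.proc i = .busy op (.fill s x))
      (h' : A.ann i = (↑op.loc, s, 0)) :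
      Step A none ({ A with ann := Function.update A.ann i (op.loc, s, x + 1) }.goto i
        (.busy op .readPtr))
  | fill_fail (i : Fin P) (op : Op M V) (s x : ℕ) (h : A.proc i = .busy op (.fill s x))
      (h' : A.ann i ≠ (↑op.loc, s, 0)) :
      Step A none (A.goto i (.busy op .readPtr))
  | readPtr (i : Fin P) (op : Op M V) (h : A.proc i = .busy op .readPtr) :
      Step A none (A.goto i (.busy op (.access ((A.ann i).2.2 - 1))))
  | access (i : Fin P) (op : Op M V) (x : ℕ) (h : A.proc i = .busy op (.access x)) :
      Step A none ({ A with buf := Function.update A.buf x (op.act (A.buf x)).1 }.goto i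
        (.busy op (.fin (op.act (A.buf x)).2)))
  | loadFresh (i : Fin P) (op : Op M V) (h : A.proc i = .busy op .loadFresh) :
      Step A none (A.goto i (.busy op (.initFresh (A.buf (A.pool i).fresh))))
  | initFresh (i : Fin P) (j : Fin M) (v y : V)
      (h : A.proc i = .busy (.write j v) (.initFresh y)) :
      Step A none ({ A with buf := Function.update A.buf (A.pool i).fresh v }.goto i
        (.busy (.write j v) .readCur))
  | readCur (i : Fin P) (op : Op M V) (h : A.proc i = .busy op .readCur) :
      Step A none (A.goto i (.busy op (.swing (A.obj op.loc).1 (A.obj op.loc).2)))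
  | swing (i : Fin P) (op : Op M V) (x e : ℕ) (h : A.proc i = .busy op (.swing x e))
      (h' : A.obj op.loc = (x, e)) :
      Step A none ({ A with
        obj := Function.update A.obj op.loc ((A.pool i).fresh, e + 1)
        pool := Function.update A.pool i ((A.pool i).exchange x) }.goto i
          (.busy op .scan))
  | swing_fail (i : Fin P) (op : Op M V) (x e : ℕ) (h : A.proc i = .busy op (.swing x e))
      (h' : A.obj op.loc ≠ (x, e)) :
      Step A none (A.goto i (.busy op (.fin .ack)))
  | scan (i : Fin P) (op : Op M V) (h : A.proc i = .busy op .scan)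
      (h' : (A.ann (A.pool i).a).2.2 ≠ 0) :
      Step A none ({ A with
        pool := Function.update A.pool i
          ((A.pool i).scanned P (A.ann (A.pool i).a).2.2) }.goto i (.busy op (.fin .ack)))
  | scan_open (i : Fin P) (op : Op M V) (h : A.proc i = .busy op .scan)
      (h' : (A.ann (A.pool i).a).2.2 = 0) :
      Step A none (A.goto i
        (.busy op (.help (A.ann (A.pool i).a).1 (A.ann (A.pool i).a).2.1)))
  | help (i : Fin P) (op : Op M V) (j s : ℕ) (h : A.proc i = .busy op (.help j s)) :
      Step A none (A.goto i (.busy op (.helpFill j s (A.obj j).1)))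
  | helpFill (i : Fin P) (op : Op M V) (j s x : ℕ) (h : A.proc i = .busy op (.helpFill j s x))
      (h' : A.ann (A.pool i).a = (j, s, 0)) :
      Step A none ({ A with ann := Function.update A.ann (A.pool i).a (j, s, x + 1) }.goto i
        (.busy op .rescan))
  | helpFill_fail (i : Fin P) (op : Op M V) (j s x : ℕ)
      (h : A.proc i = .busy op (.helpFill j s x)) (h' : A.ann (A.pool i).a ≠ (j, s, 0)) :
      Step A none (A.goto i (.busy op .rescan))
  | rescan (i : Fin P) (op : Op M V) (h : A.proc i = .busy op .rescan) :
      Step A none ({ A with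
        pool := Function.update A.pool i
          ((A.pool i).scanned P (A.ann (A.pool i).a).2.2) }.goto i (.busy op (.fin .ack)))

/-! ### Safe reuse of value objects -/

/-- Some process is about to fill the announcement `(j, s, 0)` of process `r` with `x`. -/
def State.Cand (A : State P M V) (r : Fin P) (j s x : ℕ) : Prop :=
  (∃ op, A.proc r = .busy op (.fill s x) ∧ (op.loc : ℕ) = j) ∨
    ∃ h op, A.proc h = .busy op (.helpFill j s x) ∧ (A.pool h).a = r

/-- The announcement of process `r` is filled with `x`, or may be. -/
def State.Danger (A : State P M V) (r : Fin P) (x : ℕ) : Prop :=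
  (A.ann r).2.2 = x + 1 ∨ ((A.ann r).2.2 = 0 ∧ A.Cand r (A.ann r).1 (A.ann r).2.1 x)

/-- A process that has made a write, and scans an announcement. -/
def Proc.Scanning : Proc M V → Prop
  | .busy _ .scan => True
  | .busy _ (.help _ _) => True
  | .busy _ (.helpFill _ _ _) => True
  | .busy _ .rescan => True
  | _ => False

/-- A process with an announcement that may be open. -/
def Proc.Asking : Proc M V → Prop
  | .busy _ (.readObj _) => True
  | .busy _ (.fill _ _) => True
  | _ => False

/-- Process `i` helps the announcement with location `j` and number `s`; any other announcement of
the process in question is a later one, and no threat to the objects that process `i` owns. -/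
def State.Helping (A : State P M V) (i : Fin P) (j s : ℕ) : Prop :=
  j < M ∧ ∀ r : Fin P, (r : ℕ) = (A.pool i).a →
    s ≤ (A.ann r).2.1 ∧ (s = (A.ann r).2.1 → j = (A.ann r).1) ∧
    ∀ k, k < 3 * P → A.Danger r ((A.pool i).arr k) →
      (A.ann r).2.1 = s ∨ (A.ann r).2.2 = (A.pool i).arr k + 1

/-- What holds for a process, depending on its position, about the announcements. -/
def State.AnnInv (A : State P M V) (i : Fin P) (op : Op M V) : Local V → Prop
  | .readAnn => ¬ op.IsWrite
  | .post x => ¬ op.IsWrite ∧ A.ann i = x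
  | .readObj s => ¬ op.IsWrite ∧ (A.ann i).1 = op.loc ∧ (A.ann i).2.1 = s
  | .fill s _ => ¬ op.IsWrite ∧ (A.ann i).1 = op.loc ∧ (A.ann i).2.1 = s
  | .readPtr => ¬ op.IsWrite ∧ (A.ann i).1 = op.loc
  | .access x => ¬ op.IsWrite ∧ (A.ann i).1 = op.loc ∧ (A.ann i).2.2 = x + 1
  | .loadFresh => op.IsWrite
  | .initFresh _ => op.IsWrite
  | .readCur => op.IsWrite
  | .swing _ _ => op.IsWrite
  | .scan => op.IsWrite
  | .help j s => op.IsWrite ∧ A.Helping i j s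
  | .helpFill j s _ => op.IsWrite ∧ A.Helping i j s
  | .rescan => op.IsWrite ∧ ∀ r : Fin P, (r : ℕ) = (A.pool i).a →
      ∀ k, k < 3 * P → A.Danger r ((A.pool i).arr k) → (A.ann r).2.2 = (A.pool i).arr k + 1
  | .fin _ => True

/-- The invariant of the reuse of value objects. -/
structure State.Safe (A : State P M V) : Prop where
  obj_inj : ∀ j j', j < M → j' < M → (A.obj j).1 = (A.obj j').1 → j = j'
  obj_arr : ∀ j p k, j < M → k < 3 * P → (A.obj j).1 ≠ (A.pool p).arr k
  arr_arr : ∀ p p' k k', k < 3 * P → k' < 3 * P → (A.pool p).arr k = (A.pool p').arr k' → p = p'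
  obj_lt : ∀ j, j < M → (A.obj j).1 < M + 3 * P * P
  arr_lt : ∀ p k, k < 3 * P → (A.pool p).arr k < M + 3 * P * P
  pool : ∀ p, (A.pool p).Inv P A.Danger (A.proc p).Scanning (A.pool p).a
  asking : ∀ i : Fin P, (A.ann i).2.2 = 0 → (A.proc i).Asking
  annInv : ∀ i op l, A.proc i = .busy op l → A.AnnInv i op l

theorem State.goto_proc (A : State P M V) (i : Fin P) (p : Proc M V) (h : Fin P) :
    (A.goto i p).proc h = if h = i then p else A.proc h := by
  simp [State.goto, Function.update_apply]

theorem State.Safe.loc_lt {A : State P M V} (hA : A.Safe) (i : Fin P)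
    (h : (A.ann i).2.2 = 0) : (A.ann i).1 < M := by
  have h1 := hA.asking i h
  rcases hp : A.proc i with _ | ⟨op, l⟩
  · simp [hp, Proc.Asking] at h1
  · have h2 := hA.annInv i op l hp
    cases l <;> simp [hp, Proc.Asking] at h1 <;> simp only [State.AnnInv] at h2 <;>
      rw [h2.2.1] <;> exact op.loc.2

/-- Steps that leave the pointers and the pools alone. -/
theorem State.Safe.frame {A B : State P M V} (hA : A.Safe) (i : Fin P)
    (hobj : B.obj = A.obj) (hpool : B.pool = A.pool)
    (hproc : ∀ h, h ≠ i → B.proc h = A.proc h)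
    (hann : ∀ r : Fin P, B.ann r = A.ann r ∨
      ((A.ann r).2.2 = 0 ∧ ∃ y, B.ann r = ((A.ann r).1, (A.ann r).2.1, y + 1)) ∨
      (r = i ∧ (A.ann r).2.2 ≠ 0 ∧ (B.ann r).2.1 = (A.ann r).2.1 + 1 ∧
        ∀ x, ¬ B.Danger r x))
    (hdanger : ∀ r x, B.Danger r x → A.Danger r x ∨ ∃ j, j < M ∧ (A.obj j).1 = x)
    (hscan : (B.proc i).Scanning ↔ (A.proc i).Scanning)
    (hask : (B.ann i).2.2 = 0 → (B.proc i).Asking)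
    (hinv : ∀ op l, B.proc i = .busy op l → B.AnnInv i op l) : B.Safe := by
  -- A new threat concerns an object shown by a pointer, and no process owns such an object.
  have hd : ∀ r p k, k < 3 * P → B.Danger r ((A.pool p).arr k) →
      A.Danger r ((A.pool p).arr k) := by
    intro r p k hk h
    rcases hdanger r _ h with h | ⟨j, hj, h⟩
    · exact h
    · exact absurd h (hA.obj_arr j p k hj hk)
  have hs : ∀ p, (B.proc p).Scanning ↔ (A.proc p).Scanning := by
    intro p
    by_cases hp : p = i
    · subst hp; exact hscan
    · rw [hproc p hp]
  constructor
  · rw [hobj]; exact hA.obj_inj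
  · rw [hobj, hpool]; exact hA.obj_arr
  · rw [hpool]; exact hA.arr_arr
  · rw [hobj]; exact hA.obj_lt
  · rw [hpool]; exact hA.arr_lt
  · intro p
    rw [hpool, propext (hs p)]
    exact (hA.pool p).mono fun r k hk => hd r p k hk
  · intro r hr
    by_cases hri : r = i
    · subst hri; exact hask hr
    · rw [hproc r hri]
      rcases hann r with h | ⟨-, y, h⟩ | ⟨h, -⟩
      · rw [h] at hr; exact hA.asking r hr
      · rw [h] at hr; simp at hr
      · exact absurd h hri
  · intro r op l hrl
    by_cases hri : r = i
    · subst hri; exact hinv op l hrl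
    · rw [hproc r hri] at hrl
      have h := hA.annInv r op l hrl
      have hask' := hA.asking r
      rw [hrl] at hask'
      have hr : B.ann r = A.ann r ∨ ((A.ann r).2.2 = 0 ∧
          ∃ y, B.ann r = ((A.ann r).1, (A.ann r).2.1, y + 1)) := by
        rcases hann r with h | h | ⟨h, -⟩
        · exact .inl h
        · exact .inr h
        · exact absurd h hri
      have hhelp : ∀ j s, A.Helping r j s → B.Helping r j s := by
        rintro j s ⟨hj, h⟩
        refine ⟨hj, fun t ht => ?_⟩
        rw [hpool] at ht ⊢
        obtain ⟨h1, h2, h3⟩ := h t ht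
        -- If the helped announcement has been filled, a threat is the filled object. If it has been
        -- replaced, its number is larger than `s`, and the new announcement starts without threats.
        rcases hann t with h' | ⟨-, y, h'⟩ | ⟨-, -, h', h''⟩
        · rw [h']
          exact ⟨h1, h2, fun k hk hkd => h3 k hk (hd _ _ _ hk hkd)⟩
        · refine ⟨by rw [h']; exact h1, by rw [h']; exact h2, fun k hk hkd => .inr ?_⟩
          rcases hkd with hkd | ⟨hkd, -⟩
          · exact hkd
          · rw [h'] at hkd; simp at hkd
        · exact ⟨by omega, by omega, fun k hk hkd => absurd hkd (h'' _)⟩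
      cases l with
      | readAnn => exact h
      | post x =>
        rcases hr with hr | ⟨hr, -⟩
        · exact ⟨h.1, hr.trans h.2⟩
        · exact (hask' hr).elim
      | readObj s => rcases hr with hr | ⟨-, y, hr⟩ <;> simpa only [AnnInv, hr] using h
      | fill s x => rcases hr with hr | ⟨-, y, hr⟩ <;> simpa only [AnnInv, hr] using h
      | readPtr => rcases hr with hr | ⟨-, y, hr⟩ <;> simpa only [AnnInv, hr] using h
      | access x =>
        rcases hr with hr | ⟨hr, -⟩
        · simpa only [AnnInv, hr] using h
        · exact (hask' hr).elim
      | help j s => exact ⟨h.1, hhelp j s h.2⟩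
      | helpFill j s x => exact ⟨h.1, hhelp j s h.2⟩
      | rescan =>
        refine ⟨h.1, fun t ht k hk hkd => ?_⟩
        rw [hpool] at ht hkd ⊢
        have h3 := h.2 t ht k hk (hd _ _ _ hk hkd)
        rcases hann t with h' | ⟨h', -⟩ | ⟨-, -, -, h'⟩
        · rw [h']; exact h3
        · omega
        · exact absurd hkd (h' _)
      | loadFresh => exact h
      | initFresh y => exact h
      | readCur => exact h
      | swing x e => exact h
      | scan => exact h
      | fin r => trivial

end System

/-! ### Preservation of safe reuse under every transition -/

section System

variable {P M : ℕ} {V : Type u}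

/-- Going there does not threaten any value object. -/
def Proc.Calm : Proc M V → Prop
  | .busy _ (.fill _ _) => False
  | .busy _ (.helpFill _ _ _) => False
  | _ => True

/-- Candidates arise only when a process has just read a pointer, for its own announcement or for
one that it helps. Changes of `(B.pool i).a` matter only if process `i` arrives at `helpFill`. -/
theorem State.Cand.of_goto {A B : State P M V} {i : Fin P} {p : Proc M V}
    (hproc : B.proc = Function.update A.proc i p)
    (hpool : ∀ h, h ≠ i → (B.pool h).a = (A.pool h).a) {r : Fin P} {j s x : ℕ}
    (h : B.Cand r j s x) : A.Cand r j s x ∨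
      (r = i ∧ ∃ op, p = .busy op (.fill s x) ∧ (op.loc : ℕ) = j) ∨
      ∃ op, p = .busy op (.helpFill j s x) ∧ (B.pool i).a = r := by
  rcases h with ⟨op, h1, h2⟩ | ⟨h, op, h1, h2⟩
  · rw [hproc, Function.update_apply] at h1
    split at h1
    · exact .inr (.inl ⟨by assumption, op, h1, h2⟩)
    · exact .inl (.inl ⟨op, h1, h2⟩)
  · rw [hproc, Function.update_apply] at h1
    split at h1
    · subst h
      exact .inr (.inr ⟨op, h1, h2⟩)
    · rename_i hh
      rw [hpool h hh] at h2
      exact .inl (.inr ⟨h, op, h1, h2⟩)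

theorem State.Cand.of_calm {A B : State P M V} {i : Fin P} {p : Proc M V}
    (hproc : B.proc = Function.update A.proc i p)
    (hpool : ∀ h, h ≠ i → (B.pool h).a = (A.pool h).a) (hp : p.Calm) {r : Fin P} {j s x : ℕ}
    (h : B.Cand r j s x) : A.Cand r j s x := by
  rcases h.of_goto hproc hpool with h | ⟨-, op, rfl, -⟩ | ⟨op, rfl, -⟩
  · exact h
  · exact hp.elim
  · exact hp.elim

theorem State.Danger.of_calm {A B : State P M V} {i : Fin P} {p : Proc M V}
    (hproc : B.proc = Function.update A.proc i p) (hann : B.ann = A.ann)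
    (hpool : ∀ h, h ≠ i → (B.pool h).a = (A.pool h).a) (hp : p.Calm) {r : Fin P} {x : ℕ}
    (h : B.Danger r x) : A.Danger r x := by
  rcases h with h | ⟨h1, h2⟩
  · rw [hann] at h; exact .inl h
  · rw [hann] at h1 h2; exact .inr ⟨h1, h2.of_calm hproc hpool hp⟩

theorem State.Safe.calm {A B : State P M V} (hA : A.Safe) {i : Fin P} {p : Proc M V}
    (hproc : B.proc = Function.update A.proc i p)
    (hobj : B.obj = A.obj) (hann : B.ann = A.ann) (hpool : B.pool = A.pool) (hp : p.Calm)
    (hscan : p.Scanning ↔ (A.proc i).Scanning)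
    (hask : (A.ann i).2.2 = 0 → p.Asking)
    (hinv : ∀ op l, p = .busy op l → B.AnnInv i op l) : B.Safe := by
  have hi : B.proc i = p := by rw [hproc, Function.update_self]
  refine hA.frame i hobj hpool (fun h hh => by rw [hproc, Function.update_of_ne hh])
    (fun r => .inl (by rw [hann]))
    (fun r x h => .inl (h.of_calm hproc hann (fun h _ => by rw [hpool]) hp)) ?_ ?_ ?_
  · rw [hi]; exact hscan
  · rw [hi, hann]; exact hask
  · rw [hi]; exact hinv

theorem State.Safe.not_asking {A : State P M V} (hA : A.Safe) {i : Fin P}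
    (h : ¬ (A.proc i).Asking) : (A.ann i).2.2 ≠ 0 := fun h' => h (hA.asking i h')

theorem State.Danger.of_filled {A : State P M V} {r : Fin P} {x y : ℕ} (h : A.Danger r x)
    (hr : (A.ann r).2.2 = y + 1) : x = y := by
  rcases h with h | ⟨h, -⟩ <;> omega

/-- A process that owns all objects of its pool ends a scan. -/
theorem State.Safe.scanned {A B : State P M V} (hA : A.Safe) {i : Fin P} {op : Op M V}
    {r : Ret V} {y : ℕ} (hscan : (A.proc i).Scanning)
    (hproc : B.proc = Function.update A.proc i (.busy op (.fin r)))
    (hobj : B.obj = A.obj) (hann : B.ann = A.ann)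
    (hpool : B.pool = Function.update A.pool i ((A.pool i).scanned P y))
    (hD : ∀ r : Fin P, (r : ℕ) = (A.pool i).a →
      ∀ k, k < 3 * P → A.Danger r ((A.pool i).arr k) → y = (A.pool i).arr k + 1) :
    B.Safe := by
  have hd : ∀ r x, B.Danger r x → A.Danger r x := fun r x h => h.of_calm hproc hann
    (fun h hh => by rw [hpool, Function.update_of_ne hh]) trivial
  have hpi := hA.pool i
  -- This turns the invariant of the pool into its form after the exchange, as scans require.
  rw [show (A.proc i).Scanning = True from propext (iff_true_intro hscan)] at hpi
  obtain ⟨hq, hsub⟩ := hpi.scanned fun k hk r hr h => hD r hr k hk h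
  have hsub' : ∀ p k, k < 3 * P → ∃ l, l < 3 * P ∧ (B.pool p).arr k = (A.pool p).arr l := by
    intro p k hk
    rw [hpool]
    by_cases hp : p = i
    · subst hp; rw [Function.update_self]; exact hsub k hk
    · rw [Function.update_of_ne hp]; exact ⟨k, hk, rfl⟩
  constructor
  · rw [hobj]; exact hA.obj_inj
  · intro j p k hj hk
    obtain ⟨l, hl, h⟩ := hsub' p k hk
    rw [hobj, h]; exact hA.obj_arr j p l hj hl
  · intro p p' k k' hk hk' h
    obtain ⟨l, hl, h1⟩ := hsub' p k hk
    obtain ⟨l', hl', h2⟩ := hsub' p' k' hk'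
    rw [h1, h2] at h
    exact hA.arr_arr p p' l l' hl hl' h
  · rw [hobj]; exact hA.obj_lt
  · intro p k hk
    obtain ⟨l, hl, h⟩ := hsub' p k hk
    rw [h]; exact hA.arr_lt p l hl
  · intro p
    by_cases hp : p = i
    · subst hp
      rw [hpool, hproc, Function.update_self, Function.update_self]
      exact hq.mono fun r k hk => hd r _
    · rw [hpool, hproc, Function.update_of_ne hp, Function.update_of_ne hp]
      exact (hA.pool p).mono fun r k hk => hd r _
  · intro r hr
    rw [hann] at hr
    have h := hA.asking r hr
    by_cases hri : r = i
    · subst hri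
      rcases hp : A.proc r with _ | ⟨op, l⟩
      · simp [hp, Proc.Asking] at h
      · cases l <;> simp [hp, Proc.Asking, Proc.Scanning] at h hscan
    · rw [hproc, Function.update_of_ne hri]; exact h
  · intro r op' l hrl
    by_cases hri : r = i
    · subst hri
      rw [hproc, Function.update_self] at hrl
      cases hrl
      trivial
    · rw [hproc, Function.update_of_ne hri] at hrl
      have h := hA.annInv r op' l hrl
      have hpr : B.pool r = A.pool r := by rw [hpool, Function.update_of_ne hri]
      have hhelp : ∀ j s, A.Helping r j s → B.Helping r j s := by
        rintro j s ⟨hj, h⟩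
        refine ⟨hj, fun t ht => ?_⟩
        rw [hpr] at ht ⊢
        rw [hann]
        obtain ⟨h1, h2, h3⟩ := h t ht
        exact ⟨h1, h2, fun k hk hkd => h3 k hk (hd _ _ hkd)⟩
      cases l <;> simp only [AnnInv, hann] at h ⊢ <;> try exact h
      · exact ⟨h.1, hhelp _ _ h.2⟩
      · exact ⟨h.1, hhelp _ _ h.2⟩
      · rw [hpr]
        exact ⟨h.1, fun t ht k hk hkd => h.2 t ht k hk (hd _ _ hkd)⟩

/-- A write replaces a pointer by a pointer to an object that nobody else can access. -/
theorem State.Safe.exchange {A B : State P M V} (hA : A.Safe) {i : Fin P} {op : Op M V}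
    {x e : ℕ} (hi : A.proc i = .busy op (.swing x e)) {e' : ℕ}
    (hproc : B.proc = Function.update A.proc i (.busy op .scan))
    (hx : A.obj op.loc = (x, e))
    (hobj : B.obj = Function.update A.obj op.loc ((A.pool i).fresh, e')) (hann : B.ann = A.ann)
    (hpool : B.pool = Function.update A.pool i ((A.pool i).exchange x)) :
    B.Safe := by
  have hd : ∀ r x, B.Danger r x → A.Danger r x := fun r x h => h.of_calm hproc hann
    (fun h hh => by rw [hpool, Function.update_of_ne hh]) trivial
  have hpi := hA.pool i
  rw [hi, show (Proc.busy op (.swing x e)).Scanning = False from rfl] at hpi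
  have hslot := hpi.slot_lt
  set s := (A.pool i).hb + (A.pool i).a with hs
  have hf : (A.pool i).fresh = (A.pool i).arr s := rfl
  have hloc : (op.loc : ℕ) < M := op.loc.2
  have hx' : (A.obj op.loc).1 = x := by rw [hx]
  have hBo : ∀ j, (B.obj j).1 = if j = op.loc then (A.pool i).arr s else (A.obj j).1 := by
    intro j; rw [hobj, Function.update_apply]; split <;> simp [hf]
  have hBa : ∀ p k, (B.pool p).arr k = if p = i ∧ k = s then x else (A.pool p).arr k := by
    intro p k
    rw [hpool]
    by_cases hp : p = i
    · subst hp; simp [Pool.exchange, Function.update_apply, hs]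
    · simp [hp]
  -- The replaced object was shown by a pointer, so it belonged to no pool; the swing transfers it
  -- to the pool of process `i` in exchange for the fresh one.
  have hxa : ∀ p k, k < 3 * P → (A.pool p).arr k ≠ x := fun p k hk h =>
    hA.obj_arr op.loc p k hloc hk (hx'.trans h.symm)
  have hxs : ∀ j, j < M → (A.obj j).1 = x → j = op.loc := fun j hj h =>
    hA.obj_inj j op.loc hj hloc (h.trans hx'.symm)
  constructor
  · intro j j' hj hj'
    rw [hBo, hBo]
    have := hA.obj_inj j j' hj hj'
    have := hA.obj_arr j i s hj hslot
    have := hA.obj_arr j' i s hj' hslot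
    grind
  · intro j p k hj hk
    rw [hBo, hBa]
    have h1 := hA.obj_arr j p k hj hk
    have h2 := hxa p k hk
    have h3 := hxs j hj
    have h4 := hxa i s hslot
    have h5 := hA.arr_arr i p s k hslot hk
    have h6 := hpi.inj s k hslot hk
    grind
  · intro p p' k k' hk hk'
    rw [hBa, hBa]
    have h1 := hA.arr_arr p p' k k' hk hk'
    have h2 := hxa p k hk
    have h3 := hxa p' k' hk'
    grind
  · intro j hj
    rw [hBo]
    split
    · exact hA.arr_lt i s hslot
    · exact hA.obj_lt j hj
  · intro p k hk
    rw [hBa]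
    split
    · rw [← hx']; exact hA.obj_lt _ hloc
    · exact hA.arr_lt p k hk
  · intro p
    by_cases hp : p = i
    · subst hp
      rw [hpool, hproc, Function.update_self, Function.update_self]
      exact (hpi.exchange fun k hk => hxa p k hk).mono fun r k hk => hd r _
    · rw [hpool, hproc, Function.update_of_ne hp, Function.update_of_ne hp]
      exact (hA.pool p).mono fun r k hk => hd r _
  · intro r hr
    rw [hann] at hr
    have h := hA.asking r hr
    by_cases hri : r = i
    · subst hri; rw [hi] at h; exact h.elim
    · rw [hproc, Function.update_of_ne hri]; exact h
  · intro r op' l hrl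
    by_cases hri : r = i
    · subst hri
      rw [hproc, Function.update_self] at hrl
      cases hrl
      exact hA.annInv r op _ hi
    · rw [hproc, Function.update_of_ne hri] at hrl
      have h := hA.annInv r op' l hrl
      have hpr : B.pool r = A.pool r := by rw [hpool, Function.update_of_ne hri]
      have hhelp : ∀ j s, A.Helping r j s → B.Helping r j s := by
        rintro j s ⟨hj, h⟩
        refine ⟨hj, fun t ht => ?_⟩
        rw [hpr] at ht ⊢
        rw [hann]
        obtain ⟨h1, h2, h3⟩ := h t ht
        exact ⟨h1, h2, fun k hk hkd => h3 k hk (hd _ _ hkd)⟩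
      cases l <;> simp only [AnnInv, hann] at h ⊢ <;> try exact h
      · exact ⟨h.1, hhelp _ _ h.2⟩
      · exact ⟨h.1, hhelp _ _ h.2⟩
      · rw [hpr]
        exact ⟨h.1, fun t ht k hk hkd => h.2 t ht k hk (hd _ _ hkd)⟩

/-- No helper can hold the new sequence number, since helpers carry numbers that have already
appeared in the announcement. So a pointer read for an earlier announcement cannot fill this one. -/
theorem State.Safe.not_danger_of_post {A B : State P M V} (hA : A.Safe) {i : Fin P}
    {op : Op M V} {x : Rec} (h : A.proc i = .busy op (.post x))
    (hproc : B.proc = Function.update A.proc i (.busy op (.readObj (x.2.1 + 1))))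
    (hpool : B.pool = A.pool) (hann : B.ann i = (↑op.loc, x.2.1 + 1, 0)) (y : ℕ) :
    ¬ B.Danger i y := by
  obtain ⟨-, hx⟩ := hA.annInv i op _ h
  rintro (hy | ⟨-, hy⟩)
  · rw [hann] at hy; simp at hy
  · rw [hann] at hy
    rcases hy.of_calm hproc (fun _ _ => by rw [hpool]) trivial with
      ⟨op', h1, -⟩ | ⟨g, op', h1, h2⟩
    · rw [h] at h1; cases h1
    · have := (hA.annInv g op' _ h1).2.2 i h2.symm
      rw [hx] at this
      exact absurd this (by simp)

/-- Filling an announcement creates no threats. -/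
theorem State.Danger.of_fill {A B : State P M V} {i g : Fin P} {p : Proc M V} {j s x : ℕ}
    (hproc : B.proc = Function.update A.proc i p) (hpool : B.pool = A.pool) (hp : p.Calm)
    (hann : B.ann = Function.update A.ann g (j, s, x + 1)) (hg : A.ann g = (j, s, 0))
    (hc : A.Cand g j s x) {r : Fin P} {y : ℕ} (h : B.Danger r y) : A.Danger r y := by
  by_cases hr : r = g
  · subst hr
    obtain rfl := h.of_filled (y := x) (by rw [hann, Function.update_self])
    exact .inr ⟨by rw [hg], by rw [hg]; exact hc⟩
  · have hBr : B.ann r = A.ann r := by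
      rw [hann, Function.update_of_ne (by simpa [Fin.val_inj] using hr)]
    rcases h with hy | ⟨hy, hy'⟩
    · rw [hBr] at hy; exact .inl hy
    · rw [hBr] at hy hy'
      exact .inr ⟨hy, hy'.of_calm hproc (fun _ _ => by rw [hpool]) hp⟩

theorem State.Safe.step {A B : State P M V} {e : Option (Event P M V)} (hA : A.Safe)
    (h : A.Step e B) : B.Safe := by
  cases h with
  | invoke i op h =>
    refine hA.calm (p := .busy op op.first) rfl rfl rfl rfl ?_ ?_ ?_ ?_
    · unfold Op.first; split <;> trivial
    · rw [h]; unfold Op.first; split <;> simp [Proc.Scanning]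
    · intro hi; have := hA.asking i hi; rw [h] at this; exact this.elim
    · rintro op' l heq
      cases heq
      unfold Op.first
      split <;> assumption
  | respond i op r h =>
    refine hA.calm (p := .idle) rfl rfl rfl rfl trivial (by rw [h]; rfl) ?_ (by simp)
    intro hi; have := hA.asking i hi; rw [h] at this; exact this.elim
  | readAnn i op h =>
    refine hA.calm (p := .busy op (.post (A.ann i))) rfl rfl rfl rfl trivial (by rw [h]; rfl) ?_ ?_
    · intro hi; have := hA.asking i hi; rw [h] at this; exact this.elim
    · rintro op' l heq
      cases heq
      exact ⟨hA.annInv i op _ h, rfl⟩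
  | post i op x h =>
    obtain ⟨hw, hx⟩ := hA.annInv i op _ h
    have hne : (A.ann i).2.2 ≠ 0 := hA.not_asking (by rw [h]; exact id)
    set B : State P M V := State.goto
      { A with ann := Function.update A.ann i (↑op.loc, x.2.1 + 1, 0) } i
        (.busy op (.readObj (x.2.1 + 1))) with hB
    have hBi : B.ann i = (↑op.loc, x.2.1 + 1, 0) := by simp [hB, State.goto]
    have hBr : ∀ r : Fin P, r ≠ i → B.ann r = A.ann r := by
      intro r hr
      simp [hB, State.goto, Fin.val_inj, hr]
    have hdi := fun y => hA.not_danger_of_post (B := B) h rfl rfl hBi y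
    refine hA.frame i rfl rfl ?_ ?_ ?_ ?_ ?_ ?_
    · intro r hr
      simp [hB, State.goto, hr]
    · intro r
      by_cases hr : r = i
      · subst hr
        exact .inr (.inr ⟨rfl, hne, by rw [hBi, hx], hdi⟩)
      · exact .inl (hBr r hr)
    · intro r y hry
      by_cases hr : r = i
      · subst hr; exact absurd hry (hdi y)
      · left
        rcases hry with hy | ⟨hy, hy'⟩
        · rw [hBr r hr] at hy; exact .inl hy
        · rw [hBr r hr] at hy hy'; exact .inr ⟨hy, State.Cand.of_calm (A := A) (B := B) (i := i)
            (p := .busy op (.readObj (x.2.1 + 1))) rfl (fun _ _ => rfl) trivial hy'⟩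
    · rw [h]; simp [hB, State.goto, Proc.Scanning]
    · intro; simp [hB, State.goto, Proc.Asking]
    · intro op' l hl
      simp only [hB, State.goto, Function.update_self] at hl
      cases hl
      exact ⟨hw, by rw [hBi], by rw [hBi]⟩
  | readObj i op s h =>
    have hi := hA.annInv i op _ h
    refine hA.frame i rfl rfl ?_ (fun _ => .inl rfl) ?_ ?_ ?_ ?_
    · intro r hr
      simp [State.goto, hr]
    · rintro r y (hy | ⟨hy, hy'⟩)
      · exact .inl (.inl hy)
      · rcases State.Cand.of_goto (A := A) (B := A.goto i _) rfl (fun _ _ => rfl) hy' with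
          hc | ⟨-, op', hc, -⟩ | ⟨op', hc, -⟩
        · exact .inl (.inr ⟨hy, hc⟩)
        · injection hc with _ hc
          injection hc with _ hc
          -- The only new candidate is the object to which the location points right now.
          exact .inr ⟨op.loc, op.loc.2, hc⟩
        · cases hc
    · rw [h]; simp [State.goto, Proc.Scanning]
    · intro; simp [State.goto, Proc.Asking]
    · intro op' l hl
      simp only [State.goto, Function.update_self] at hl
      cases hl
      exact hi
  | fill i op s x h h' =>
    have hi := hA.annInv i op _ h
    set B : State P M V := State.goto
      { A with ann := Function.update A.ann i (↑op.loc, s, x + 1) } i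
        (.busy op .readPtr) with hB
    have hBi : B.ann i = (↑op.loc, s, x + 1) := by simp [hB, State.goto]
    have hBr : ∀ r : Fin P, r ≠ i → B.ann r = A.ann r := by
      intro r hr
      simp [hB, State.goto, Fin.val_inj, hr]
    refine hA.frame i rfl rfl ?_ ?_ ?_ ?_ ?_ ?_
    · intro r hr
      simp [hB, State.goto, hr]
    · intro r
      by_cases hr : r = i
      · subst hr
        exact .inr (.inl ⟨by rw [h'], x, by rw [hBi, h']⟩)
      · exact .inl (hBr r hr)
    · exact fun r y hry => .inl (State.Danger.of_fill (A := A) (B := B) (i := i) (g := i) (p := .busy op .readPtr)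
        rfl rfl trivial rfl h' (.inl ⟨op, h, rfl⟩) hry)
    · rw [h]; simp [hB, State.goto, Proc.Scanning]
    · intro h0; rw [hBi] at h0; simp at h0
    · intro op' l hl
      simp only [hB, State.goto, Function.update_self] at hl
      cases hl
      exact ⟨hi.1, by rw [hBi]⟩
  | fill_fail i op s x h h' =>
    have hi := hA.annInv i op _ h
    refine hA.calm (p := .busy op .readPtr) rfl rfl rfl rfl trivial (by rw [h]; rfl) ?_ ?_
    -- A failed CAS means that somebody has filled the announcement: location and number still
    -- agree, so the third component is nonzero.
    · intro h0
      exact absurd (Prod.ext hi.2.1 (Prod.ext hi.2.2 h0)) h'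
    · rintro op' l heq
      cases heq
      exact ⟨hi.1, hi.2.1⟩
  | readPtr i op h =>
    have hi := hA.annInv i op _ h
    have hne : (A.ann i).2.2 ≠ 0 := hA.not_asking (by rw [h]; exact id)
    refine hA.calm (p := .busy op (.access ((A.ann i).2.2 - 1))) rfl rfl rfl rfl trivial
      (by rw [h]; rfl) (fun h0 => absurd h0 hne) ?_
    rintro op' l heq
    cases heq
    exact ⟨hi.1, hi.2, by show (A.ann i).2.2 = _; omega⟩
  | access i op x h =>
    have hne : (A.ann i).2.2 ≠ 0 := hA.not_asking (by rw [h]; exact id)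
    refine hA.calm (p := .busy op (.fin (op.act (A.buf x)).2)) rfl rfl rfl rfl trivial
      (by rw [h]; rfl) (fun h0 => absurd h0 hne) ?_
    rintro op' l heq
    cases heq
    trivial
  | loadFresh i op h =>
    have hi := hA.annInv i op _ h
    have hne : (A.ann i).2.2 ≠ 0 := hA.not_asking (by rw [h]; exact id)
    refine hA.calm (p := .busy op (.initFresh (A.buf (A.pool i).fresh))) rfl rfl rfl rfl trivial
      (by rw [h]; rfl) (fun h0 => absurd h0 hne) ?_
    rintro op' l heq
    cases heq
    exact hi
  | initFresh i j v y h =>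
    have hi := hA.annInv i _ _ h
    have hne : (A.ann i).2.2 ≠ 0 := hA.not_asking (by rw [h]; exact id)
    refine hA.calm (p := .busy (.write j v) .readCur) rfl rfl rfl rfl trivial
      (by rw [h]; rfl) (fun h0 => absurd h0 hne) ?_
    rintro op' l heq
    cases heq
    exact hi
  | readCur i op h =>
    have hi := hA.annInv i op _ h
    have hne : (A.ann i).2.2 ≠ 0 := hA.not_asking (by rw [h]; exact id)
    refine hA.calm (p := .busy op (.swing (A.obj op.loc).1 (A.obj op.loc).2)) rfl rfl rfl rfl
      trivial (by rw [h]; rfl) (fun h0 => absurd h0 hne) ?_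
    rintro op' l heq
    cases heq
    exact hi
  | swing i op x e h h' => exact hA.exchange h rfl h' rfl rfl rfl
  | swing_fail i op x e h h' =>
    have hne : (A.ann i).2.2 ≠ 0 := hA.not_asking (by rw [h]; exact id)
    refine hA.calm (p := .busy op (.fin .ack)) rfl rfl rfl rfl trivial
      (by rw [h]; rfl) (fun h0 => absurd h0 hne) ?_
    rintro op' l heq
    cases heq
    trivial
  | scan i op h h' =>
    refine hA.scanned (by rw [h]; trivial) rfl rfl rfl rfl fun r hr k hk hd => ?_
    rw [← hr] at h' ⊢
    rcases hd with hd | ⟨hd, -⟩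
    · exact hd
    · exact absurd hd h'
  | scan_open i op h h' =>
    have hi := hA.annInv i op _ h
    have hne : (A.ann i).2.2 ≠ 0 := hA.not_asking (by rw [h]; exact id)
    refine hA.calm (p := .busy op (.help _ _)) rfl rfl rfl rfl trivial
      (by rw [h]; rfl) (fun h0 => absurd h0 hne) ?_
    rintro op' l heq
    cases heq
    refine ⟨hi, hA.loc_lt ⟨(A.pool i).a, (hA.pool i).a_lt⟩ h', fun r hr => ?_⟩
    have hr' : (r : ℕ) = (A.pool i).a := hr
    rw [← hr']
    exact ⟨le_rfl, fun _ => rfl, fun _ _ _ => .inl rfl⟩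
  | help i op j s h =>
    have hi := hA.annInv i op _ h
    have hne : (A.ann i).2.2 ≠ 0 := hA.not_asking (by rw [h]; exact id)
    have hd : ∀ r y, (A.goto i (.busy op (.helpFill j s (A.obj j).1))).Danger r y →
        A.Danger r y ∨ ∃ j, j < M ∧ (A.obj j).1 = y := by
      rintro r y (hy | ⟨hy, hy'⟩)
      · exact .inl (.inl hy)
      · rcases State.Cand.of_goto (A := A) (B := A.goto i _) rfl (fun _ _ => rfl) hy' with
          hc | ⟨-, op', hc, -⟩ | ⟨op', hc, -⟩
        · exact .inl (.inr ⟨hy, hc⟩)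
        · cases hc
        · injection hc with _ hc
          injection hc with _ _ hc
          exact .inr ⟨_, hi.2.1, hc⟩
    refine hA.frame i rfl rfl ?_ (fun _ => .inl rfl) hd ?_ ?_ ?_
    · intro r hr
      simp [State.goto, hr]
    · rw [h]; simp [State.goto, Proc.Scanning]
    · intro h0; exact absurd h0 hne
    · intro op' l hl
      simp only [State.goto, Function.update_self] at hl
      cases hl
      refine ⟨hi.1, hi.2.1, fun r hr => ?_⟩
      obtain ⟨h1, h2, h3⟩ := hi.2.2 r hr
      refine ⟨h1, h2, fun k hk hkd => ?_⟩
      rcases hd _ _ hkd with hkd | ⟨j', hj', hkd⟩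
      · exact h3 k hk hkd
      -- The pointer just read shows no object of the helper's own pool.
      · exact absurd hkd (hA.obj_arr j' i k hj' hk)
  | helpFill i op j s x h h' =>
    have hi := hA.annInv i op _ h
    have hne : (A.ann i).2.2 ≠ 0 := hA.not_asking (by rw [h]; exact id)
    set g : Fin P := ⟨(A.pool i).a, (hA.pool i).a_lt⟩ with hg
    have hga : (A.pool i).a = (g : ℕ) := rfl
    rw [hga] at h' ⊢
    set B : State P M V := State.goto
      { A with ann := Function.update A.ann g (j, s, x + 1) } i
        (.busy op .rescan) with hB
    have hBg : B.ann g = (j, s, x + 1) := by simp [hB, State.goto]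
    have hBr : ∀ r : Fin P, r ≠ g → B.ann r = A.ann r := by
      intro r hr
      simp only [hB, State.goto, Function.update_apply, Fin.val_inj, if_neg hr]
    -- A process in the middle of a write has no open announcement, so it never helps itself.
    have hgi : i ≠ g := by rintro hgi; rw [hgi, h'] at hne; exact hne rfl
    refine hA.frame i rfl rfl ?_ ?_ ?_ ?_ ?_ ?_
    · intro r hr
      simp [hB, State.goto, hr]
    · intro r
      by_cases hr : r = g
      · subst hr
        exact .inr (.inl ⟨by rw [h'], x, by rw [hBg, h']⟩)
      · exact .inl (hBr r hr)
    · exact fun r y hry => .inl (State.Danger.of_fill (A := A) (B := B) (i := i) (g := g) (p := .busy op .rescan)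
        rfl rfl trivial rfl h' (.inr ⟨i, op, h, rfl⟩) hry)
    · rw [h]; simp [hB, State.goto, Proc.Scanning]
    · intro h0; rw [hBr i hgi] at h0; exact absurd h0 hne
    · intro op' l hl
      simp only [hB, State.goto, Function.update_self] at hl
      cases hl
      refine ⟨hi.1, fun r hr k hk hkd => ?_⟩
      obtain rfl : r = g := Fin.ext hr
      have := hkd.of_filled (y := x) (by rw [hBg])
      rw [this, hBg]
  | helpFill_fail i op j s x h h' =>
    have hi := hA.annInv i op _ h
    have hne : (A.ann i).2.2 ≠ 0 := hA.not_asking (by rw [h]; exact id)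
    refine hA.calm (p := .busy op .rescan) rfl rfl rfl rfl trivial (by rw [h]; rfl)
      (fun h0 => absurd h0 hne) ?_
    rintro op' l heq
    cases heq
    refine ⟨hi.1, fun r hr k hk hkd => ?_⟩
    have hkd : A.Danger r ((A.pool i).arr k) := State.Danger.of_calm (A := A)
      (B := A.goto i _) (i := i)
      (p := .busy op .rescan) rfl rfl (fun _ _ => rfl) trivial hkd
    have hr : (r : ℕ) = (A.pool i).a := hr
    obtain ⟨h1, h2, h3⟩ := hi.2.2 r hr
    -- Either the announcement still has the number `s`, and since the CAS failed it is filled; or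
    -- it is a later one, which threatens an owned object only if it shows it.
    rcases h3 k hk hkd with h4 | h4
    · rcases hkd with hkd | ⟨hkd, -⟩
      · exact hkd
      · rw [← hr] at h'
        exact absurd (Prod.ext (h2 h4.symm).symm (Prod.ext h4 hkd)) h'
    · exact h4
  | rescan i op h =>
    have hi := hA.annInv i op _ h
    refine hA.scanned (by rw [h]; trivial) rfl rfl rfl rfl fun r hr k hk hd => ?_
    rw [← hr]
    exact hi.2 r hr k hk hd

end System

section System

variable {P M : ℕ} {V : Type u}

/-! ### Linearization of the transition system -/

/-- The response of an operation that has taken effect. -/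
def Local.ret : Local V → Option (Ret V)
  | .scan => some .ack
  | .help _ _ => some .ack
  | .helpFill _ _ _ => some .ack
  | .rescan => some .ack
  | .fin r => some r
  | _ => none

/-- Between the announcement of a location and the access to a value object. -/
def Local.Active : Local V → Prop
  | .readObj _ => True
  | .fill _ _ => True
  | .readPtr => True
  | .access _ => True
  | _ => False

/-- A pointer to the object, or a way to get one, exists. -/
def State.Exposed (A : State P M V) (x : ℕ) : Prop :=
  (∃ j, j < M ∧ (A.obj j).1 = x) ∨ ∃ r, A.Danger r x

/-- The current operation of process `r` was invoked before any entry of location `j` with key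
above `k` took effect. -/
def Cut (H : List (Event P M V)) (L : List (Ent P M V)) (r : Fin P) (j : Fin M) (k : ℕ) : Prop :=
  ∀ a op, Pending H r a op → ∀ z ∈ L, z.op.loc = j → k < z.key → a < z.stamp

/-- What holds for a process, depending on its position, about values. -/
def State.ValInv (A : State P M V) (H : List (Event P M V)) (L : List (Ent P M V)) (i : Fin P)
    (op : Op M V) : Local V → Prop
  | .initFresh y => A.buf (A.pool i).fresh = y
  | .readCur => ∀ j v, op = .write j v → A.buf (A.pool i).fresh = v
  | .swing x e => (∀ j v, op = .write j v → A.buf (A.pool i).fresh = v) ∧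
      e ≤ (A.obj op.loc).2 ∧ (e = (A.obj op.loc).2 → x = (A.obj op.loc).1) ∧
      Cut H L i op.loc (3 * e + 1)
  | _ => True

/-- The operation of a process is in the list if it has taken effect. -/
def Entered (L : List (Ent P M V)) (a : ℕ) : Option (Ret V) → Prop
  | none => ∀ z ∈ L, z.pos ≠ a
  | some r => ∃ z ∈ L, z.pos = a ∧ z.ret = r

/-- `L` linearizes the history `H` that leads to the state `A`; object `x` was last installed at
location `(home x).1` in epoch `(home x).2`. -/
structure State.Lin (σ₀ : Fin M → V) (A : State P M V) (H : List (Event P M V))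
    (L : List (Ent P M V)) (home : ℕ → ℕ × ℕ) : Prop where
  safe : A.Safe
  lin : LinInv σ₀ H L fun j => (A.obj j).2
  home_inj : Function.Injective home
  home_obj : ∀ j, j < M → home (A.obj j).1 = (j, (A.obj j).2)
  home_le : ∀ x j, j < M → (home x).1 = j → (home x).2 ≤ (A.obj j).2
  -- An exposed object holds the value of its location at the end of the reads and CAS of its epoch,
  -- even if that epoch is over. The contents of other objects are free to change.
  val : ∀ x (j : Fin M), A.Exposed x → (home x).1 = j →
    A.buf x = valAt σ₀ L j (3 * (home x).2)
  acq : ∀ r op l x, A.proc r = .busy op l → l.Active → A.Danger r x →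
    x < M + 3 * P * P ∧ (home x).1 = op.loc ∧ Cut H L r op.loc (3 * (home x).2)
  idle : ∀ i, A.proc i = .idle → ∀ a op, ¬ Pending H i a op
  pend : ∀ i op l, A.proc i = .busy op l → ∃ a, Pending H i a op ∧ Entered L a l.ret
  valInv : ∀ i op l, A.proc i = .busy op l → A.ValInv H L i op l

theorem State.Safe.obj_ne_fresh {A : State P M V} (hA : A.Safe) (i : Fin P) {j : ℕ}
    (hj : j < M) : (A.obj j).1 ≠ (A.pool i).fresh :=
  hA.obj_arr j i _ hj (hA.pool i).slot_lt

/-- Before the swing, the next object of a pool is neither shown by a pointer nor threatened by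
anyone, so its owner may overwrite it without affecting the abstract contents. -/
theorem State.Safe.not_exposed_fresh {A : State P M V} (hA : A.Safe) (i : Fin P)
    (h : ¬ (A.proc i).Scanning) : ¬ A.Exposed (A.pool i).fresh := by
  rintro (⟨j, hj, h'⟩ | ⟨r, h'⟩)
  · exact hA.obj_ne_fresh i hj h'
  · have hp := hA.pool i
    rw [show (A.proc i).Scanning = False from propext (iff_false_intro h)] at hp
    exact hp.fresh_safe r h'

/-- A process is a threat to an object because it was one before, or because the object has just
been read. -/
def State.Reach (A B : State P M V) : Prop := ∀ r x, B.Danger r x →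
  (A.Danger r x ∧ ∀ op l, B.proc r = .busy op l → l.Active →
      ∃ l', A.proc r = .busy op l' ∧ l'.Active) ∨
    ∃ op, x = (A.obj op.loc).1 ∧ ∀ op' l, B.proc r = .busy op' l → op' = op

theorem State.Reach.calm {A B : State P M V} {i : Fin P} {p : Proc M V}
    (hproc : B.proc = Function.update A.proc i p) (hann : B.ann = A.ann)
    (hpool : ∀ h, h ≠ i → (B.pool h).a = (A.pool h).a) (hp : p.Calm)
    (hact : ∀ op l, p = .busy op l → l.Active → ∃ l', A.proc i = .busy op l' ∧ l'.Active) :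
    A.Reach B := by
  refine fun r x hd => .inl ⟨hd.of_calm hproc hann hpool hp, fun op l hr hl => ?_⟩
  rw [hproc, Function.update_apply] at hr
  split at hr
  · subst r
    exact hact op l hr hl
  · exact ⟨l, hr, hl⟩

theorem State.Reach.exposed {A B : State P M V} (h : A.Reach B) (hobj : B.obj = A.obj) {x : ℕ}
    (hx : B.Exposed x) : A.Exposed x := by
  rcases hx with hx | ⟨r, hx⟩
  · rw [hobj] at hx; exact .inl hx
  · rcases h r x hx with ⟨hx, -⟩ | ⟨op, rfl, -⟩
    · exact .inr ⟨r, hx⟩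
    · exact .inl ⟨op.loc, op.loc.2, rfl⟩

/-- Steps that leave the pointers alone. -/
theorem State.Lin.frame {σ₀ : Fin M → V} {A B : State P M V} {H H' : List (Event P M V)}
    {L L' : List (Ent P M V)} {home : ℕ → ℕ × ℕ} (hA : A.Lin σ₀ H L home) (i : Fin P)
    (hsafe : B.Safe) (hobj : B.obj = A.obj) (hreach : A.Reach B)
    (hlin : LinInv σ₀ H' L' fun j => (A.obj j).2)
    (hval : ∀ x (j : Fin M), A.Exposed x → (home x).1 = j →
      B.buf x = valAt σ₀ L' j (3 * (home x).2))
    (hproc : ∀ h, h ≠ i → B.proc h = A.proc h)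
    (hfresh : ∀ h, h ≠ i → (B.pool h).fresh = (A.pool h).fresh)
    (hbuf : ∀ h, h ≠ i → ¬ (A.proc h).Scanning →
      B.buf (A.pool h).fresh = A.buf (A.pool h).fresh)
    (hpend : ∀ h, h ≠ i → ∀ a op, Pending H' h a op ↔ Pending H h a op)
    (hact : H' = H ∨ ∀ op l, B.proc i = .busy op l → ¬ l.Active)
    (hmem : ∀ z ∈ L, z ∈ L')
    (hnew : ∀ z ∈ L', z ∈ L ∨ ∃ op, Pending H i z.pos op)
    (hcut : ∀ r j k, Cut H L r j k → Cut H L' r j k)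
    (hiidle : B.proc i = .idle → ∀ a op, ¬ Pending H' i a op)
    (hipend : ∀ op l, B.proc i = .busy op l → ∃ a, Pending H' i a op ∧ Entered L' a l.ret)
    (hival : ∀ op l, B.proc i = .busy op l → B.ValInv H' L' i op l) :
    B.Lin σ₀ H' L' home := by
  have hcut' : ∀ r j k, r ≠ i → Cut H L r j k → Cut H' L' r j k := fun r j k hr hc a op hp =>
    hcut r j k hc a op ((hpend r hr a op).1 hp)
  constructor
  · exact hsafe
  · rw [hobj]; exact hlin
  · exact hA.home_inj
  · rw [hobj]; exact hA.home_obj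
  · rw [hobj]; exact hA.home_le
  · exact fun x j hx hj => hval x j (hreach.exposed hobj hx) hj
  · intro r op l x hr hl hd
    rcases hreach r x hd with ⟨hd, h'⟩ | ⟨op', rfl, h'⟩
    · obtain ⟨l', hl1, hl2⟩ := h' op l hr hl
      obtain ⟨h1, h2, h3⟩ := hA.acq r op l' x hl1 hl2 hd
      refine ⟨h1, h2, ?_⟩
      by_cases hri : r = i
      · subst hri
        rcases hact with rfl | hact
        · exact hcut _ _ _ h3
        · exact absurd hl (hact op l hr)
      · exact hcut' _ _ _ hri h3
    -- An object just read from its location belongs to the current epoch. No entry of the location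
    -- has a key above `3 * w`, so the cut holds vacuously.
    · obtain rfl := h' op l hr
      have hh := hA.home_obj op.loc op.loc.2
      refine ⟨hA.safe.obj_lt _ op.loc.2, by rw [hh], ?_⟩
      rw [hh]
      intro a op' _ z hz hzl hzk
      have := hlin.key_le z hz
      rw [hzl] at this
      exact absurd hzk (not_lt.2 this)
  · intro r hr a op
    by_cases hri : r = i
    · subst hri; exact hiidle hr a op
    · rw [hpend r hri]
      rw [hproc r hri] at hr
      exact hA.idle r hr a op
  · intro r op l hr
    by_cases hri : r = i
    · subst hri; exact hipend op l hr
    · rw [hproc r hri] at hr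
      obtain ⟨a, h1, h2⟩ := hA.pend r op l hr
      refine ⟨a, (hpend r hri a op).2 h1, ?_⟩
      cases hl : l.ret with
      | some t =>
        rw [hl] at h2
        obtain ⟨z, hz, h2⟩ := h2
        exact ⟨z, hmem z hz, h2⟩
      | none =>
        rw [hl] at h2
        intro z hz hza
        rcases hnew z hz with hz | ⟨op', hz⟩
        · exact h2 z hz hza
        · rw [hza] at hz
          have := hz.1.symm.trans h1.1
          simp only [Option.some.injEq, Event.inv.injEq] at this
          exact hri this.1.symm
  · intro r op l hr
    by_cases hri : r = i
    · subst hri; exact hival op l hr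
    · rw [hproc r hri] at hr
      have h := hA.valInv r op l hr
      have hb := hbuf r hri
      rw [hr] at hb
      cases l with
      | initFresh y =>
        simp only [ValInv] at h ⊢
        rw [hfresh r hri, hb id, h]
      | readCur =>
        simp only [ValInv] at h ⊢
        rw [hfresh r hri, hb id]; exact h
      | swing x e =>
        simp only [ValInv] at h ⊢
        rw [hfresh r hri, hb id, hobj]
        exact ⟨h.1, h.2.1, h.2.2.1, hcut' _ _ _ hri h.2.2.2⟩
      | _ => trivial

/-- Steps that change neither pointers nor exposed values, and where no operation takes effect. -/
theorem State.Lin.silent {σ₀ : Fin M → V} {A B : State P M V} {H : List (Event P M V)}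
    {L : List (Ent P M V)} {home : ℕ → ℕ × ℕ} (hA : A.Lin σ₀ H L home) {i : Fin P}
    {op : Op M V} {l l' : Local V} (hi : A.proc i = .busy op l)
    (hproc : B.proc = Function.update A.proc i (.busy op l'))
    (hsafe : B.Safe) (hobj : B.obj = A.obj) (hreach : A.Reach B)
    (hpool : ∀ h, h ≠ i → B.pool h = A.pool h)
    (hbuf : ∀ x, A.Exposed x → B.buf x = A.buf x)
    (hfresh : ∀ h, h ≠ i → B.buf (A.pool h).fresh = A.buf (A.pool h).fresh)
    (hret : l'.ret = l.ret) (hval : B.ValInv H L i op l') : B.Lin σ₀ H L home := by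
  have hBi : B.proc i = .busy op l' := by rw [hproc, Function.update_self]
  refine hA.frame i hsafe hobj hreach hA.lin ?_ ?_ ?_ ?_ (fun _ _ _ _ => Iff.rfl) (.inl rfl)
    (fun z hz => hz) (fun z hz => .inl hz) (fun _ _ _ h => h) ?_ ?_ ?_
  · intro x j hx hj
    rw [hbuf x hx]; exact hA.val x j hx hj
  · intro h hh
    rw [hproc, Function.update_of_ne hh]
  · intro h hh
    rw [hpool h hh]
  · exact fun h hh _ => hfresh h hh
  · rw [hBi]; simp
  · rw [hBi]
    rintro op' l'' heq
    cases heq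
    rw [hret]
    exact hA.pend i op l hi
  · rw [hBi]
    rintro op' l'' heq
    cases heq
    exact hval

/-- An entry with the stamp of a later entry of its location, or with the current stamp, does not
violate a cut. -/
theorem Cut.insert {H : List (Event P M V)} {L L' : List (Ent P M V)} {y : Ent P M V}
    (hy : y.stamp = H.length ∨
      ∃ f ∈ L, f.op.loc = y.op.loc ∧ y.key < f.key ∧ y.stamp = f.stamp)
    (hmem : ∀ z, z ∈ L' ↔ z = y ∨ z ∈ L) (r : Fin P) (j : Fin M) (k : ℕ)
    (h : Cut H L r j k) : Cut H L' r j k := by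
  intro a op hp z hz hzj hzk
  rcases (hmem z).1 hz with rfl | hz
  · rcases hy with hy | ⟨f, hf, h1, h2, h3⟩
    · rw [hy]; exact hp.lt
    · rw [h3]; exact h a op hp f hf (h1.trans hzj) (hzk.trans h2)
  · exact h a op hp z hz hzj hzk

end System

/-! ### Transitions at which operations are invoked, take effect or return -/

section System

variable {P M : ℕ} {V : Type u}

/-- The operation is linearized at the end of the reads and CAS of the epoch of the object, which
may be long over. The invariant `acq` says that the operation was invoked before any later entry of
the location took effect, so this is a legitimate time. -/
theorem State.Lin.access {σ₀ : Fin M → V} {A B : State P M V} {H : List (Event P M V)}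
    {L : List (Ent P M V)} {home : ℕ → ℕ × ℕ} (hA : A.Lin σ₀ H L home) {i : Fin P}
    {op : Op M V} {x : ℕ} (hi : A.proc i = .busy op (.access x)) (hB : B =
      { A with buf := Function.update A.buf x (op.act (A.buf x)).1 }.goto i
        (.busy op (.fin (op.act (A.buf x)).2))) (hsafe : B.Safe) :
    ∃ L', B.Lin σ₀ H L' home := by
  have hproc : B.proc = Function.update A.proc i (.busy op (.fin (op.act (A.buf x)).2)) := by
    rw [hB]; rfl
  have hBi : B.proc i = .busy op (.fin (op.act (A.buf x)).2) := by
    rw [hproc, Function.update_self]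
  have hbuf : ∀ y, B.buf y = if y = x then (op.act (A.buf x)).1 else A.buf y := by
    intro y; rw [hB]; simp [goto, Function.update_apply]
  have hd : A.Danger i x := .inl (hA.safe.annInv i op _ hi).2.2
  have hx : A.Exposed x := .inr ⟨i, hd⟩
  obtain ⟨-, hhome, hcut⟩ := hA.acq i op _ x hi trivial hd
  obtain ⟨a, hpa, hent⟩ := hA.pend i op _ hi
  have hv := hA.val x op.loc hx hhome
  have he := hA.home_le x op.loc op.loc.2 hhome
  obtain ⟨L', y, hlin, hya, hyr, hyop, hyk, hys, hmem, hval1, hval2⟩ :=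
    hA.lin.exists_insert hpa hent (r := (op.act (A.buf x)).2) (e := (home x).2)
      (k := 3 * (home x).2) (.inl ⟨rfl, he, by rw [hv]⟩) (fun z hz h1 h2 => hcut a op hpa z hz h1 h2)
  have hreach : A.Reach B := State.Reach.calm hproc (by rw [hB]; rfl) (by rw [hB]; intros; rfl)
    trivial (by intro op' l heq; cases heq; exact False.elim)
  refine ⟨L', hA.frame i hsafe (by rw [hB]; rfl) hreach hlin ?_ ?_ ?_ ?_ (fun _ _ _ _ => Iff.rfl)
    (.inl rfl) (fun z hz => (hmem z).2 (.inr hz)) ?_ ?_ ?_ ?_ ?_⟩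
  · intro x' j hx' hj
    rw [hbuf]
    split
    · rename_i h
      subst h
      obtain rfl : j = op.loc := Fin.ext (hj.symm.trans hhome)
      rw [hval2 rfl, hv]
    · rename_i h
      rw [hval1 j _ (hA.home_le x' j j.2 hj), hA.val x' j hx' hj]
      -- Only the value of this location at this epoch changes, and by injectivity of `home` no
      -- other object records it.
      by_contra hcon
      push Not at hcon
      apply h
      apply hA.home_inj
      refine Prod.ext ?_ hcon.2.1
      rw [hj, hhome, hcon.1]
  · intro h hh
    rw [hproc, Function.update_of_ne hh]
  · intro h _
    rw [hB]; rfl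
  · intro h _ hs
    rw [hbuf, if_neg]
    rintro rfl
    exact hA.safe.not_exposed_fresh h hs hx
  · intro z hz
    rcases (hmem z).1 hz with rfl | hz
    · exact .inr ⟨op, hya ▸ hpa⟩
    · exact .inl hz
  · exact Cut.insert (by rw [hyop, hyk]; exact hys) hmem
  · rw [hBi]; simp
  · rw [hBi]
    rintro op' l heq
    cases heq
    exact ⟨a, hpa, y, (hmem y).2 (.inl rfl), hya, hyr⟩
  · rw [hBi]
    rintro op' l heq
    cases heq
    trivial

/-- The epoch `e` that the process read has ended in the meantime. The write is inserted behind the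
reads and CAS of this epoch and before the write that ended it, so its value is never seen. -/
theorem State.Lin.swing_fail {σ₀ : Fin M → V} {A B : State P M V} {H : List (Event P M V)}
    {L : List (Ent P M V)} {home : ℕ → ℕ × ℕ} (hA : A.Lin σ₀ H L home) {i : Fin P}
    {op : Op M V} {x e : ℕ} (hi : A.proc i = .busy op (.swing x e))
    (hne : A.obj op.loc ≠ (x, e)) (hB : B = A.goto i (.busy op (.fin .ack)))
    (hsafe : B.Safe) : ∃ L', B.Lin σ₀ H L' home := by
  have hproc : B.proc = Function.update A.proc i (.busy op (.fin .ack)) := by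
    rw [hB]; rfl
  have hBi : B.proc i = .busy op (.fin .ack) := by
    rw [hproc, Function.update_self]
  have hw := hA.safe.annInv i op _ hi
  obtain ⟨-, he, hex, hcut⟩ := hA.valInv i op _ hi
  obtain ⟨a, hpa, hent⟩ := hA.pend i op _ hi
  -- Epochs never repeat, so a record with the same count would have the same pointer; there is no
  -- ABA problem.
  have hlt : e < (A.obj op.loc).2 := by
    refine lt_of_le_of_ne he fun h => hne ?_
    rw [h, hex h]
  obtain ⟨L', y, hlin, hya, hyr, hyop, hyk, hys, hmem, hval1, -⟩ :=
    hA.lin.exists_insert hpa hent (r := .ack) (e := e) (k := 3 * e + 1)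
      (.inr ⟨rfl, hlt, rfl, hw⟩) (fun z hz h1 h2 => hcut a op hpa z hz h1 h2)
  have hreach : A.Reach B := State.Reach.calm hproc (by rw [hB]; rfl) (by rw [hB]; intros; rfl)
    trivial (by intro op' l heq; cases heq; exact False.elim)
  refine ⟨L', hA.frame i hsafe (by rw [hB]; rfl) hreach hlin ?_ ?_ ?_ ?_ (fun _ _ _ _ => Iff.rfl)
    (.inl rfl) (fun z hz => (hmem z).2 (.inr hz)) ?_ ?_ ?_ ?_ ?_⟩
  · intro x' j hx' hj
    rw [hval1 j _ (hA.home_le x' j j.2 hj) (by simp), ← hA.val x' j hx' hj, hB]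
    rfl
  · intro h hh
    rw [hproc, Function.update_of_ne hh]
  · intro h _
    rw [hB]; rfl
  · intro h _ _
    rw [hB]; rfl
  · intro z hz
    rcases (hmem z).1 hz with rfl | hz
    · exact .inr ⟨op, hya ▸ hpa⟩
    · exact .inl hz
  · exact Cut.insert (by rw [hyop, hyk]; exact hys) hmem
  · rw [hBi]; simp
  · rw [hBi]
    rintro op' l heq
    cases heq
    exact ⟨a, hpa, y, (hmem y).2 (.inl rfl), hya, hyr⟩
  · rw [hBi]
    rintro op' l heq
    cases heq
    trivial

/-- The fresh object is unexposed, so its home can be moved to the new epoch without violating any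
claim about its old home. The replaced object keeps its home, since slow readers may still operate
on it. -/
theorem State.Lin.swing {σ₀ : Fin M → V} {A B : State P M V} {H : List (Event P M V)}
    {L : List (Ent P M V)} {home : ℕ → ℕ × ℕ} (hA : A.Lin σ₀ H L home) {i : Fin P}
    {op : Op M V} {x e : ℕ} (hi : A.proc i = .busy op (.swing x e))
    (hx : A.obj op.loc = (x, e)) (hB : B = { A with
        obj := Function.update A.obj op.loc ((A.pool i).fresh, e + 1)
        pool := Function.update A.pool i ((A.pool i).exchange x) }.goto i
          (.busy op .scan)) (hsafe : B.Safe) :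
    ∃ L', B.Lin σ₀ H L' (Function.update home (A.pool i).fresh (op.loc, e + 1)) := by
  have hproc : B.proc = Function.update A.proc i (.busy op .scan) := by
    rw [hB]; rfl
  have hBi : B.proc i = .busy op .scan := by
    rw [hproc, Function.update_self]
  have hpool : ∀ h, h ≠ i → B.pool h = A.pool h := by
    intro h hh; rw [hB]; simp [goto, hh]
  have hbuf : B.buf = A.buf := by rw [hB]; rfl
  have hobj : ∀ j, B.obj j = if j = op.loc then ((A.pool i).fresh, e + 1) else A.obj j := by
    intro j; rw [hB]; simp [goto, Function.update_apply]
  obtain ⟨j, v, rfl⟩ := hA.safe.annInv i op _ hi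
  change A.obj j = (x, e) at hx
  change ∀ j', B.obj j' = if j' = j then ((A.pool i).fresh, e + 1) else A.obj j' at hobj
  show ∃ L', B.Lin σ₀ H L' (Function.update home (A.pool i).fresh (j, e + 1))
  obtain ⟨hfv, -, -, -⟩ := hA.valInv i _ _ hi
  have hfv := hfv j v rfl
  obtain ⟨a, hpa, hent⟩ := hA.pend i _ _ hi
  have hns : ¬ (A.proc i).Scanning := by rw [hi]; exact id
  have hf := hA.safe.not_exposed_fresh i hns
  set f := (A.pool i).fresh with hfdef
  have he : (A.obj j).2 = e := by rw [hx]
  obtain ⟨L', y, hlin, hya, hyr, hys, hmem, hval1, hval2⟩ := hA.lin.exists_swing hpa hent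
  simp only [he] at hlin hval2
  have hd : ∀ r x, B.Danger r x → A.Danger r x := fun r x h => h.of_calm hproc (by rw [hB]; rfl)
    (fun h hh => by rw [hpool h hh]) trivial
  have hexp : ∀ x, B.Exposed x → x = f ∨ A.Exposed x := by
    rintro x (⟨j', hj', hx⟩ | ⟨r, hx⟩)
    · rw [hobj] at hx
      split at hx
      · exact .inl hx.symm
      · exact .inr (.inl ⟨j', hj', hx⟩)
    · exact .inr (.inr ⟨r, hd r x hx⟩)
  have hcut : ∀ r j k, Cut H L r j k → Cut H L' r j k := Cut.insert (.inl hys) hmem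
  -- No object has its home in an epoch that has not yet begun, so `home` stays injective.
  have hle : ∀ x, home x ≠ ((j : ℕ), e + 1) := by
    intro x hxe
    have := hA.home_le x j j.2 (by rw [hxe])
    rw [hxe, he] at this
    exact absurd this (by simp)
  refine ⟨L', ?_⟩
  constructor
  · exact hsafe
  · convert hlin using 1
    funext j'
    rw [hobj, Function.update_apply]
    simp only [Fin.val_inj]
    split <;> rfl
  · intro x x' hxx
    simp only [Function.update_apply] at hxx
    split at hxx <;> split at hxx
    · simp [*]
    · exact absurd hxx.symm (hle _)
    · exact absurd hxx (hle _)
    · exact hA.home_inj hxx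
  · intro j' hj'
    rw [hobj]
    split
    · rename_i h
      subst h
      simp
    · rw [Function.update_of_ne (hA.safe.obj_ne_fresh i hj')]
      exact hA.home_obj j' hj'
  · intro x' j' hj' hxj
    rw [hobj]
    rw [Function.update_apply] at hxj ⊢
    split at hxj
    · rename_i h
      rw [if_pos hxj.symm, if_pos h]
    · rename_i h
      rw [if_neg h]
      have := hA.home_le x' j' hj' hxj
      split
      · rename_i h'
        subst h'
        rw [he] at this
        exact this.trans (Nat.le_succ _)
      · exact this
  · intro x' j' hx' hj'
    rw [hbuf]
    by_cases hxf : x' = f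
    · subst hxf
      rw [Function.update_self] at hj' ⊢
      obtain rfl : j = j' := Fin.ext hj'
      rw [hfv, hval2]
    · rw [Function.update_of_ne hxf] at hj' ⊢
      have hx' := (hexp x' hx').resolve_left hxf
      rw [hval1 j' _ (hA.home_le x' j' j'.2 hj'), hA.val x' j' hx' hj']
  · intro r op' l x' hr hl hdr
    have hdA := hd r x' hdr
    have hxf : x' ≠ f := by rintro rfl; exact hf (.inr ⟨r, hdA⟩)
    rw [Function.update_of_ne hxf]
    by_cases hri : r = i
    · subst hri
      rw [hBi] at hr
      cases hr
      exact hl.elim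
    · rw [hproc, Function.update_of_ne hri] at hr
      obtain ⟨h1, h2, h3⟩ := hA.acq r op' l x' hr hl hdA
      exact ⟨h1, h2, hcut _ _ _ h3⟩
  · intro r hr
    by_cases hri : r = i
    · subst hri
      rw [hBi] at hr
      cases hr
    · rw [hproc, Function.update_of_ne hri] at hr
      exact hA.idle r hr
  · intro r op' l hr
    by_cases hri : r = i
    · subst hri
      rw [hBi] at hr
      cases hr
      exact ⟨a, hpa, y, (hmem y).2 (.inl rfl), hya, hyr⟩
    · rw [hproc, Function.update_of_ne hri] at hr
      obtain ⟨b, h1, h2⟩ := hA.pend r op' l hr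
      refine ⟨b, h1, ?_⟩
      cases hl : l.ret with
      | some t =>
        rw [hl] at h2
        obtain ⟨z, hz, h2⟩ := h2
        exact ⟨z, (hmem z).2 (.inr hz), h2⟩
      | none =>
        rw [hl] at h2
        intro z hz hzb
        rcases (hmem z).1 hz with rfl | hz
        · rw [← hzb, hya] at h1
          have := hpa.1.symm.trans h1.1
          simp only [Option.some.injEq, Event.inv.injEq] at this
          exact hri this.1.symm
        · exact h2 z hz hzb
  · intro r op' l hr
    by_cases hri : r = i
    · subst hri
      rw [hBi] at hr
      cases hr
      trivial
    · rw [hproc, Function.update_of_ne hri] at hr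
      have h := hA.valInv r op' l hr
      cases l with
      | initFresh y => simp only [ValInv, hpool r hri, hbuf] at h ⊢; exact h
      | readCur => simp only [ValInv, hpool r hri, hbuf] at h ⊢; exact h
      | swing x' e' =>
        simp only [ValInv, hpool r hri, hbuf] at h ⊢
        obtain ⟨h1, h2, h3, h4⟩ := h
        refine ⟨h1, ?_, ?_, hcut _ _ _ h4⟩
        · rw [hobj]
          split
          · rename_i hj
            rw [hj, he] at h2
            exact h2.trans (Nat.le_succ _)
          · exact h2
        · rw [hobj]
          split
          · rename_i hj
            rw [hj, he] at h2
            intro h5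
            simp only at h5
            omega
          · exact h3
      | _ => trivial

theorem State.Lin.invoke {σ₀ : Fin M → V} {A B : State P M V} {H : List (Event P M V)}
    {L : List (Ent P M V)} {home : ℕ → ℕ × ℕ} (hA : A.Lin σ₀ H L home) {i : Fin P}
    {op : Op M V} (hB : B = A.goto i (.busy op op.first))
    (hsafe : B.Safe) : B.Lin σ₀ (H ++ [.inv i op]) L home := by
  have hproc : B.proc = Function.update A.proc i (.busy op op.first) := by
    rw [hB]; rfl
  have hBi : B.proc i = .busy op op.first := by
    rw [hproc, Function.update_self]
  have hfirst : op.first = .loadFresh ∨ op.first = .readAnn := by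
    unfold Op.first; split <;> simp
  have hna : ∀ op' l, Proc.busy op op.first = .busy op' l → ¬ l.Active := by
    rintro op' l heq
    cases heq
    rcases hfirst with h | h <;> rw [h] <;> exact id
  have hreach : A.Reach B := by
    refine State.Reach.calm hproc (by rw [hB]; rfl) (by rw [hB]; intros; rfl) ?_
      (fun op' l heq hl => absurd hl (hna op' l heq))
    rcases hfirst with h | h <;> rw [h] <;> trivial
  refine hA.frame i hsafe (by rw [hB]; rfl) hreach (hA.lin.invoke i op) ?_ ?_ ?_ ?_ ?_
    (.inr ?_) (fun z hz => hz) (fun z hz => .inl hz) (fun _ _ _ h => h) ?_ ?_ ?_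
  · intro x j hx hj
    rw [← hA.val x j hx hj, hB]; rfl
  · intro h hh
    rw [hproc, Function.update_of_ne hh]
  · intro h _
    rw [hB]; rfl
  · intro h _ _
    rw [hB]; rfl
  · intro h hh a op'
    rw [pending_append]
    constructor
    · rintro (⟨-, h1⟩ | ⟨-, h1⟩)
      · exact h1
      · cases h1; exact absurd rfl hh
    · exact fun h1 => .inl ⟨fun h2 => hh h2.symm, h1⟩
  · rw [hBi]; exact hna
  · rw [hBi]; simp
  · rw [hBi]
    rintro op' l heq
    cases heq
    refine ⟨H.length, pending_append.2 (.inr ⟨rfl, rfl⟩), ?_⟩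
    have : op.first.ret = none := by rcases hfirst with h | h <;> rw [h] <;> rfl
    rw [this]
    -- Entries have positions below the length of the old history, where the new invocation is
    -- placed.
    intro z hz
    have := hA.lin.pos_lt z hz
    have := hA.lin.stamp_le z hz
    omega
  · rw [hBi]
    rintro op' l heq
    cases heq
    rcases hfirst with h | h <;> rw [h] <;> trivial

theorem State.Lin.respond {σ₀ : Fin M → V} {A B : State P M V} {H : List (Event P M V)}
    {L : List (Ent P M V)} {home : ℕ → ℕ × ℕ} (hA : A.Lin σ₀ H L home) {i : Fin P}
    {op : Op M V} {r : Ret V} (hi : A.proc i = .busy op (.fin r)) (hB : B = A.goto i .idle)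
    (hsafe : B.Safe) : B.Lin σ₀ (H ++ [.res i r]) L home := by
  have hproc : B.proc = Function.update A.proc i .idle := by
    rw [hB]; rfl
  have hBi : B.proc i = .idle := by
    rw [hproc, Function.update_self]
  obtain ⟨a, hpa, hent⟩ := hA.pend i op _ hi
  have hreach : A.Reach B :=
    State.Reach.calm hproc (by rw [hB]; rfl) (by rw [hB]; intros; rfl) trivial (by simp)
  refine hA.frame i hsafe (by rw [hB]; rfl) hreach (hA.lin.respond hpa hent) ?_ ?_ ?_ ?_ ?_
    (.inr ?_) (fun z hz => hz) (fun z hz => .inl hz) (fun _ _ _ h => h) ?_ ?_ ?_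
  · intro x j hx hj
    rw [← hA.val x j hx hj, hB]; rfl
  · intro h hh
    rw [hproc, Function.update_of_ne hh]
  · intro h _
    rw [hB]; rfl
  · intro h _ _
    rw [hB]; rfl
  · intro h hh a op'
    rw [pending_append]
    constructor
    · rintro (⟨-, h1⟩ | ⟨-, h1⟩)
      · exact h1
      · cases h1
    · exact fun h1 => .inl ⟨fun h2 => hh h2.symm, h1⟩
  · rw [hBi]; simp
  · rintro - a' op' h1
    rcases pending_append.1 h1 with ⟨h1, -⟩ | ⟨-, h1⟩
    · exact h1 rfl
    · cases h1
  · rw [hBi]; simp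
  · rw [hBi]; simp

end System

/-! ### Every transition extends the linearization -/

section System

variable {P M : ℕ} {V : Type u}

theorem State.Lin.step {σ₀ : Fin M → V} {A B : State P M V} {H : List (Event P M V)}
    {L : List (Ent P M V)} {home : ℕ → ℕ × ℕ} {e : Option (Event P M V)}
    (hA : A.Lin σ₀ H L home) (h : A.Step e B) :
    ∃ L' home', B.Lin σ₀ (H ++ e.toList) L' home' := by
  have hsafe := hA.safe.step h
  cases h with
  | invoke i op h => exact ⟨L, home, hA.invoke rfl hsafe⟩
  | respond i op r h => exact ⟨L, home, hA.respond h rfl hsafe⟩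
  | readAnn i op h =>
    rw [Option.toList_none, List.append_nil]
    exact ⟨L, home, hA.silent h rfl hsafe rfl
      (.calm rfl rfl (fun _ _ => rfl) trivial (by rintro op' l heq; cases heq; exact False.elim))
      (fun _ _ => rfl) (fun _ _ => rfl) (fun _ _ => rfl) rfl trivial⟩
  | post i op x h =>
    rw [Option.toList_none, List.append_nil]
    refine ⟨L, home, hA.silent h rfl hsafe rfl ?_
      (fun _ _ => rfl) (fun _ _ => rfl) (fun _ _ => rfl) rfl trivial⟩
    intro r y hd
    left
    by_cases hr : r = i
    · subst hr
      -- A fresh announcement carries no threats, so the claims about acquired objects hold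
      -- trivially when an operation becomes active.
      exact absurd hd (hA.safe.not_danger_of_post
        (B := State.goto { A with ann := Function.update A.ann r (↑op.loc, x.2.1 + 1, 0) } r _)
        h rfl rfl (by simp [State.goto]) y)
    · constructor
      · have hBr : (State.goto { A with ann := Function.update A.ann i (↑op.loc, x.2.1 + 1, 0) } i
            (.busy op (.readObj (x.2.1 + 1)))).ann r = A.ann r := by
          simp [State.goto, Fin.val_inj, hr]
        rcases hd with hy | ⟨hy, hy'⟩
        · rw [hBr] at hy; exact .inl hy
        · rw [hBr] at hy hy'
          exact .inr ⟨hy, State.Cand.of_calm (A := A) (B := State.goto _ i _) (i := i)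
            (p := .busy op (.readObj (x.2.1 + 1))) rfl (fun _ _ => rfl) trivial hy'⟩
      · intro op' l hl hl'
        rw [State.goto_proc, if_neg hr] at hl
        exact ⟨l, hl, hl'⟩
  | readObj i op s h =>
    rw [Option.toList_none, List.append_nil]
    refine ⟨L, home, hA.silent h rfl hsafe rfl ?_
      (fun _ _ => rfl) (fun _ _ => rfl) (fun _ _ => rfl) rfl trivial⟩
    intro r y hd
    have hact : ∀ op' l, (A.goto i (.busy op (.fill s (A.obj op.loc).1))).proc r = .busy op' l →
        l.Active → ∃ l', A.proc r = .busy op' l' ∧ l'.Active := by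
      intro op' l hl hl'
      rw [State.goto_proc] at hl
      split at hl
      · subst r
        cases hl
        exact ⟨_, h, trivial⟩
      · exact ⟨l, hl, hl'⟩
    rcases hd with hy | ⟨hy, hy'⟩
    · exact .inl ⟨.inl hy, hact⟩
    · rcases State.Cand.of_goto (A := A) (B := A.goto i _) rfl (fun _ _ => rfl) hy' with
        hc | ⟨hr, op', hc, -⟩ | ⟨op', hc, -⟩
      · exact .inl ⟨.inr ⟨hy, hc⟩, hact⟩
      · injection hc with _ hc
        injection hc with _ hc
        refine .inr ⟨op, hc.symm, fun op'' l hl => ?_⟩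
        rw [State.goto_proc, if_pos hr] at hl
        cases hl
        rfl
      · cases hc
  | fill i op s x h h' =>
    rw [Option.toList_none, List.append_nil]
    refine ⟨L, home, hA.silent h rfl hsafe rfl (fun r y hd => .inl ⟨?_, fun op' l hl hl' => ?_⟩)
      (fun _ _ => rfl) (fun _ _ => rfl) (fun _ _ => rfl) rfl trivial⟩
    · exact State.Danger.of_fill (A := A) (i := i) (g := i)
        (B := State.goto { A with ann := Function.update A.ann i (↑op.loc, s, x + 1) } i _)
        (p := .busy op .readPtr)
        rfl rfl trivial rfl h' (.inl ⟨op, h, rfl⟩) hd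
    · rw [State.goto_proc] at hl
      split at hl
      · subst r
        cases hl
        exact ⟨_, h, trivial⟩
      · exact ⟨l, hl, hl'⟩
  | fill_fail i op s x h h' =>
    rw [Option.toList_none, List.append_nil]
    exact ⟨L, home, hA.silent h rfl hsafe rfl
      (.calm rfl rfl (fun _ _ => rfl) trivial
        (by rintro op' l heq; cases heq; exact fun _ => ⟨_, h, trivial⟩))
      (fun _ _ => rfl) (fun _ _ => rfl) (fun _ _ => rfl) rfl trivial⟩
  | readPtr i op h =>
    rw [Option.toList_none, List.append_nil]
    exact ⟨L, home, hA.silent h rfl hsafe rfl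
      (.calm rfl rfl (fun _ _ => rfl) trivial
        (by rintro op' l heq; cases heq; exact fun _ => ⟨_, h, trivial⟩))
      (fun _ _ => rfl) (fun _ _ => rfl) (fun _ _ => rfl) rfl trivial⟩
  | access i op x h =>
    rw [Option.toList_none, List.append_nil]
    obtain ⟨L', hL'⟩ := hA.access h rfl hsafe
    exact ⟨L', home, hL'⟩
  | loadFresh i op h =>
    rw [Option.toList_none, List.append_nil]
    exact ⟨L, home, hA.silent h rfl hsafe rfl
      (.calm rfl rfl (fun _ _ => rfl) trivial (by rintro op' l heq; cases heq; exact False.elim))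
      (fun _ _ => rfl) (fun _ _ => rfl) (fun _ _ => rfl) rfl rfl⟩
  | initFresh i j v y h =>
    rw [Option.toList_none, List.append_nil]
    refine ⟨L, home, hA.silent h rfl hsafe rfl
      (.calm rfl rfl (fun _ _ => rfl) trivial (by rintro op' l heq; cases heq; exact False.elim))
      (fun _ _ => rfl) (fun x hx => ?_) (fun r hr => ?_) rfl ?_⟩
    · refine Function.update_of_ne ?_ _ _
      rintro rfl
      exact hA.safe.not_exposed_fresh i (by rw [h]; exact id) hx
    -- The pools are disjoint, so another writer's prepared object is not touched.
    · exact Function.update_of_ne (fun hf => hr (hA.safe.arr_arr r i _ _ (hA.safe.pool r).slot_lt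
        (hA.safe.pool i).slot_lt hf)) _ _
    · intro j' v' hv
      cases hv
      exact Function.update_self ..
  | readCur i op h =>
    rw [Option.toList_none, List.append_nil]
    refine ⟨L, home, hA.silent h rfl hsafe rfl
      (.calm rfl rfl (fun _ _ => rfl) trivial (by rintro op' l heq; cases heq; exact False.elim))
      (fun _ _ => rfl) (fun _ _ => rfl) (fun _ _ => rfl) rfl
      ⟨hA.valInv i op _ h, le_rfl, fun _ => rfl, fun a op' _ z hz hzl hzk => ?_⟩⟩
    have := hA.lin.key_le z hz
    rw [hzl] at this
    omega
  | swing i op x e h h' =>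
    rw [Option.toList_none, List.append_nil]
    obtain ⟨L', hL'⟩ := hA.swing h h' rfl hsafe
    exact ⟨L', _, hL'⟩
  | swing_fail i op x e h h' =>
    rw [Option.toList_none, List.append_nil]
    obtain ⟨L', hL'⟩ := hA.swing_fail h h' rfl hsafe
    exact ⟨L', home, hL'⟩
  | scan i op h h' =>
    rw [Option.toList_none, List.append_nil]
    exact ⟨L, home, hA.silent h rfl hsafe rfl
      (.calm rfl rfl (fun r hr => by simp [State.goto, hr]) trivial
        (by rintro op' l heq; cases heq; exact False.elim))
      (fun r hr => by simp [State.goto, hr]) (fun _ _ => rfl) (fun _ _ => rfl) rfl trivial⟩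
  | scan_open i op h h' =>
    rw [Option.toList_none, List.append_nil]
    exact ⟨L, home, hA.silent h rfl hsafe rfl
      (.calm rfl rfl (fun _ _ => rfl) trivial (by rintro op' l heq; cases heq; exact False.elim))
      (fun _ _ => rfl) (fun _ _ => rfl) (fun _ _ => rfl) rfl trivial⟩
  | help i op j s h =>
    rw [Option.toList_none, List.append_nil]
    refine ⟨L, home, hA.silent h rfl hsafe rfl ?_
      (fun _ _ => rfl) (fun _ _ => rfl) (fun _ _ => rfl) rfl trivial⟩
    intro r y hd
    have hact : ∀ op' l, (A.goto i (.busy op (.helpFill j s (A.obj j).1))).proc r =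
        .busy op' l → l.Active → ∃ l', A.proc r = .busy op' l' ∧ l'.Active := by
      intro op' l hl hl'
      rw [State.goto_proc] at hl
      split at hl
      · subst r
        cases hl
        exact hl'.elim
      · exact ⟨l, hl, hl'⟩
    rcases hd with hy | ⟨hy, hy'⟩
    · exact .inl ⟨.inl hy, hact⟩
    · rcases State.Cand.of_goto (A := A) (B := A.goto i _) rfl (fun _ _ => rfl) hy' with
        hc | ⟨hr, op', hc, -⟩ | ⟨op', hc, -⟩
      · exact .inl ⟨.inr ⟨hy, hc⟩, hact⟩
      · cases hc
      · injection hc with _ hc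
        injection hc with hj _ hc
        -- The helper threatens `x` on behalf of `r` only if the announcement is still open under
        -- the number that the helper holds. Then process `r` is still asking, and `j` is the
        -- location of its current operation, during which the pointer has been read.
        have hask := hA.safe.asking r hy
        rcases hp : A.proc r with _ | ⟨op₁, l₁⟩
        · simp [hp, Proc.Asking] at hask
        · have hloc : (A.ann r).1 = op₁.loc := by
            have := hA.safe.annInv r op₁ l₁ hp
            cases l₁ <;> simp [hp, Proc.Asking] at hask <;> exact this.2.1
          refine .inr ⟨op₁, ?_, fun op'' l hl => ?_⟩
          · rw [← hc, hj, ← hloc]; rfl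
          · rw [State.goto_proc] at hl
            split at hl
            · subst r
              rw [h] at hp
              cases hp
              cases hl
              rfl
            · rw [hp] at hl
              cases hl
              rfl
  | helpFill i op j s x h h' =>
    rw [Option.toList_none, List.append_nil]
    refine ⟨L, home, hA.silent h rfl hsafe rfl (fun r y hd => .inl ⟨?_, fun op' l hl hl' => ?_⟩)
      (fun _ _ => rfl) (fun _ _ => rfl) (fun _ _ => rfl) rfl trivial⟩
    · exact State.Danger.of_fill (A := A) (i := i)
        (B := State.goto { A with ann := Function.update A.ann (A.pool i).a (j, s, x + 1) } i _)
        (g := ⟨(A.pool i).a, (hA.safe.pool i).a_lt⟩)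
        (p := .busy op .rescan) rfl rfl trivial rfl h' (.inr ⟨i, op, h, rfl⟩) hd
    · rw [State.goto_proc] at hl
      split at hl
      · subst r
        cases hl
        exact hl'.elim
      · exact ⟨l, hl, hl'⟩
  | helpFill_fail i op j s x h h' =>
    rw [Option.toList_none, List.append_nil]
    exact ⟨L, home, hA.silent h rfl hsafe rfl
      (.calm rfl rfl (fun _ _ => rfl) trivial (by rintro op' l heq; cases heq; exact False.elim))
      (fun _ _ => rfl) (fun _ _ => rfl) (fun _ _ => rfl) rfl trivial⟩
  | rescan i op h =>
    rw [Option.toList_none, List.append_nil]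
    exact ⟨L, home, hA.silent h rfl hsafe rfl
      (.calm rfl rfl (fun r hr => by simp [State.goto, hr]) trivial
        (by rintro op' l heq; cases heq; exact False.elim))
      (fun r hr => by simp [State.goto, hr]) (fun _ _ => rfl) (fun _ _ => rfl) rfl trivial⟩

end System

/-! ### The program text

Integer cells: 0 index of the location; 1 number `P` of processes; 2 record of the own announcement;
3 number `M` of locations; 4 start `32 + 3 * P` of the table `Pool.inv`; 5 kind of the operation;
6 and 7 `Pool.a` and `Pool.hb`; 10 to 16 registers; from 32 the table `Pool.arr`. -/

/-- The contents of integer cell `n`. -/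
def Expr.cell (n : ℕ) : Expr := .load (.const n)

/-- The entry at position `e` of the table `Pool.arr`. -/
def Expr.arr (e : Expr) : Expr := .load (.add (.const 32) e)

/-- The position of the object that is used next. -/
def Expr.slot : Expr := .add (.cell 7) (.cell 6)

/-- The position where the announced object of the scanned process is kept. -/
def Expr.guard : Expr := .add (.add (.cell 1) (.cell 1)) (.cell 6)

/-- The announced object. -/
def Expr.announced : Expr := .sub (.cell 12) (.const 1)

/-- The record of the announcement to be scanned. -/
def Expr.scanned : Expr := .add (.cell 3) (.cell 6)

open WritableCAS.Expr in
/-- The implementation of an array of writable CAS objects. -/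
def implementation : Code where
  text := [
    /- read and CAS -/
    .set (const 5) (const 0),
    .jumpEq (const 0) (const 0) 3,
    .set (const 5) (const 1),
    .readRec (cell 2) (const 10),
    .casRec (cell 2) (cell 10) (cell 11) (cell 12)
      (cell 0) (add (cell 11) (const 1)) (const 0) (const 13),
    .readRec (cell 0) (const 14),
    .casRec (cell 2) (cell 0) (add (cell 11) (const 1)) (const 0)
      (cell 0) (add (cell 11) (const 1)) (add (cell 14) (const 1)) (const 13),
    .readRec (cell 2) (const 10),
    .jumpEq (cell 5) (const 0) 11,
    .casVal announced (const 0) (const 1) (const 13),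
    .retFlag (cell 13),
    .readVal announced (const 2),
    .retVal (const 2),
    /- write -/
    .readVal (arr slot) (const 2),
    .casVal (arr slot) (const 2) (const 0) (const 13),
    .readRec (cell 0) (const 14),
    .casRec (cell 0) (cell 14) (cell 15) (cell 16)
      (arr slot) (add (cell 15) (const 1)) (const 0) (const 13),
    .jumpEq (cell 13) (const 0) 39,
    .set (add (cell 4) (cell 14)) slot,
    .set (add (const 32) slot) (cell 14),
    /- scan -/
    .readRec scanned (const 10),
    .jumpLt (const 0) (cell 12) 25,
    .readRec (cell 10) (const 14),
    .casRec scanned (cell 10) (cell 11) (const 0)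
      (cell 10) (cell 11) (add (cell 14) (const 1)) (const 13),
    .readRec scanned (const 10),
    .set (const 14) (load (add (cell 4) announced)),
    .jumpEq (arr (cell 14)) announced 28,
    .jumpEq (const 0) (const 0) 35,
    .jumpLt (cell 14) (cell 7) 30,
    .jumpLt (cell 14) (add (cell 7) (cell 1)) 35,
    .set (const 15) (arr guard),
    .set (add (cell 4) (cell 15)) (cell 14),
    .set (add (const 32) (cell 14)) (cell 15),
    .set (add (cell 4) announced) guard,
    .set (add (const 32) guard) announced,
    .set (const 6) (add (cell 6) (const 1)),
    .jumpLt (cell 6) (cell 1) 39,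
    .set (const 7) (sub (cell 1) (cell 7)),
    .set (const 6) (const 0),
    .retAck]
  entryRead := 0
  entryCas := 2
  entryWrite := 13

section Machine

variable {P M : ℕ} {V : Type u}

/-! ### Local instructions -/

/-- Assignment to an integer cell. -/
def Private.setInt (p : Private V) (d v : ℕ) : Private V :=
  { p with ints := Function.update p.ints d v }

/-- Assignment to a value cell. -/
def Private.setVal (p : Private V) (d : ℕ) (v : V) : Private V :=
  { p with vals := Function.update p.vals d v }

theorem Private.setInt_ints (p : Private V) (d v c : ℕ) :
    (p.setInt d v).ints c = if c = d then v else p.ints c := Function.update_apply ..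

theorem Private.setVal_ints (p : Private V) (d : ℕ) (v : V) : (p.setVal d v).ints = p.ints := rfl

theorem Private.setVal_vals (p : Private V) (d : ℕ) (v : V) (c : ℕ) :
    (p.setVal d v).vals c = if c = d then v else p.vals c := Function.update_apply ..

/-- The effect of a local instruction. -/
def localStep (code : Code) (p : Private V) (pc : ℕ) : Option (Private V × ℕ) :=
  match code.text[pc]? with
  | some (.set d e) => some (p.setInt (d.eval p.ints) (e.eval p.ints), pc + 1)
  | some (.move d c) => some (p.setVal (d.eval p.ints) (p.vals (c.eval p.ints)), pc + 1)
  | some (.jumpEq e f t) => some (p, if e.eval p.ints = f.eval p.ints then t else pc + 1)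
  | some (.jumpLt e f t) => some (p, if e.eval p.ints < f.eval p.ints then t else pc + 1)
  | _ => none

theorem exec_of_localStep {N₁ N₂ : ℕ} {code : Code} {p p' : Private V} {pc pc' : ℕ}
    (h : localStep code p pc = some (p', pc')) (s : Shared N₁ N₂ V) :
    exec code s p pc = (s, p', .goto pc') := by
  unfold localStep at h
  unfold exec
  split at h <;> simp_all <;> obtain ⟨rfl, rfl⟩ := h <;> rfl

/-- Local instructions lead to `q` at position `qc`, where a non-local instruction follows. -/
inductive Settles (code : Code) : Private V → ℕ → Private V → ℕ → Prop where
  | refl {p : Private V} {pc : ℕ} (h : localStep code p pc = none) : Settles code p pc p pc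
  | step {p p' q : Private V} {pc pc' qc : ℕ} (h : localStep code p pc = some (p', pc'))
      (h' : Settles code p' pc' q qc) : Settles code p pc q qc

theorem Settles.set {code : Code} {p q : Private V} {pc qc d' v : ℕ} {d e : Expr}
    (ht : code.text[pc]? = some (.set d e)) (hd : d.eval p.ints = d') (hv : e.eval p.ints = v)
    (h : Settles code (p.setInt d' v) (pc + 1) q qc) : Settles code p pc q qc := by
  subst hd hv
  refine .step ?_ h
  unfold localStep
  rw [ht]

theorem Settles.jumpEq {code : Code} {p q : Private V} {pc qc t : ℕ} {e f : Expr}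
    (ht : code.text[pc]? = some (.jumpEq e f t))
    (h : Settles code p (if e.eval p.ints = f.eval p.ints then t else pc + 1) q qc) :
    Settles code p pc q qc := by
  refine .step ?_ h
  unfold localStep
  rw [ht]

theorem Settles.jumpLt {code : Code} {p q : Private V} {pc qc t : ℕ} {e f : Expr}
    (ht : code.text[pc]? = some (.jumpLt e f t))
    (h : Settles code p (if e.eval p.ints < f.eval p.ints then t else pc + 1) q qc) :
    Settles code p pc q qc := by
  refine .step ?_ h
  unfold localStep
  rw [ht]

/-- The target of a jump. -/
def Instr.target : Instr → Option ℕ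
  | .jumpEq _ _ t => some t
  | .jumpLt _ _ t => some t
  | _ => none

/-- The text has no loops. Hence an operation executes each position at most once, which is the
whole step bound. -/
theorem jump_forward (pc t : ℕ) (x : Instr) (h : implementation.text[pc]? = some x)
    (ht : x.target = some t) : pc < t := by
  have hpc : pc < 40 := (List.getElem?_eq_some_iff.1 h).1
  have key : ∀ pc < 40, ∀ t ∈ implementation.text[pc]?.bind Instr.target, pc < t := by decide
  exact key pc hpc t (by simp [h, ht])

theorem localStep_lt {p p' : Private V} {pc pc' : ℕ}
    (h : localStep implementation p pc = some (p', pc')) : pc < pc' := by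
  unfold localStep at h
  split at h
  · simp at h; omega
  · simp at h; omega
  · rename_i ht
    have := jump_forward _ _ _ ht rfl
    simp at h
    have h2 := h.2
    split at h2 <;> omega
  · rename_i ht
    have := jump_forward _ _ _ ht rfl
    simp at h
    have h2 := h.2
    split at h2 <;> omega
  · simp at h

/-! ### Representation of the private memory -/

/-- The private memory of process `i` between operations. -/
structure Rep (P M i : ℕ) (m : ℕ → ℕ) (q : Pool) : Prop where
  procs : m 1 = P
  own : m 2 = M + i
  base : m 3 = M
  inv_base : m 4 = 32 + 3 * P
  a : m 6 = q.a
  hb : m 7 = q.hb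
  arr : ∀ k, k < 3 * P → m (32 + k) = q.arr k
  -- Placed behind `arr`, because it is indexed by arbitrary value objects and has no bound
  -- depending on `P` alone; it starts as zero.
  inv : ∀ x, m (32 + 3 * P + x) = q.inv x

/-- The parameters of an operation in the private memory. -/
def Op.Params (op : Op M V) (p : Private V) : Prop :=
  p.ints 0 = op.loc ∧
  match op with
  | .read _ => p.ints 5 = 0
  | .cas _ a b => p.ints 5 = 1 ∧ p.vals 0 = a ∧ p.vals 1 = b
  | .write _ v => p.vals 0 = v

/-- The private memory of process `i` during an operation. -/
structure Regs (P M i : ℕ) (q : Pool) (op : Op M V) (p : Private V) : Prop where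
  rep : Rep P M i p.ints q
  params : op.Params p

theorem Op.Params.setInt {op : Op M V} {p : Private V} (h : op.Params p) {d v : ℕ}
    (h0 : d ≠ 0) (h5 : d ≠ 5) : op.Params (p.setInt d v) := by
  cases op <;> simp only [Op.Params, Private.setInt_ints, if_neg h0.symm, if_neg h5.symm] at h ⊢ <;>
    exact h

theorem Op.Params.setVal {op : Op M V} {p : Private V} (h : op.Params p) {v : V} :
    op.Params (p.setVal 2 v) := by
  cases op <;> simpa [Op.Params, Private.setVal_ints, Private.setVal_vals] using h

theorem Rep.setReg {i : ℕ} {m : ℕ → ℕ} {q : Pool} (h : Rep P M i m q) {d v : ℕ}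
    (hd : d = 0 ∨ d = 5 ∨ 8 ≤ d ∧ d < 32) : Rep P M i (Function.update m d v) q := by
  constructor
  · rw [Function.update_of_ne (by omega)]; exact h.procs
  · rw [Function.update_of_ne (by omega)]; exact h.own
  · rw [Function.update_of_ne (by omega)]; exact h.base
  · rw [Function.update_of_ne (by omega)]; exact h.inv_base
  · rw [Function.update_of_ne (by omega)]; exact h.a
  · rw [Function.update_of_ne (by omega)]; exact h.hb
  · intro k hk; rw [Function.update_of_ne (by omega)]; exact h.arr k hk
  · intro x; rw [Function.update_of_ne (by omega)]; exact h.inv x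

theorem Regs.setReg {i : ℕ} {q : Pool} {op : Op M V} {p : Private V} (h : Regs P M i q op p)
    {d v : ℕ} (hd : 8 ≤ d ∧ d < 32) : Regs P M i q op (p.setInt d v) :=
  ⟨h.rep.setReg (.inr (.inr hd)), h.params.setInt (by omega) (by omega)⟩

theorem Regs.setVal {i : ℕ} {q : Pool} {op : Op M V} {p : Private V} (h : Regs P M i q op p)
    {v : V} : Regs P M i q op (p.setVal 2 v) :=
  ⟨h.rep, h.params.setVal⟩

theorem Regs.setArr {i : ℕ} {q : Pool} {op : Op M V} {p : Private V} (h : Regs P M i q op p)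
    {k v : ℕ} (hk : k < 3 * P) :
    Regs P M i { q with arr := Function.update q.arr k v } op (p.setInt (32 + k) v) := by
  refine ⟨?_, h.params.setInt (by omega) (by omega)⟩
  have h := h.rep
  constructor <;> simp only [Private.setInt_ints]
  · rw [if_neg (by omega)]; exact h.procs
  · rw [if_neg (by omega)]; exact h.own
  · rw [if_neg (by omega)]; exact h.base
  · rw [if_neg (by omega)]; exact h.inv_base
  · rw [if_neg (by omega)]; exact h.a
  · rw [if_neg (by omega)]; exact h.hb
  · intro l hl
    rw [Function.update_apply, h.arr l hl]
    simp
  · intro x; rw [if_neg (by omega)]; exact h.inv x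

theorem Regs.setInv {i : ℕ} {q : Pool} {op : Op M V} {p : Private V} (h : Regs P M i q op p)
    {x v : ℕ} :
    Regs P M i { q with inv := Function.update q.inv x v } op
      (p.setInt (32 + 3 * P + x) v) := by
  refine ⟨?_, h.params.setInt (by omega) (by omega)⟩
  have h := h.rep
  constructor <;> simp only [Private.setInt_ints]
  · rw [if_neg (by omega)]; exact h.procs
  · rw [if_neg (by omega)]; exact h.own
  · rw [if_neg (by omega)]; exact h.base
  · rw [if_neg (by omega)]; exact h.inv_base
  · rw [if_neg (by omega)]; exact h.a
  · rw [if_neg (by omega)]; exact h.hb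
  · intro l hl; rw [if_neg (by omega)]; exact h.arr l hl
  · intro y
    rw [Function.update_apply, h.inv y]
    simp

theorem Regs.setA {i : ℕ} {q : Pool} {op : Op M V} {p : Private V} (h : Regs P M i q op p)
    {v : ℕ} : Regs P M i { q with a := v } op (p.setInt 6 v) := by
  refine ⟨?_, h.params.setInt (by omega) (by omega)⟩
  have h := h.rep
  constructor <;> simp only [Private.setInt_ints]
  · exact h.procs
  · exact h.own
  · exact h.base
  · exact h.inv_base
  · rfl
  · exact h.hb
  · intro l hl; rw [if_neg (by omega)]; exact h.arr l hl
  · intro x; rw [if_neg (by omega)]; exact h.inv x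

theorem Regs.setHb {i : ℕ} {q : Pool} {op : Op M V} {p : Private V} (h : Regs P M i q op p)
    {v : ℕ} : Regs P M i { q with hb := v } op (p.setInt 7 v) := by
  refine ⟨?_, h.params.setInt (by omega) (by omega)⟩
  have h := h.rep
  constructor <;> simp only [Private.setInt_ints]
  · exact h.procs
  · exact h.own
  · exact h.base
  · exact h.inv_base
  · exact h.a
  · rfl
  · intro l hl; rw [if_neg (by omega)]; exact h.arr l hl
  · intro x; rw [if_neg (by omega)]; exact h.inv x

/-! ### Blocks of local instructions -/

theorem settles_exchange {i : ℕ} {q : Pool} {op : Op M V} {p : Private V}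
    (h : Regs P M i q op p) (hs : q.hb + q.a < 3 * P) :
    ∃ r, Settles implementation p 18 r 20 ∧ Regs P M i (q.exchange (p.ints 14)) op r := by
  have hslot : Expr.slot.eval p.ints = q.hb + q.a := by
    simp [Expr.slot, Expr.cell, Expr.eval, h.rep.a, h.rep.hb]
  have h1 := h.setInv (x := p.ints 14) (v := q.hb + q.a)
  have h2 := h1.setArr (v := p.ints 14) hs
  refine ⟨_, ?_, h2⟩
  refine .set (d' := 32 + 3 * P + p.ints 14) rfl ?_ hslot ?_
  · simp [Expr.cell, Expr.eval, h.rep.inv_base]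
  refine .set (d' := 32 + (q.hb + q.a)) (v := p.ints 14) rfl ?_ ?_ (.refl rfl)
  · simp [Expr.slot, Expr.cell, Expr.eval, h1.rep.a, h1.rep.hb]
  · simp only [Expr.cell, Expr.eval, Private.setInt_ints]
    rw [if_neg (by omega)]

theorem settles_advance {i : ℕ} {q : Pool} {op : Op M V} {p : Private V}
    (h : Regs P M i q op p) :
    ∃ r, Settles implementation p 35 r 39 ∧ Regs P M i (q.advance P) op r := by
  have h1 := h.setA (v := q.a + 1)
  have he1 : (Expr.cell 6 |>.add (.const 1)).eval p.ints = q.a + 1 := by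
    simp [Expr.cell, Expr.eval, h.rep.a]
  have hlt : ((Expr.cell 6).eval (p.setInt 6 (q.a + 1)).ints <
      (Expr.cell 1).eval (p.setInt 6 (q.a + 1)).ints) ↔ q.a + 1 < P := by
    simp [Expr.cell, Expr.eval, Private.setInt_ints, h.rep.procs]
  by_cases ha : q.a + 1 < P
  · refine ⟨p.setInt 6 (q.a + 1), ?_, ?_⟩
    · refine .set (d' := 6) rfl rfl he1 (.jumpLt rfl ?_)
      rw [if_pos (hlt.2 ha)]
      exact .refl rfl
    · rw [Pool.advance, if_pos ha]
      exact h1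
  · have h2 := h1.setHb (v := P - q.hb)
    have h3 := h2.setA (v := 0)
    refine ⟨_, ?_, by rw [Pool.advance, if_neg ha]; exact h3⟩
    refine .set (d' := 6) rfl rfl he1 (.jumpLt rfl ?_)
    rw [if_neg (mt hlt.1 ha)]
    refine .set (d' := 7) (v := P - q.hb) rfl rfl ?_ (.set (d' := 6) (v := 0) rfl rfl rfl (.refl rfl))
    simp [Expr.cell, Expr.eval, h1.rep.procs, h1.rep.hb]

/-- Cell 12 holds the pointer field of the scanned announcement. The bound on `q.inv` keeps every
table lookup within the represented part of `arr`. -/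
theorem settles_scanned {i : ℕ} {q : Pool} {op : Op M V} {p : Private V}
    (h : Regs P M i q op p) (ha : q.a < P) (hinv : ∀ x, q.inv x < 3 * P) :
    ∃ r, Settles implementation p 25 r 39 ∧ Regs P M i (q.scanned P (p.ints 12)) op r := by
  set x := p.ints 12 - 1 with hx
  set k := q.inv x with hk
  have hk3 : k < 3 * P := hinv x
  have hann : Expr.announced.eval p.ints = x := by simp [Expr.announced, Expr.cell, Expr.eval, hx]
  have hs1 : ∀ {r : Private V}, Settles implementation (p.setInt 14 k) 26 r 39 →
      Settles implementation p 25 r 39 := by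
    intro r hr
    refine .set rfl rfl ?_ hr
    simp only [Expr.eval, hann, Expr.cell, h.rep.inv_base, h.rep.inv]
    rfl
  have h1 : Regs P M i q op (p.setInt 14 k) := h.setReg (by omega)
  set p1 := p.setInt 14 k with hp1
  have h14 : p1.ints 14 = k := by simp [hp1, Private.setInt_ints]
  have h12 : p1.ints 12 - 1 = x := by simp [hp1, Private.setInt_ints, hx]
  have hcond1 : ((Expr.cell 14).arr.eval p1.ints = Expr.announced.eval p1.ints) ↔ q.arr k = x := by
    simp only [Expr.arr, Expr.announced, Expr.cell, Expr.eval, h14, h12, h1.rep.arr k hk3]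
  have hcond2 : ((Expr.cell 14).eval p1.ints < (Expr.cell 7).eval p1.ints) ↔ k < q.hb := by
    simp only [Expr.cell, Expr.eval, h14, h1.rep.hb]
  have hcond3 : ((Expr.cell 14).eval p1.ints <
      ((Expr.cell 7).add (Expr.cell 1)).eval p1.ints) ↔ k < q.hb + P := by
    simp only [Expr.cell, Expr.eval, h14, h1.rep.hb, h1.rep.procs]
  by_cases hm : q.Movable P x
  · -- The announced object moves.
    have hg : 2 * P + q.a < 3 * P := by omega
    have h2 := h1.setReg (d := 15) (v := q.arr (2 * P + q.a)) (by omega)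
    have h3 := h2.setInv (x := q.arr (2 * P + q.a)) (v := k)
    have h4 := h3.setArr (k := k) (v := q.arr (2 * P + q.a)) hk3
    have h5 := h4.setInv (x := x) (v := 2 * P + q.a)
    have h6 := h5.setArr (k := 2 * P + q.a) (v := x) hg
    obtain ⟨r, hr, hr'⟩ := settles_advance h6
    refine ⟨r, ?_, ?_⟩
    · apply hs1
      refine .jumpEq rfl ?_
      rw [if_pos (hcond1.2 hm.1)]
      -- Two jumps test whether the position lies outside the part in use; either alternative leads
      -- to the exchange.
      have hto : ∀ {r}, Settles implementation p1 30 r 39 → Settles implementation p1 28 r 39 := by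
        intro r hr
        refine .jumpLt rfl ?_
        rcases hm.2 with hlt | hle
        · rw [if_pos (hcond2.2 hlt)]; exact hr
        · by_cases hlt : k < q.hb
          · rw [if_pos (hcond2.2 hlt)]; exact hr
          · rw [if_neg (mt hcond2.1 hlt)]
            refine .jumpLt rfl ?_
            rw [if_neg (mt hcond3.1 (not_lt.2 hle))]
            exact hr
      apply hto
      -- The displaced object is saved in cell 15, and the announced one stays in cell 12, so the
      -- table entries can be overwritten one after the other.
      refine .set (d' := 15) (v := q.arr (2 * P + q.a)) rfl rfl ?_ ?_
      · simp only [Expr.arr, Expr.guard, Expr.cell, Expr.eval, h1.rep.a, h1.rep.procs, ← two_mul]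
        exact h1.rep.arr _ hg
      refine .set (d' := 32 + 3 * P + q.arr (2 * P + q.a)) (v := k) rfl ?_ ?_ ?_
      · simp [Expr.cell, Expr.eval, h2.rep.inv_base, Private.setInt_ints]
      · simp [Expr.cell, Expr.eval, Private.setInt_ints, h14]
      refine .set (d' := 32 + k) (v := q.arr (2 * P + q.a)) rfl ?_ ?_ ?_
      · simp only [Expr.cell, Expr.eval, Private.setInt_ints]
        rw [if_neg (by omega), if_neg (by omega), h14]
      · simp only [Expr.cell, Expr.eval, Private.setInt_ints]
        rw [if_neg (by omega), if_pos trivial]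
      refine .set (d' := 32 + 3 * P + x) (v := 2 * P + q.a) rfl ?_ ?_ ?_
      · simp only [Expr.announced, Expr.cell, Expr.eval, h4.rep.inv_base]
        simp only [Private.setInt_ints]
        rw [if_neg (by omega), if_neg (by omega), if_neg (by omega), h12]
      · simp only [Expr.guard, Expr.cell, Expr.eval, h4.rep.procs, h4.rep.a, ← two_mul]
      refine .set (d' := 32 + (2 * P + q.a)) (v := x) rfl ?_ ?_ hr
      · simp only [Expr.guard, Expr.cell, Expr.eval, h5.rep.procs, h5.rep.a, ← two_mul]
      · simp only [Expr.announced, Expr.cell, Expr.eval, Private.setInt_ints]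
        rw [if_neg (by omega), if_neg (by omega), if_neg (by omega), if_neg (by omega), h12]
    · rw [Pool.scanned, if_pos hm, Pool.swap]
      rw [← hk, hm.1]
      exact hr'
  · obtain ⟨r, hr, hr'⟩ := settles_advance h1
    refine ⟨r, ?_, ?_⟩
    · apply hs1
      refine .jumpEq rfl ?_
      by_cases hx1 : q.arr k = x
      · rw [if_pos (hcond1.2 hx1)]
        have h28 : ¬ k < q.hb := fun hlt => hm ⟨hx1, .inl hlt⟩
        have h29 : k < q.hb + P := not_le.1 fun hle => hm ⟨hx1, .inr hle⟩
        refine .jumpLt rfl ?_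
        rw [if_neg (mt hcond2.1 h28)]
        refine .jumpLt rfl ?_
        rw [if_pos (hcond3.2 h29)]
        exact hr
      · rw [if_neg (mt hcond1.1 hx1)]
        refine .jumpEq rfl ?_
        rw [if_pos rfl]
        exact hr
    · rw [Pool.scanned, if_neg hm]
      exact hr'

end Machine

section Machine

variable {P M : ℕ} {V : Type u}

/-! ### Shared instructions -/

section Exec

variable {N₁ N₂ : ℕ} {s : Shared N₁ N₂ V} {p : Private V} {k : ℕ}

theorem exec_readRec (pc d' : ℕ) {a d : Expr} (ht : implementation.text[pc]? = some (.readRec a d))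
    (ha : a.eval p.ints = k) (hd : d.eval p.ints = d') (hk : k < N₂) {x : Rec}
    (hx : s.recs ⟨k, hk⟩ = x) :
    exec implementation s p pc =
      (s, ((p.setInt d' x.1).setInt (d' + 1) x.2.1).setInt (d' + 2) x.2.2, .goto (pc + 1)) := by
  subst ha hd hx
  unfold exec
  rw [ht]
  simp only [dif_pos hk]
  rfl

theorem exec_casRec (pc d' : ℕ) {a o₁ o₂ o₃ n₁ n₂ n₃ d : Expr}
    (ht : implementation.text[pc]? = some (.casRec a o₁ o₂ o₃ n₁ n₂ n₃ d)) (ha : a.eval p.ints = k)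
    (hd : d.eval p.ints = d') (hk : k < N₂) {x y : Rec}
    (hx : (o₁.eval p.ints, o₂.eval p.ints, o₃.eval p.ints) = x)
    (hy : (n₁.eval p.ints, n₂.eval p.ints, n₃.eval p.ints) = y) (h : s.recs ⟨k, hk⟩ = x) :
    exec implementation s p pc =
      ({ s with recs := Function.update s.recs ⟨k, hk⟩ y }, p.setInt d' 1, .goto (pc + 1)) := by
  subst ha hd hx hy
  unfold exec
  rw [ht]
  simp only [dif_pos hk, if_pos h]
  rfl

theorem exec_casRec_fail (pc d' : ℕ) {a o₁ o₂ o₃ n₁ n₂ n₃ d : Expr}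
    (ht : implementation.text[pc]? = some (.casRec a o₁ o₂ o₃ n₁ n₂ n₃ d)) (ha : a.eval p.ints = k)
    (hd : d.eval p.ints = d') (hk : k < N₂) {x : Rec}
    (hx : (o₁.eval p.ints, o₂.eval p.ints, o₃.eval p.ints) = x) (h : s.recs ⟨k, hk⟩ ≠ x) :
    exec implementation s p pc = (s, p.setInt d' 0, .goto (pc + 1)) := by
  subst ha hd hx
  unfold exec
  rw [ht]
  simp only [dif_pos hk, if_neg h]
  rfl

theorem exec_readVal (pc d' : ℕ) {a d : Expr} (ht : implementation.text[pc]? = some (.readVal a d))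
    (ha : a.eval p.ints = k) (hd : d.eval p.ints = d') (hk : k < N₁) {x : V}
    (hx : s.objs ⟨k, hk⟩ = x) :
    exec implementation s p pc = (s, p.setVal d' x, .goto (pc + 1)) := by
  subst ha hd hx
  unfold exec
  rw [ht]
  simp only [dif_pos hk]
  rfl

theorem exec_casVal (pc d' : ℕ) {a o n d : Expr} (ht : implementation.text[pc]? = some (.casVal a o n d))
    (ha : a.eval p.ints = k) (hd : d.eval p.ints = d') (hk : k < N₁) {y : V}
    (hy : p.vals (n.eval p.ints) = y) (h : s.objs ⟨k, hk⟩ = p.vals (o.eval p.ints)) :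
    exec implementation s p pc =
      ({ s with objs := Function.update s.objs ⟨k, hk⟩ y }, p.setInt d' 1, .goto (pc + 1)) := by
  subst ha hd hy
  unfold exec
  rw [ht]
  simp only [dif_pos hk, if_pos h]
  rfl

theorem exec_casVal_fail (pc d' : ℕ) {a o n d : Expr} (ht : implementation.text[pc]? = some (.casVal a o n d))
    (ha : a.eval p.ints = k) (hd : d.eval p.ints = d') (hk : k < N₁)
    (h : s.objs ⟨k, hk⟩ ≠ p.vals (o.eval p.ints)) :
    exec implementation s p pc = (s, p.setInt d' 0, .goto (pc + 1)) := by
  subst ha hd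
  unfold exec
  rw [ht]
  simp only [dif_pos hk, if_neg h]
  rfl

end Exec

/-! ### Refinement -/

/-- Position in the program text and registers of a process before a shared instruction or a
return. -/
def Local.At (op : Op M V) : Local V → Private V → ℕ → Prop
  | .readAnn, _, pc => pc = 3
  | .post x, p, pc => pc = 4 ∧ (p.ints 10, p.ints 11, p.ints 12) = x
  | .readObj s, p, pc => pc = 5 ∧ p.ints 11 + 1 = s
  | .fill s x, p, pc => pc = 6 ∧ p.ints 11 + 1 = s ∧ p.ints 14 = x
  | .readPtr, _, pc => pc = 7
  | .access x, p, pc => p.ints 12 - 1 = x ∧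
      match op with
      | .read _ => pc = 11
      | .cas _ _ _ => pc = 9
      | .write _ _ => False
  | .loadFresh, _, pc => pc = 13
  | .initFresh y, p, pc => pc = 14 ∧ p.vals 2 = y
  | .readCur, _, pc => pc = 15
  | .swing x e, p, pc => pc = 16 ∧ p.ints 14 = x ∧ p.ints 15 = e ∧ p.ints 16 = 0
  | .scan, _, pc => pc = 20
  | .help j s, p, pc => pc = 22 ∧ p.ints 10 = j ∧ p.ints 11 = s
  | .helpFill j s x, p, pc => pc = 23 ∧ p.ints 10 = j ∧ p.ints 11 = s ∧ p.ints 14 = x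
  | .rescan, _, pc => pc = 24
  | .fin r, p, pc => (pc = 10 ∧ r = .flag (decide (p.ints 13 ≠ 0))) ∨
      (pc = 12 ∧ r = .value (p.vals 2)) ∨ (pc = 39 ∧ r = .ack)

theorem Local.At.lt {op : Op M V} {l : Local V} {p : Private V} {pc : ℕ} (h : l.At op p pc) :
    pc < 40 := by
  cases l <;> simp only [Local.At] at h
  case access x =>
    have h := h.2
    cases op <;> simp only at h <;> omega
  all_goals omega

theorem Settles.le {p q : Private V} {pc qc : ℕ} (h : Settles implementation p pc q qc) :
    pc ≤ qc := by
  induction h with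
  | refl => exact le_rfl
  | step h _ ih => exact (localStep_lt h).le.trans ih

/-- The shared memory contains the pointers, announcements and values. -/
structure Mem (s : Shared (M + 3 * P * P) (M + P) V) (obj : ℕ → ℕ × ℕ) (ann : ℕ → Rec)
    (buf : ℕ → V) : Prop where
  objs : ∀ k, s.objs k = buf k
  recs_obj : ∀ k (h : k < M + P), k < M → s.recs ⟨k, h⟩ = ((obj k).1, (obj k).2, 0)
  recs_ann : ∀ k (h : M + k < M + P), s.recs ⟨M + k, h⟩ = ann k

section Mem

variable {s : Shared (M + 3 * P * P) (M + P) V} {obj : ℕ → ℕ × ℕ} {ann : ℕ → Rec} {buf : ℕ → V}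

theorem Mem.setBuf (h : Mem s obj ann buf) {k : ℕ} (hk : k < M + 3 * P * P) (v : V) :
    Mem { s with objs := Function.update s.objs ⟨k, hk⟩ v } obj ann (Function.update buf k v) where
  objs l := by
    simp only [Function.update_apply, Fin.ext_iff, h.objs]
  recs_obj := h.recs_obj
  recs_ann := h.recs_ann

theorem Mem.setObj (h : Mem s obj ann buf) {j : ℕ} (hj : j < M) (hk : j < M + P) (x e : ℕ) :
    Mem { s with recs := Function.update s.recs ⟨j, hk⟩ (x, e, 0) }
      (Function.update obj j (x, e)) ann buf where
  objs := h.objs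
  recs_obj k hk hkM := by
    simp only [Function.update_apply, Fin.ext_iff, h.recs_obj k hk hkM]
    split <;> rfl
  recs_ann k hk := by
    simp only [Function.update_apply, Fin.ext_iff, h.recs_ann k hk]
    rw [if_neg (by omega)]

theorem Mem.setAnn (h : Mem s obj ann buf) {i : ℕ} (hk : M + i < M + P) (x : Rec) :
    Mem { s with recs := Function.update s.recs ⟨M + i, hk⟩ x } obj (Function.update ann i x)
      buf where
  objs := h.objs
  recs_obj k hk hkM := by
    simp only [Function.update_apply, Fin.ext_iff, h.recs_obj k hk hkM]
    rw [if_neg (by omega)]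
  recs_ann k hk := by
    simp only [Function.update_apply, Fin.ext_iff, h.recs_ann k hk, Nat.add_left_cancel_iff]

end Mem

/-- The next instruction of process `i`, which is settled, makes a step of the transition
system. -/
def State.Advances (A : State P M V) (s : Shared (M + 3 * P * P) (M + P) V) (i : Fin P)
    (op : Op M V) (p : Private V) (pc : ℕ) : Prop :=
  ∃ s' p' l' A', exec implementation s p pc = (s', p', .goto (pc + 1)) ∧ A.Step none A' ∧
    A'.proc = Function.update A.proc i (.busy op l') ∧ (∀ h, h ≠ i → A'.pool h = A.pool h) ∧
    Mem s' A'.obj A'.ann A'.buf ∧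
    ∃ q qc, Settles implementation p' (pc + 1) q qc ∧ Regs P M i (A'.pool i) op q ∧ l'.At op q qc

theorem Regs.setRegs {i : ℕ} {q : Pool} {op : Op M V} {p : Private V} (h : Regs P M i q op p)
    {d u v w : ℕ} (hd : 8 ≤ d ∧ d + 2 < 32) :
    Regs P M i q op (((p.setInt d u).setInt (d + 1) v).setInt (d + 2) w) :=
  ((h.setReg (by omega)).setReg (by omega)).setReg (by omega)

theorem settles_access {i : ℕ} {q : Pool} {op : Op M V} {p : Private V} (h : Regs P M i q op p)
    (hop : ¬ op.IsWrite) :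
    ∃ qc, Settles implementation p 8 p qc ∧ Local.At op (.access (p.ints 12 - 1)) p qc := by
  have h5 := h.params.2
  cases op with
  | read j =>
    refine ⟨11, .jumpEq rfl ?_, rfl, rfl⟩
    rw [if_pos (show (Expr.cell 5).eval p.ints = (Expr.const 0).eval p.ints from h5)]
    exact .refl rfl
  | cas j a b =>
    refine ⟨9, .jumpEq rfl ?_, rfl, rfl⟩
    have h5 : (Expr.cell 5).eval p.ints = 1 := h5.1
    rw [h5, if_neg (by simp [Expr.eval])]
    exact .refl rfl
  | write j v => exact (hop ⟨j, v, rfl⟩).elim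

/-- The invariants enter here for two reasons: all addresses are in range, so that no access faults,
and the CAS operations that the transition system treats as unconditional (posting an announcement,
initializing a fresh object) do succeed. -/
theorem State.Lin.advances {σ₀ : Fin M → V} {A : State P M V} {H : List (Event P M V)}
    {L : List (Ent P M V)} {home : ℕ → ℕ × ℕ} (hA : A.Lin σ₀ H L home)
    {s : Shared (M + 3 * P * P) (M + P) V} (hm : Mem s A.obj A.ann A.buf) {i : Fin P}
    {op : Op M V} {l : Local V} (h : A.proc i = .busy op l) {p : Private V} {pc : ℕ}
    (hr : Regs P M i (A.pool i) op p) (ha : l.At op p pc) :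
    A.Advances s i op p pc ∨ ∃ r, l = .fin r ∧ exec implementation s p pc = (s, p, .done r) := by
  have hs := hA.safe
  have hinv := hs.annInv i op l h
  have hval := hA.valInv i op l h
  have hi := i.2
  have hj := op.loc.2
  have h0 : p.ints 0 = op.loc := hr.params.1
  have hslot := (hs.pool i).slot_lt
  have halt := (hs.pool i).a_lt
  have hfresh : Expr.slot.arr.eval p.ints = (A.pool i).fresh := by
    simp only [Expr.slot, Expr.arr, Expr.cell, Expr.eval, hr.rep.a, hr.rep.hb]
    exact hr.rep.arr _ hslot
  have hfresh_lt : (A.pool i).fresh < M + 3 * P * P := hs.arr_lt i _ hslot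
  have hscan : Expr.scanned.eval p.ints = M + (A.pool i).a := by
    simp [Expr.scanned, Expr.cell, Expr.eval, hr.rep.a, hr.rep.base]
  cases l with
  | readAnn =>
    obtain rfl := ha
    exact .inl ⟨_, _, _, _, exec_readRec 3 10 rfl hr.rep.own rfl (by omega) (hm.recs_ann i _),
      .readAnn i op h, rfl, fun _ _ => rfl, hm, _, _, .refl rfl, hr.setRegs (by omega), rfl, rfl⟩
  | post x =>
    obtain ⟨rfl, hx⟩ := ha
    refine .inl ⟨_, _, _, _, exec_casRec 4 13 (y := (op.loc, x.2.1 + 1, 0)) rfl hr.rep.own rfl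
      (by omega) hx ?_ ((hm.recs_ann i _).trans hinv.2), .post i op x h, rfl, fun _ _ => rfl,
      hm.setAnn _ _, _, _, .refl rfl, hr.setReg (by omega), rfl, ?_⟩
    · rw [← hx]
      simp only [Expr.cell, Expr.eval, h0]
    · rw [← hx]
      rfl
  | readObj n =>
    obtain ⟨rfl, hx⟩ := ha
    exact .inl ⟨_, _, _, _, exec_readRec 5 14 rfl h0 rfl (by omega) (hm.recs_obj op.loc _ hj),
      .readObj i op n h, rfl, fun _ _ => rfl, hm, _, _, .refl rfl, hr.setRegs (by omega), rfl, hx,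
      rfl⟩
  | fill n x =>
    obtain ⟨rfl, hn, hx⟩ := ha
    by_cases hc : A.ann i = (↑op.loc, n, 0)
    · refine .inl ⟨_, _, _, _, exec_casRec 6 13 (x := (op.loc, n, 0)) (y := (op.loc, n, x + 1)) rfl
        hr.rep.own rfl (by omega) ?_ ?_ ((hm.recs_ann i _).trans hc), .fill i op n x h hc, rfl,
        fun _ _ => rfl, hm.setAnn _ _, _, _, .refl rfl, hr.setReg (by omega), rfl⟩
      · simp only [Expr.cell, Expr.eval, h0, hn]
      · simp only [Expr.cell, Expr.eval, h0, hn, hx]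
    · refine .inl ⟨_, _, _, _, exec_casRec_fail 6 13 (x := (op.loc, n, 0)) rfl hr.rep.own rfl
        (by omega) ?_ (by rwa [hm.recs_ann i]), .fill_fail i op n x h hc, rfl,
        fun _ _ => rfl, hm, _, _, .refl rfl, hr.setReg (by omega), rfl⟩
      simp only [Expr.cell, Expr.eval, h0, hn]
  | readPtr =>
    obtain rfl := ha
    have hr' := hr.setRegs (d := 10) (u := (A.ann i).1) (v := (A.ann i).2.1) (w := (A.ann i).2.2)
      (by omega)
    obtain ⟨qc, h1, h2⟩ := settles_access hr' hinv.1
    exact .inl ⟨_, _, _, _, exec_readRec 7 10 rfl hr.rep.own rfl (by omega) (hm.recs_ann i _),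
      .readPtr i op h, rfl, fun _ _ => rfl, hm, _, qc, h1, hr', h2⟩
  | access x =>
    obtain ⟨hx, ha⟩ := ha
    -- An announcement made for the current operation shows an existing object; only the initial
    -- announcements do not.
    have hlt : x < M + 3 * P * P := (hA.acq i op _ x h trivial (.inl hinv.2.2)).1
    have hann : Expr.announced.eval p.ints = x := by
      simp [Expr.announced, Expr.cell, Expr.eval, hx]
    have hobj : s.objs ⟨x, hlt⟩ = A.buf x := hm.objs _
    cases op with
    | write j v => exact ha.elim
    | read j =>
      obtain rfl := ha
      refine .inl ⟨_, _, _, _, exec_readVal 11 2 rfl hann rfl hlt hobj,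
        .access i _ x h, rfl, fun _ _ => rfl, ?_, _, _, .refl rfl, hr.setVal, .inr (.inl ⟨rfl, ?_⟩)⟩
      · simp only [State.goto, Op.act, Function.update_eq_self]
        exact hm
      · simp [Op.act, Private.setVal_vals]
    | cas j a b =>
      obtain rfl := ha
      obtain ⟨-, h0, h1⟩ := hr.params.2
      by_cases hc : A.buf x = a
      · refine .inl ⟨_, _, _, _, exec_casVal 9 13 (y := b) rfl hann rfl hlt h1 ?_,
          .access i _ x h, rfl, fun _ _ => rfl, ?_, _, _, .refl rfl, hr.setReg (by omega),
          .inl ⟨rfl, ?_⟩⟩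
        · rw [hobj, hc]; exact h0.symm
        · simp only [State.goto, Op.act, if_pos hc]
          exact hm.setBuf hlt b
        · simp [Op.act, hc, Private.setInt_ints]
      · refine .inl ⟨_, _, _, _, exec_casVal_fail 9 13 rfl hann rfl hlt ?_,
          .access i _ x h, rfl, fun _ _ => rfl, ?_, _, _, .refl rfl, hr.setReg (by omega),
          .inl ⟨rfl, ?_⟩⟩
        · rw [hobj]; exact fun h' => hc (h'.trans h0)
        · simp only [State.goto, Op.act, if_neg hc, Function.update_eq_self]
          exact hm
        · simp [Op.act, hc, Private.setInt_ints]
  | loadFresh =>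
    obtain rfl := ha
    exact .inl ⟨_, _, _, _, exec_readVal 13 2 rfl hfresh rfl hfresh_lt (hm.objs _),
      .loadFresh i op h, rfl, fun _ _ => rfl, hm, _, _, .refl rfl, hr.setVal, rfl, rfl⟩
  | initFresh y =>
    obtain ⟨rfl, hy⟩ := ha
    obtain ⟨j, v, rfl⟩ := hinv
    have hobj : s.objs ⟨(A.pool i).fresh, hfresh_lt⟩ = A.buf (A.pool i).fresh := hm.objs _
    exact .inl ⟨_, _, _, _, exec_casVal 14 13 rfl hfresh rfl hfresh_lt (hr.params.2 :)
      -- The object still holds the value just read, so the CAS succeeds.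
      (by rw [hobj]; exact hval.trans hy.symm),
      .initFresh i j v y h, rfl, fun _ _ => rfl, hm.setBuf _ _, _, _, .refl rfl,
      hr.setReg (by omega), rfl⟩
  | readCur =>
    obtain rfl := ha
    exact .inl ⟨_, _, _, _, exec_readRec 15 14 rfl h0 rfl (by omega) (hm.recs_obj op.loc _ hj),
      .readCur i op h, rfl, fun _ _ => rfl, hm, _, _, .refl rfl, hr.setRegs (by omega), rfl, rfl,
      rfl, rfl⟩
  | swing x e =>
    obtain ⟨rfl, hx, he, h16⟩ := ha
    have hold : ((Expr.cell 14).eval p.ints, (Expr.cell 15).eval p.ints,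
        (Expr.cell 16).eval p.ints) = (x, e, 0) := by
      simp only [Expr.cell, Expr.eval, hx, he, h16]
    by_cases hc : A.obj op.loc = (x, e)
    · have hr' := hr.setReg (d := 13) (v := 1) (by omega)
      obtain ⟨r, h1, h2⟩ := settles_exchange hr' hslot
      rw [show (p.setInt 13 1).ints 14 = x from hx] at h2
      refine .inl ⟨_, _, _, _, exec_casRec 16 13 (y := ((A.pool i).fresh, e + 1, 0)) rfl h0 rfl
        (by omega) hold ?_ (by rw [hm.recs_obj op.loc _ hj, hc]), .swing i op x e h hc, rfl,
        fun k hk => Function.update_of_ne hk .., hm.setObj hj _ _ _, r, 20, .jumpEq rfl ?_, ?_, rfl⟩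
      · simp only [hfresh]
        simp only [Expr.cell, Expr.eval, he]
      · exact h1
      · simpa [State.goto] using h2
    · refine .inl ⟨_, _, _, _, exec_casRec_fail 16 13 rfl h0 rfl (by omega) hold ?_,
        .swing_fail i op x e h hc, rfl, fun _ _ => rfl, hm, _, 39, .jumpEq rfl (.refl rfl),
        hr.setReg (by omega), .inr (.inr ⟨rfl, rfl⟩)⟩
      rw [hm.recs_obj op.loc _ hj]
      intro h'
      simp only [Prod.mk.injEq] at h'
      exact hc (Prod.ext h'.1 h'.2.1)
  | scan =>
    obtain rfl := ha
    set x := A.ann (A.pool i).a with hx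
    have hr' := hr.setRegs (d := 10) (u := x.1) (v := x.2.1) (w := x.2.2) (by omega)
    have hexec := exec_readRec 20 10 rfl hscan rfl (by omega)
      (hm.recs_ann (A.pool i).a (by omega))
    by_cases hc : x.2.2 = 0
    · refine .inl ⟨_, _, _, _, hexec, .scan_open i op h hc, rfl, fun _ _ => rfl, hm, _, 22,
        .jumpLt rfl ?_, hr', rfl, rfl, rfl⟩
      rw [if_neg (by simp [Expr.cell, Expr.eval, Private.setInt_ints, ← hx, hc])]
      exact .refl rfl
    · obtain ⟨r, h1, h2⟩ := settles_scanned hr' halt (hs.pool i).inv_lt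
      refine .inl ⟨_, _, _, _, hexec, .scan i op h hc, rfl, fun k hk => Function.update_of_ne hk ..,
        hm, r, 39, .jumpLt rfl ?_, ?_, .inr (.inr ⟨rfl, rfl⟩)⟩
      · rw [if_pos (by simp [Expr.cell, Expr.eval, Private.setInt_ints, ← hx]; omega)]
        exact h1
      · simpa [State.goto, Private.setInt_ints] using h2
  | help j n =>
    obtain ⟨rfl, h10, h11⟩ := ha
    have hjM : j < M := hinv.2.1
    exact .inl ⟨_, _, _, _, exec_readRec 22 14 rfl h10 rfl (by omega) (hm.recs_obj j _ hjM),
      .help i op j n h, rfl, fun _ _ => rfl, hm, _, _, .refl rfl, hr.setRegs (by omega), rfl, h10,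
      h11, rfl⟩
  | helpFill j n x =>
    obtain ⟨rfl, h10, h11, h14⟩ := ha
    have hold : ((Expr.cell 10).eval p.ints, (Expr.cell 11).eval p.ints,
        (Expr.const 0).eval p.ints) = (j, n, 0) := by
      simp only [Expr.cell, Expr.eval, h10, h11]
    by_cases hc : A.ann (A.pool i).a = (j, n, 0)
    · refine .inl ⟨_, _, _, _, exec_casRec 23 13 (y := (j, n, x + 1)) rfl
        hscan rfl (by omega) hold ?_ ((hm.recs_ann _ _).trans hc), .helpFill i op j n x h hc, rfl,
        fun _ _ => rfl, hm.setAnn _ _, _, _, .refl rfl, hr.setReg (by omega), rfl⟩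
      simp only [Expr.cell, Expr.eval, h10, h11, h14]
    · exact .inl ⟨_, _, _, _, exec_casRec_fail 23 13 rfl hscan rfl
        (by omega) hold (by rwa [hm.recs_ann]), .helpFill_fail i op j n x h hc, rfl,
        fun _ _ => rfl, hm, _, _, .refl rfl, hr.setReg (by omega), rfl⟩
  | rescan =>
    obtain rfl := ha
    set x := A.ann (A.pool i).a with hx
    have hr' := hr.setRegs (d := 10) (u := x.1) (v := x.2.1) (w := x.2.2) (by omega)
    obtain ⟨r, h1, h2⟩ := settles_scanned hr' halt (hs.pool i).inv_lt
    refine .inl ⟨_, _, _, _, exec_readRec 24 10 rfl hscan rfl (by omega) (hm.recs_ann _ (by omega)),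
      .rescan i op h, rfl, fun k hk => Function.update_of_ne hk ..,
      hm, r, 39, h1, ?_, .inr (.inr ⟨rfl, rfl⟩)⟩
    simpa [State.goto, Private.setInt_ints] using h2
  | fin r =>
    refine .inr ⟨r, rfl, ?_⟩
    rcases ha with ⟨rfl, rfl⟩ | ⟨rfl, rfl⟩ | ⟨rfl, rfl⟩ <;> rfl

/-- The machine is about to make, after some local instructions, the next step of a process of the
transition system. -/
inductive Follows (i : ℕ) (q : Pool) : Proc M V → Private V → Control → Prop where
  | idle {p : Private V} (h : Rep P M i p.ints q) : Follows i q .idle p .idle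
  | busy {op : Op M V} {l : Local V} {p r : Private V} {pc rc n : ℕ} (hn : n ≤ pc)
      (hs : Settles implementation p pc r rc) (hr : Regs P M i q op r) (ha : l.At op r rc) :
      Follows i q (.busy op l) p (.running pc n)

/-- The configuration represents the state of the transition system. -/
structure Represents (c : Config P (M + 3 * P * P) (M + P) V) (A : State P M V) : Prop where
  mem : Mem c.shared A.obj A.ann A.buf
  follows : ∀ i : Fin P, Follows (P := P) i (A.pool i) (A.proc i) (c.priv i) (c.ctrl i)

/-- The number of executed instructions never exceeds the position in the text, because every
instruction moves forward; and the text has 40 positions. -/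
theorem Represents.lt {c : Config P (M + 3 * P * P) (M + P) V} {A : State P M V}
    (h : Represents c A) {i : Fin P} {pc n : ℕ} (hi : c.ctrl i = .running pc n) : n < 40 := by
  have hf := h.follows i
  rw [hi] at hf
  generalize A.proc i = pr at hf
  cases hf with
  | busy hn hs hr ha => exact (hn.trans hs.le).trans_lt ha.lt

theorem Follows.first {i : ℕ} {q : Pool} {p : Private V} (h : Rep P M i p.ints q)
    (op : Op M V) : Follows (P := P) i q (.busy op op.first) (op.pass p)
      (.running (op.entry implementation) 0) := by
  cases op with
  | read j =>
    rw [Op.first, if_neg (by rintro ⟨_, _, h⟩; cases h)]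
    refine .busy (Nat.zero_le _) (rc := 3)
      (.set (d' := 5) (v := 0) rfl rfl rfl (.jumpEq rfl (.refl rfl)))
      ⟨(h.setReg (.inl rfl)).setReg (.inr (.inl rfl)), ?_, ?_⟩ rfl
    · rfl
    · rfl
  | cas j a b =>
    rw [Op.first, if_neg (by rintro ⟨_, _, h⟩; cases h)]
    refine .busy (Nat.zero_le _) (rc := 3) (.set (d' := 5) (v := 1) rfl rfl rfl (.refl rfl))
      ⟨(h.setReg (.inl rfl)).setReg (.inr (.inl rfl)), ?_, ?_, ?_, ?_⟩ rfl
    · rfl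
    · rfl
    · rfl
    · rfl
  | write j v =>
    rw [Op.first, if_pos ⟨j, v, rfl⟩]
    exact .busy (Nat.zero_le _) (rc := 13) (.refl rfl) ⟨h.setReg (.inl rfl), rfl, rfl⟩ rfl

theorem Represents.update {c : Config P (M + 3 * P * P) (M + P) V} {A B : State P M V}
    (h : Represents c A) {i : Fin P} {s : Shared (M + 3 * P * P) (M + P) V} {p : Private V}
    {t : Control} (hm : Mem s B.obj B.ann B.buf) (hproc : ∀ h, h ≠ i → B.proc h = A.proc h)
    (hpool : ∀ h, h ≠ i → B.pool h = A.pool h)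
    (hf : Follows (P := P) i (B.pool i) (B.proc i) p t) :
    Represents ⟨s, Function.update c.priv i p, Function.update c.ctrl i t⟩ B where
  mem := hm
  follows r := by
    by_cases hr : r = i
    · subst hr
      simpa using hf
    · simp only [Function.update_of_ne hr, hproc r hr, hpool r hr]
      exact h.follows r

/-- Local instructions are stuttering steps, because `Follows` already looks ahead to the settled
state. Every other step of the machine is one transition with the same event. -/
theorem Represents.step {σ₀ : Fin M → V} {c c' : Config P (M + 3 * P * P) (M + P) V}
    {A : State P M V} {H : List (Event P M V)} {L : List (Ent P M V)} {home : ℕ → ℕ × ℕ}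
    {e : Option (Event P M V)} (h : Represents c A) (hA : A.Lin σ₀ H L home)
    (hstep : Step implementation c e c') :
    (e = none ∧ Represents c' A) ∨ ∃ B, A.Step e B ∧ Represents c' B := by
  cases hstep with
  | invoke i op hi =>
    have hf := h.follows i
    rw [hi] at hf
    generalize hp : A.proc i = pr at hf
    cases hf with
    | idle hrep =>
      refine .inr ⟨_, .invoke i op hp, h.update h.mem (fun r hr => ?_) (fun _ _ => rfl) ?_⟩
      · rw [State.goto_proc, if_neg hr]
      · rw [State.goto_proc, if_pos rfl]
        exact .first hrep op
  | advance i pc n pc' s p hi he =>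
    have hf := h.follows i
    rw [hi] at hf
    generalize hp : A.proc i = pr at hf
    cases hf with
    | busy hn hs hr ha =>
      cases hs with
      | step hl hs =>
        have hlt := localStep_lt hl
        rw [exec_of_localStep hl] at he
        cases he
        refine .inl ⟨rfl, h.update h.mem (fun _ _ => rfl) (fun _ _ => rfl) ?_⟩
        rw [hp]
        exact .busy (by omega) hs hr ha
      | refl _ =>
        rcases hA.advances h.mem hp hr ha with
          ⟨s', p', l', B, hexec, hB, hproc, hpool, hm, q, qc, h1, h2, h3⟩ | ⟨r, -, hexec⟩
        · rw [hexec] at he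
          cases he
          refine .inr ⟨B, hB, h.update hm (fun r hr => ?_) hpool ?_⟩
          · rw [hproc, Function.update_of_ne hr]
          · rw [hproc, Function.update_self]
            exact .busy (by omega) h1 h2 h3
        · rw [hexec] at he
          cases he
  | finish i pc n r s p hi he =>
    have hf := h.follows i
    rw [hi] at hf
    generalize hp : A.proc i = pr at hf
    cases hf with
    | busy hn hs hr ha =>
      cases hs with
      | step hl hs =>
        rw [exec_of_localStep hl] at he
        cases he
      | refl _ =>
        rcases hA.advances h.mem hp hr ha with
          ⟨s', p', l', B, hexec, -⟩ | ⟨r', rfl, hexec⟩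
        · rw [hexec] at he
          cases he
        · rw [hexec] at he
          cases he
          refine .inr ⟨_, .respond i _ _ hp, h.update h.mem (fun r hr => ?_) (fun _ _ => rfl) ?_⟩
          · rw [State.goto_proc, if_neg hr]
          · rw [State.goto_proc, if_pos rfl]
            exact .idle hr.rep

end Machine

/-! ### Simulation of concurrent programs by linearizable implementations -/

section Simulation

variable {P M N₁ N₂ : ℕ} {V : Type u} {S : Type v}

/-- The process goes from one local state to another by local instructions and accesses with the
given responses. -/
inductive Program.LocalRun (A : Program P M V S) (i : Fin P) : S → List (Op M V × Ret V) → S → Prop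
  where
  | refl (s : S) : LocalRun A i s [] s
  | tau {s s' t : S} {K : List (Op M V × Ret V)} (h : A.act i s = .tau s')
      (h' : LocalRun A i s' K t) : LocalRun A i s K t
  | access {s t : S} {K : List (Op M V × Ret V)} {op : Op M V} {cont : Ret V → S} {r : Ret V}
      (h : A.act i s = .access op cont) (h' : LocalRun A i (cont r) K t) :
      LocalRun A i s ((op, r) :: K) t

theorem Program.LocalRun.trans {A : Program P M V S} {i : Fin P} {s t u : S}
    {K K' : List (Op M V × Ret V)} (h : A.LocalRun i s K t) (h' : A.LocalRun i t K' u) :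
    A.LocalRun i s (K ++ K') u := by
  induction h with
  | refl => exact h'
  | tau h _ ih => exact .tau h (ih h')
  | access h _ ih => exact .access h (ih h')

/-- Local instructions until the next access. -/
theorem Program.LocalRun.exists_access {A : Program P M V S} {i : Fin P} {s t : S} {op : Op M V}
    {r : Ret V} {K : List (Op M V × Ret V)} (h : A.LocalRun i s ((op, r) :: K) t) :
    ∃ u cont, A.LocalRun i s [] u ∧ A.act i u = .access op cont ∧ A.LocalRun i (cont r) K t := by
  generalize hK : (op, r) :: K = K' at h
  induction h with
  | refl => cases hK
  | tau h _ ih =>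
    obtain ⟨u, cont, h1, h2, h3⟩ := ih hK
    exact ⟨u, cont, .tau h h1, h2, h3⟩
  | access h h' =>
    cases hK
    exact ⟨_, _, .refl _, h, h'⟩

theorem Program.AtomicExec.local {A : Program P M V S} {σ₀ σ : Fin M → V}
    {T : List (Fin P × Op M V × Ret V)} {loc : Fin P → S} (h : A.AtomicExec σ₀ T loc σ)
    {i : Fin P} {s t : S} (hi : loc i = s) (hr : A.LocalRun i s [] t) :
    A.AtomicExec σ₀ T (Function.update loc i t) σ := by
  generalize hK : [] = K at hr
  induction hr generalizing loc with
  | refl =>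
    subst hi
    rwa [Function.update_eq_self]
  | @tau s s' t K hs _ ih =>
    subst hi
    have h2 := ih (.tau i s' h hs) (Function.update_self ..) hK
    rwa [Function.update_idem] at h2
  | access => cases hK

theorem Program.AtomicExec.all_local {A : Program P M V S} {σ₀ σ : Fin M → V}
    {T : List (Fin P × Op M V × Ret V)} {loc : Fin P → S} (h : A.AtomicExec σ₀ T loc σ)
    {t : Fin P → S} (ht : ∀ i, A.LocalRun i (loc i) [] (t i)) : A.AtomicExec σ₀ T t σ := by
  classical
  -- Local instructions do not touch the shared contents, so the processes can be run to their
  -- targets one at a time.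
  have key : ∀ F : Finset (Fin P),
      A.AtomicExec σ₀ T (fun i => if i ∈ F then t i else loc i) σ := by
    intro F
    induction F using Finset.induction_on with
    | empty => simpa using h
    | insert i F hi ih =>
      have h2 := ih.local (i := i) (if_neg hi) (ht i)
      convert h2 using 1
      funext r
      by_cases hr : r = i
      · subst hr; simp
      · simp [hr]
  simpa using key Finset.univ

/-- Sequential runs of all processes are merged in the order of a legal list. -/
theorem Program.AtomicExec.merge {A : Program P M V S} {σ₀ σ : Fin M → V}
    {T : List (Fin P × Op M V × Ret V)} {loc : Fin P → S} (h : A.AtomicExec σ₀ T loc σ)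
    (L : List (Instance P M V)) (hL : Legal σ L) {t : Fin P → S}
    (ht : ∀ i, A.LocalRun i (loc i)
      ((L.filter fun x => x.proc = i).map fun x => (x.op, x.ret)) (t i)) :
    ∃ σ', A.AtomicExec σ₀ (T ++ L.map fun x => (x.proc, x.op, x.ret)) t σ' := by
  induction L generalizing T loc σ with
  | nil => exact ⟨σ, by simpa using h.all_local ht⟩
  | cons x L ih =>
    obtain ⟨hx, hL⟩ := hL
    have hp := ht x.proc
    rw [List.filter_cons_of_pos (by simp), List.map_cons] at hp
    obtain ⟨u, cont, h1, h2, h3⟩ := hp.exists_access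
    have h4 := Program.AtomicExec.access x.proc x.op cont (h.local rfl h1)
      (by rwa [Function.update_self])
    rw [hx, Function.update_idem] at h4
    obtain ⟨σ', h5⟩ := ih h4 hL fun i => by
      by_cases hi : i = x.proc
      · subst hi
        rwa [Function.update_self]
      · rw [Function.update_of_ne hi]
        have := ht i
        rwa [List.filter_cons_of_neg (by simpa using Ne.symm hi)] at this
    exact ⟨σ', by simpa using h5⟩

theorem Program.SimExec.exec {A : Program P M V S} {code : Code} {c₀ c : Config P N₁ N₂ V}
    {H : List (Event P M V)} {loc : Fin P → S} (h : A.SimExec code c₀ H loc c) :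
    Exec code c₀ H c := by
  induction h with
  | start => exact .start
  | tau _ _ _ _ _ ih => exact ih
  | call _ _ _ _ _ hs ih => exact .step ih hs
  | advance _ hs ih => simpa using Exec.step ih hs
  | finish _ _ _ _ _ _ hs ih => exact .step ih hs

/-- The instance is an operation of process `i` that has returned. -/
def Instance.Completed (H : List (Event P M V)) (i : Fin P) (x : Instance P M V) : Prop :=
  x.proc = i ∧ H[x.pos]? = some (.inv i x.op) ∧ ∃ b, IsResponse H x.pos b x.ret

/-- Process `i` has got to the local state `s` by the operations that have returned. -/
structure Program.Reaches (A : Program P M V S) (H : List (Event P M V)) (i : Fin P) (s : S)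
    (idle : Prop) : Prop where
  run : ∃ K : List (Instance P M V), K.Pairwise (fun x y => x.pos < y.pos) ∧
    (∀ x, x ∈ K ↔ x.Completed H i) ∧
    A.LocalRun i (A.start i) (K.map fun x => (x.op, x.ret)) s
  settled : ∀ a op, H[a]? = some (.inv i op) → (∃ b r, IsResponse H a b r) ∨ Pending H i a op
  not_pending : idle → ∀ a op, ¬ Pending H i a op
  pending : ¬ idle → ∃ a op cont, Pending H i a op ∧ A.act i s = .access op cont

theorem Program.Reaches.other {A : Program P M V S} {H : List (Event P M V)} {i : Fin P} {s : S}
    {idle : Prop} (h : A.Reaches H i s idle) {e : Event P M V} (he : e.proc ≠ i) :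
    A.Reaches (H ++ [e]) i s idle := by
  have hp : ∀ a op, Pending (H ++ [e]) i a op ↔ Pending H i a op := by
    intro a op
    rw [pending_append]
    constructor
    · rintro (⟨-, h⟩ | ⟨-, rfl⟩)
      · exact h
      · exact (he rfl).elim
    · exact fun h => .inl ⟨he, h⟩
  have hget : ∀ (a : ℕ) (op : Op M V), (H ++ [e])[a]? = some (Event.inv i op) ↔ H[a]? = some (Event.inv i op) := by
    intro a op
    rw [getElem?_append_singleton]
    constructor
    · rintro (h | ⟨-, rfl⟩)
      · exact h
      · exact (he rfl).elim
    · exact .inl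
  have hres : ∀ a op b r, H[a]? = some (.inv i op) →
      (IsResponse (H ++ [e]) a b r ↔ IsResponse H a b r) := by
    intro a op b r ha
    rw [isResponse_append]
    constructor
    · rintro (h | ⟨-, i', op', rfl, h⟩)
      · exact h
      · have := ha.symm.trans h.1
        simp only [Option.some.injEq, Event.inv.injEq] at this
        exact (he this.1.symm).elim
    · exact .inl
  obtain ⟨K, hK, hmem, hrun⟩ := h.run
  refine ⟨⟨K, hK, fun x => (hmem x).trans ?_, hrun⟩, ?_, ?_, ?_⟩
  · simp only [Instance.Completed, hget]
    refine and_congr_right fun _ => and_congr_right fun hx => ?_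
    simp only [hres _ _ _ _ hx]
  · intro a op ha
    rw [hget] at ha
    simp only [hp, hres _ _ _ _ ha]
    exact h.settled a op ha
  · simpa only [hp] using h.not_pending
  · simpa only [hp] using h.pending

theorem Program.Reaches.invoke {A : Program P M V S} {H : List (Event P M V)} {i : Fin P} {s : S}
    {idle idle' : Prop} (h : A.Reaches H i s idle) (hi : idle) (hi' : ¬ idle') {op : Op M V}
    {cont : Ret V → S} (ha : A.act i s = .access op cont) :
    A.Reaches (H ++ [Event.inv i op]) i s idle' := by
  have hp : Pending (H ++ [Event.inv i op]) i H.length op := pending_append.2 (.inr ⟨rfl, rfl⟩)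
  have hres : ∀ a b r, IsResponse (H ++ [Event.inv i op]) a b r ↔ IsResponse H a b r := by
    intro a b r
    rw [isResponse_append]
    simp
  obtain ⟨K, hK, hmem, hrun⟩ := h.run
  refine ⟨⟨K, hK, fun x => (hmem x).trans ?_, hrun⟩, ?_, fun h => (hi' h).elim,
    fun _ => ⟨_, _, _, hp, ha⟩⟩
  · simp only [Instance.Completed, hres, getElem?_append_singleton]
    refine and_congr_right fun _ => ⟨fun hx => ⟨.inl hx.1, hx.2⟩, ?_⟩
    rintro ⟨hx | ⟨hx, -⟩, b, hb⟩
    · exact ⟨hx, b, hb⟩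
    · have h1 := hb.1
      have h2 := hb.lt
      omega
  · intro a op' h'
    rcases (getElem?_append_singleton ..).1 h' with h' | ⟨rfl, heq⟩
    · simp only [hres]
      rcases h.settled a op' h' with h' | h'
      · exact .inl h'
      · exact (h.not_pending hi _ _ h').elim
    · cases heq
      exact .inr hp

theorem Program.Reaches.respond {A : Program P M V S} {H : List (Event P M V)} {i : Fin P} {s : S}
    {idle idle' : Prop} (h : A.Reaches H i s idle) (hi : ¬ idle) (hi' : idle') {op : Op M V}
    {cont : Ret V → S} (ha : A.act i s = .access op cont) (r : Ret V) :
    A.Reaches (H ++ [Event.res i r]) i (cont r) idle' := by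
  obtain ⟨K, hK, hmem, hrun⟩ := h.run
  obtain ⟨a, op', cont', hp, ha'⟩ := h.pending hi
  obtain ⟨rfl, rfl⟩ : op = op' ∧ cont = cont' := by
    have := ha.symm.trans ha'
    simpa using this
  have hnew : IsResponse (H ++ [Event.res i r]) a H.length r :=
    isResponse_append.2 (.inr ⟨rfl, i, op, rfl, hp⟩)
  have hnp : ∀ a op, ¬ Pending (H ++ [Event.res i r]) i a op := by
    intro a op hp
    rcases pending_append.1 hp with ⟨h, -⟩ | ⟨-, h⟩
    · exact h rfl
    · cases h
  refine ⟨⟨K ++ [⟨a, i, op, r⟩], ?_, fun x => ?_, ?_⟩, ?_, fun _ => hnp, fun h => (h hi').elim⟩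
  · rw [List.pairwise_append]
    refine ⟨hK, List.pairwise_singleton .., fun x hx y hy => ?_⟩
    rw [List.mem_singleton] at hy
    subst hy
    obtain ⟨hxi, hx, b, hb⟩ := (hmem x).1 hx
    rcases lt_trichotomy x.pos a with hlt | heq | hgt
    · exact hlt
    · rw [heq] at hb
      exact (hp.not_isResponse hb).elim
    · exact (hp.2 _ _ hgt hx rfl).elim
  · rw [List.mem_append, hmem, List.mem_singleton]
    constructor
    · rintro (⟨h1, h2, b, h3⟩ | rfl)
      · exact ⟨h1, (getElem?_append_singleton ..).2 (.inl h2), b, isResponse_append.2 (.inl h3)⟩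
      · exact ⟨rfl, (getElem?_append_singleton ..).2 (.inl hp.1), _, hnew⟩
    · rintro ⟨h1, h2, b, h3⟩
      rcases (getElem?_append_singleton ..).1 h2 with h2 | ⟨-, h2⟩
      · rcases isResponse_append.1 h3 with h3 | ⟨rfl, i', op', h4, h3⟩
        · exact .inl ⟨h1, h2, b, h3⟩
        · simp only [Event.res.injEq] at h4
          obtain ⟨rfl, hr⟩ := h4
          obtain ⟨hpos, hop⟩ := hp.unique h3
          have h5 := h2.symm.trans h3.1
          simp only [Option.some.injEq, Event.inv.injEq, true_and] at h5
          obtain ⟨xp, xi, xo, xr⟩ := x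
          simp only at h1 hr hpos h5
          subst h1 hr hpos h5 hop
          exact .inr rfl
      · cases h2
  · rw [List.map_append]
    exact hrun.trans (.access ha (.refl _))
  · intro c op' hc
    rcases (getElem?_append_singleton ..).1 hc with hc | ⟨-, hc⟩
    · rcases h.settled c op' hc with ⟨b, r', hb⟩ | hb
      · exact .inl ⟨b, r', isResponse_append.2 (.inl hb)⟩
      · obtain ⟨rfl, rfl⟩ := hp.unique hb
        exact .inl ⟨_, _, hnew⟩
    · cases hc

theorem Program.Reaches.tau {A : Program P M V S} {H : List (Event P M V)} {i : Fin P} {s s' : S}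
    {idle : Prop} (h : A.Reaches H i s idle) (hi : idle) (ha : A.act i s = .tau s') :
    A.Reaches H i s' idle := by
  obtain ⟨K, hK, hmem, hrun⟩ := h.run
  refine ⟨⟨K, hK, hmem, ?_⟩, h.settled, h.not_pending, fun h => (h hi).elim⟩
  simpa using hrun.trans (.tau ha (.refl _))

/-- The simulation changes a local state only by local instructions and by returns of calls. From
the viewpoint of one process it is therefore a sequential run with the responses in the history,
whatever the implementation does. -/
theorem Program.SimExec.reaches {A : Program P M V S} {code : Code} {c₀ c : Config P N₁ N₂ V}
    (h₀ : ∀ i, c₀.ctrl i = .idle) {H : List (Event P M V)} {loc : Fin P → S}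
    (h : A.SimExec code c₀ H loc c) (i : Fin P) : A.Reaches H i (loc i) (c.ctrl i = .idle) := by
  induction h with
  | start =>
    exact ⟨⟨[], .nil, by simp [Instance.Completed], .refl _⟩, by simp, by simp [Pending],
      fun h => (h (h₀ i)).elim⟩
  | tau r s _ hi ha ih =>
    by_cases hr : i = r
    · subst hr
      rw [Function.update_self]
      exact ih.tau hi ha
    · rwa [Function.update_of_ne hr]
  | call r op cont _ ha hs ih =>
    cases hs with
    | invoke _ _ hi =>
      by_cases hr : i = r
      · subst hr
        exact ih.invoke hi (by simp) ha
      · simp only [Function.update_of_ne hr]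
        exact ih.other (Ne.symm hr)
  | @advance H loc c c' _ hs ih =>
    cases hs with
    | advance r pc n pc' s p hi he =>
      by_cases hr : i = r
      · subst hr
        have : (c.ctrl i = .idle) = (Function.update c.ctrl i (.running pc' (n + 1)) i = .idle) := by
          simp [hi]
        rwa [this] at ih
      · simpa only [Function.update_of_ne hr] using ih
  | finish r op cont x _ ha hs ih =>
    cases hs with
    | finish _ pc n _ s p hi he =>
      by_cases hr : i = r
      · subst hr
        rw [Function.update_self]
        exact ih.respond (by simp [hi]) (by simp) ha x
      · simp only [Function.update_of_ne hr]
        exact ih.other (Ne.symm hr)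

theorem eq_of_pairwise_pos {K K' : List (Instance P M V)} (h : K.Pairwise fun x y => x.pos < y.pos)
    (h' : K'.Pairwise fun x y => x.pos < y.pos) (hm : ∀ x, x ∈ K ↔ x ∈ K') : K = K' := by
  have hnd : ∀ {K : List (Instance P M V)}, K.Pairwise (fun x y => x.pos < y.pos) → K.Nodup :=
    fun h => h.imp fun hxy heq => by subst heq; omega
  exact ((List.perm_ext_iff_of_nodup (hnd h) (hnd h')).2 hm).eq_of_pairwise
    (fun x y _ _ h1 h2 => by omega) h h'

/-- The operations of a process take effect in the order of their invocations. -/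
theorem Program.Reaches.pairwise_pos {A : Program P M V S} {H : List (Event P M V)} {i : Fin P}
    {s : S} {idle : Prop} (h : A.Reaches H i s idle) {L : List (Instance P M V)}
    (hL : IsLinearization H L) :
    (L.filter fun x => x.proc = i).Pairwise fun x y => x.pos < y.pos := by
  have hnd := List.pairwise_map.1 hL.nodup
  refine ((hnd.and hL.order).filter _).imp_of_mem fun {x y} hx hy hxy => ?_
  simp only [List.mem_filter, decide_eq_true_eq] at hx hy
  have hHx := hL.mem x hx.1
  have hHy := hL.mem y hy.1
  rw [hx.2] at hHx
  rw [hy.2] at hHy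
  by_contra hlt
  have hlt : y.pos < x.pos := by have := hxy.1; omega
  -- A process invokes its next operation only after the previous one has returned, so the order of
  -- the linearization agrees with the order of invocation.
  rcases h.settled _ _ hHy with ⟨b, r, hb⟩ | hp
  · refine hxy.2 b r hb ?_
    obtain ⟨hyb, i', op', h1, h2, h3⟩ := hb
    have h4 := hHy.symm.trans h1
    simp only [Option.some.injEq, Event.inv.injEq] at h4
    rcases lt_trichotomy b x.pos with hb | hb | hb
    · exact hb
    · subst hb
      rw [hHx] at h2
      cases h2
    · exact (h3 _ _ hlt hb hHx h4.1).elim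
  · exact hp.2 _ _ hlt hHx rfl

/-- The operations of the process in `L` are its completed ones, in the order in which it made them,
possibly followed by its pending one. In the latter case the run is continued by this access with
the response chosen in `L`. -/
theorem Program.Reaches.exists_localRun {A : Program P M V S} {H : List (Event P M V)} {i : Fin P}
    {s : S} {idle : Prop} (h : A.Reaches H i s idle) {L : List (Instance P M V)}
    (hL : IsLinearization H L) :
    ∃ t, A.LocalRun i (A.start i) ((L.filter fun x => x.proc = i).map fun x => (x.op, x.ret)) t ∧
      (idle → t = s) ∧ (¬ idle → t = s ∨ ∃ (op : Op M V) (cont : Ret V → S) (r : Ret V),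
        A.act i s = .access op cont ∧ t = cont r) := by
  obtain ⟨K, hK, hmem, hrun⟩ := h.run
  have hF := h.pairwise_pos hL
  have hKF : ∀ x ∈ K, x ∈ L.filter fun x => x.proc = i := by
    intro x hx
    obtain ⟨hxi, hx, b, hb⟩ := (hmem x).1 hx
    obtain ⟨z, hz, hzx⟩ := hL.complete _ _ _ hb
    have h1 := hL.mem z hz
    have h2 := hL.response z hz b x.ret (by rwa [hzx])
    rw [hzx, hx] at h1
    simp only [Option.some.injEq, Event.inv.injEq] at h1
    have : z = x := by
      obtain ⟨zp, zi, zo, zr⟩ := z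
      obtain ⟨xp, xi, xo, xr⟩ := x
      simp only at hzx h1 h2 hxi
      simp only [Instance.mk.injEq]
      exact ⟨hzx, h1.1.symm.trans hxi.symm, h1.2.symm, h2⟩
    subst this
    simpa using ⟨hz, hxi⟩
  have hFK : ∀ x ∈ L.filter (fun x => x.proc = i), x ∈ K ∨ Pending H i x.pos x.op := by
    intro x hx
    simp only [List.mem_filter, decide_eq_true_eq] at hx
    have h1 := hL.mem x hx.1
    rw [hx.2] at h1
    rcases h.settled _ _ h1 with ⟨b, r, hb⟩ | hp
    · have h2 := hL.response x hx.1 b r hb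
      subst h2
      exact .inl ((hmem x).2 ⟨hx.2, h1, b, hb⟩)
    · exact .inr hp
  by_cases hex : ∃ y ∈ L.filter (fun x => x.proc = i), Pending H i y.pos y.op
  · obtain ⟨y, hy, hp⟩ := hex
    have hidle : ¬ idle := fun hi => h.not_pending hi _ _ hp
    obtain ⟨a, op, cont, hp', ha⟩ := h.pending hidle
    obtain ⟨-, rfl⟩ := hp.unique hp'
    have heq : K ++ [y] = L.filter fun x => x.proc = i := by
      refine eq_of_pairwise_pos ?_ hF fun x => ?_
      · rw [List.pairwise_append]
        refine ⟨hK, List.pairwise_singleton .., fun x hx z hz => ?_⟩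
        rw [List.mem_singleton] at hz
        subst hz
        obtain ⟨-, hx, b, hb⟩ := (hmem x).1 hx
        rcases lt_trichotomy x.pos z.pos with hlt | heq | hgt
        · exact hlt
        · rw [heq] at hb
          exact (hp.not_isResponse hb).elim
        · exact (hp.2 _ _ hgt hx rfl).elim
      · rw [List.mem_append, List.mem_singleton]
        constructor
        · rintro (hx | rfl)
          · exact hKF x hx
          · exact hy
        · intro hx
          refine (hFK x hx).imp_right fun hpx => ?_
          exact List.inj_on_of_nodup_map hL.nodup (List.mem_of_mem_filter hx)
            (List.mem_of_mem_filter hy) (hpx.unique hp).1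
    refine ⟨cont y.ret, ?_, fun hi => (hidle hi).elim, fun _ => .inr ⟨_, _, _, ha, rfl⟩⟩
    rw [← heq, List.map_append]
    exact hrun.trans (.access ha (.refl _))
  · have heq : K = L.filter fun x => x.proc = i :=
      eq_of_pairwise_pos hK hF fun x => ⟨hKF x, fun hx =>
        (hFK x hx).resolve_right fun hp => hex ⟨x, hx, hp⟩⟩
    rw [← heq]
    exact ⟨s, hrun, fun _ => rfl, fun _ => .inl rfl⟩

/-- Atomic accesses can be replaced by calls of a linearizable implementation. -/
theorem Program.isDelaySimulation_of_linearizable (A : Program P M V S) {code : Code}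
    {c₀ : Config P N₁ N₂ V} {σ₀ : Fin M → V} {k : ℕ} (hlin : Linearizable code c₀ σ₀)
    (hk : StepComplexityLE M code c₀ k) (h₀ : ∀ i, c₀.ctrl i = .idle) :
    A.IsDelaySimulation code c₀ σ₀ k := by
  intro H loc c h
  refine ⟨hk H c h.exec, ?_⟩
  obtain ⟨L, hL, hlegal⟩ := hlin H c h.exec
  -- Final local states in the atomic execution; they are ahead of the simulation only where a
  -- pending access has been linearized.
  choose t ht using fun i => (h.reaches h₀ i).exists_localRun hL
  obtain ⟨σ, hσ⟩ := Program.AtomicExec.start.merge L hlegal fun i => (ht i).1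
  exact ⟨L, t, σ, hL, by simpa using hσ, fun i => (ht i).2⟩

end Simulation

/-! ### The initial configuration -/

section Initial

variable {P M : ℕ} {V : Type u}

/-- Initial contents of the records: pointers to the value objects, and announcements that are
filled with a value object that does not exist. -/
def initialRecs (P M : ℕ) (k : Fin (M + P)) : Rec :=
  if (k : ℕ) < M then (k, 0, 0) else (0, 0, M + 3 * P * P + 1)

/-- Initial contents of the integer cells of process `i`. -/
def initialInts (P M : ℕ) (i : Fin P) (a : ℕ) : ℕ :=
  if a = 1 then P
  else if a = 2 then M + i
  else if a = 3 then M
  else if a = 4 then 32 + 3 * P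
  else if 32 ≤ a ∧ a < 32 + 3 * P then M + 3 * P * i + (a - 32)
  else 0

/-- Initial contents of the value objects; `v` is arbitrary. -/
def initialBuf (σ₀ : Fin M → V) (v : V) (k : ℕ) : V := if h : k < M then σ₀ ⟨k, h⟩ else v

/-- The initial configuration. -/
def initialConfig (P : ℕ) (σ₀ : Fin M → V) (v : V) : Config P (M + 3 * P * P) (M + P) V where
  shared := ⟨fun k => initialBuf σ₀ v k, initialRecs P M⟩
  priv i := ⟨initialInts P M i, fun _ => v⟩
  ctrl _ := .idle

/-- The initial state of the transition system. -/
def initialState (P : ℕ) (σ₀ : Fin M → V) (v : V) : State P M V where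
  obj j := (j, 0)
  ann _ := (0, 0, M + 3 * P * P + 1)
  buf := initialBuf σ₀ v
  proc _ := .idle
  pool i := { arr := fun k => M + 3 * P * i + k, inv := fun _ => 0, a := 0, hb := 0 }

theorem initialArr_lt (i : Fin P) {k : ℕ} (hk : k < 3 * P) :
    M + 3 * P * i + k < M + 3 * P * P := by
  have := Nat.mul_le_mul_left (3 * P) (Nat.succ_le_of_lt i.2)
  rw [Nat.succ_eq_add_one, mul_add, mul_one] at this
  omega

theorem represents_initial (σ₀ : Fin M → V) (v : V) :
    Represents (initialConfig P σ₀ v) (initialState P σ₀ v) where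
  mem :=
    { objs := fun _ => rfl
      recs_obj := fun k _ hk => if_pos hk
      recs_ann := fun k _ => if_neg (by simp) }
  follows i := by
    refine .idle ?_
    constructor
    · rfl
    · rfl
    · rfl
    · rfl
    · simp [initialConfig, initialInts, initialState]
    · simp [initialConfig, initialInts, initialState]
    · intro k hk
      simp only [initialConfig, initialInts, initialState]
      rw [if_neg (by omega), if_neg (by omega), if_neg (by omega), if_neg (by omega),
        if_pos (by omega), Nat.add_sub_cancel_left]
    · intro x
      simp only [initialConfig, initialInts, initialState]
      rw [if_neg (by omega), if_neg (by omega), if_neg (by omega), if_neg (by omega),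
        if_neg (by omega)]

theorem initialState_danger {σ₀ : Fin M → V} {v : V} {r : Fin P} {x : ℕ}
    (h : (initialState P σ₀ v).Danger r x) : x = M + 3 * P * P := by
  rcases h with h | ⟨h, -⟩
  · simp only [initialState] at h
    omega
  · simp [initialState] at h

theorem initialState_safe (σ₀ : Fin M → V) (v : V) : (initialState P σ₀ v).Safe := by
  have hd : ∀ (r p : Fin P) k, k < 3 * P →
      ¬ (initialState P σ₀ v).Danger r (((initialState P σ₀ v).pool p).arr k) :=
    fun r p k hk h => (initialArr_lt p hk).ne (initialState_danger h)
  constructor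
  · exact fun _ _ _ _ h => h
  · intro j p k hj hk h
    simp only [initialState] at h
    omega
  · intro p p' k k' hk hk' h
    simp only [initialState] at h
    rcases lt_trichotomy (p : ℕ) p' with hlt | heq | hgt
    · have := Nat.mul_le_mul_left (3 * P) (Nat.succ_le_of_lt hlt)
      rw [Nat.succ_eq_add_one, mul_add, mul_one] at this
      omega
    · exact Fin.ext heq
    · have := Nat.mul_le_mul_left (3 * P) (Nat.succ_le_of_lt hgt)
      rw [Nat.succ_eq_add_one, mul_add, mul_one] at this
      omega
  · exact fun j hj => Nat.lt_add_right _ hj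
  · exact fun p k hk => initialArr_lt p hk
  · intro p
    have hP := p.pos
    constructor
    · exact hP
    · exact .inl rfl
    · intro x
      simp only [initialState]
      omega
    · intro k l _ _ h
      exact Nat.add_left_cancel h
    · intro k _ h2 _ r
      simp only [initialState] at h2
      exact hd r p k (by omega)
    · intro k hk _ _ r _
      exact hd r p k hk
    -- The zero inverse table is incorrect in general, but initially nobody threatens an owned
    -- object.
    · exact fun k hk => .inr fun r => hd r p k hk
  · intro i h
    simp [initialState] at h
  · intro i op l h
    cases h

/-- With `home x = (x, 0)`, the first `M` objects belong to their locations in epoch 0. For the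
others the first component is not a location, so nothing is claimed about their contents. -/
theorem initialState_lin (σ₀ : Fin M → V) (v : V) :
    (initialState P σ₀ v).Lin σ₀ [] [] fun x => (x, 0) where
  safe := initialState_safe σ₀ v
  lin := LinInv.nil σ₀
  home_inj x y h := congrArg Prod.fst h
  home_obj _ _ := rfl
  home_le _ _ _ _ := Nat.zero_le _
  val x j _ h := by
    simp only at h
    subst h
    simp [initialState, initialBuf, valAt, evalAt]
  acq _ _ _ _ h := by cases h
  idle _ _ _ _ := by simp [Pending]
  pend _ _ _ h := by cases h
  valInv _ _ _ h := by cases h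

theorem Exec.exists_lin {σ₀ : Fin M → V} {v : V} {H : List (Event P M V)}
    {c : Config P (M + 3 * P * P) (M + P) V}
    (h : Exec implementation (initialConfig P σ₀ v) H c) :
    ∃ A L home, Represents c A ∧ A.Lin σ₀ H L home := by
  induction h with
  | start => exact ⟨_, _, _, represents_initial σ₀ v, initialState_lin σ₀ v⟩
  | step _ hs ih =>
    obtain ⟨A, L, home, hr, hA⟩ := ih
    rcases hr.step hA hs with ⟨rfl, hr'⟩ | ⟨B, hB, hr'⟩
    · rw [Option.toList_none, List.append_nil]
      exact ⟨A, L, home, hr', hA⟩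
    · obtain ⟨L', home', hB'⟩ := hA.step hB
      exact ⟨B, L', home', hr', hB'⟩

theorem implementation_linearizable (σ₀ : Fin M → V) (v : V) :
    Linearizable implementation (initialConfig P σ₀ v) σ₀ := by
  intro H c h
  obtain ⟨A, L, home, -, hA⟩ := h.exists_lin
  exact ⟨_, hA.lin.isLinearization, hA.lin.isLegal⟩

theorem implementation_stepComplexityLE (σ₀ : Fin M → V) (v : V) :
    StepComplexityLE M implementation (initialConfig P σ₀ v) 40 := by
  intro H c h i pc n hi
  obtain ⟨A, L, home, hr, -⟩ := h.exists_lin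
  exact hr.lt hi

end Initial

end WritableCAS

/-! ### The theorem -/

theorem mainTheorem7 :
    ∃ (code : WritableCAS.Code) (C k : ℕ), ∀ P M : ℕ,
      ∃ (N₁ N₂ : ℕ) (recs : Fin N₂ → WritableCAS.Rec) (ints : Fin P → ℕ → ℕ),
        N₁ + N₂ ≤ C * (M + P ^ 2) ∧
        (∀ i a, C * (P + 1) ≤ a → ints i a = 0) ∧
        ∀ (V : Type u) [Nonempty V] (σ₀ : Fin M → V),
          ∃ c₀ : WritableCAS.Config P N₁ N₂ V,
            c₀.shared.recs = recs ∧
            (∀ i, (c₀.priv i).ints = ints i ∧ c₀.ctrl i = .idle) ∧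
            WritableCAS.Linearizable code c₀ σ₀ ∧
            WritableCAS.StepComplexityLE M code c₀ k ∧
            ∀ (S : Type v) (A : WritableCAS.Program P M V S),
              A.IsDelaySimulation code c₀ σ₀ k := by
  -- There are `2 * M + 3 * P ^ 2 + P` objects, and the initialized private memory ends at address
  -- `32 + 3 * P`; the constant 32 covers both. The other constant, 40, is the length of the text.
  refine ⟨WritableCAS.implementation, 32, 40, fun P M => ⟨M + 3 * P * P, M + P,
    WritableCAS.initialRecs P M, WritableCAS.initialInts P M, ?_, ?_, ?_⟩⟩
  · have : P ≤ P ^ 2 := Nat.le_self_pow two_ne_zero P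
    have : 3 * P * P = 3 * P ^ 2 := by ring
    omega
  · intro i a ha
    unfold WritableCAS.initialInts
    rw [if_neg (by omega), if_neg (by omega), if_neg (by omega), if_neg (by omega),
      if_neg (by omega)]
  · intro V hV σ₀
    -- An arbitrary value fills the pools and the private value cells, which matters for `M = 0`,
    -- where `σ₀` provides none.
    obtain ⟨v⟩ := hV
    have hlin := WritableCAS.implementation_linearizable (P := P) σ₀ v
    have hk := WritableCAS.implementation_stepComplexityLE (P := P) σ₀ v
    exact ⟨WritableCAS.initialConfig P σ₀ v, rfl, fun _ => ⟨rfl, rfl⟩, hlin, hk,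
      fun S A => A.isDelaySimulation_of_linearizable hlin hk fun _ => rfl⟩
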